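/- Let $B$ be the quaternion algebra over $\mathbb{Q}$ ramified exactly at $\infty$ and $23$, $R \subset B$ a maximal order, and $B \hookrightarrow M_2(\mathbb{Q}_2)$ an embedding taking $R$ into $M_2(\mathbb{Z}_2)$. Let $\Gamma$ be the image of $R[1/2]^\times$ in $\mathrm{GL}_2(\mathbb{Q}_2)$, $\mathbf{X} = \Gamma\backslash \mathrm{GL}_2(\mathbb{Q}_2)$ and $\mathbf{Y} = \mathbf{X}/\mathrm{GL}_2(\mathbb{Z}_2)$, where $\mathbf{X}$ carries the quotient of the Haar measure giving $\mathrm{GL}_2(\mathbb{Z}_2)$ volume $2$. For odd $m$ let $T_m\varphi(x) = \sum_{\alpha\in M_m/\Gamma}\varphi(\alpha^{-1}x)$ with $M_m = \{\alpha \in R[1/2] : \mathrm{nr}(\alpha) \in m\,\mathbb{Z}[1/2]^\times\}$; let $T_{2^r}\varphi(x) = \sum_h \varphi(xh)$, the sum over cosets $h\,\mathrm{GL}_2(\mathbb{Z}_2)$ with $h \in M_2(\mathbb{Z}_2)$ and $\det h \in 2^r\mathbb{Z}_2^\times$; and let $T_{2^r m} = T_m T_{2^r}$. Let $\Psi_1,\Psi_2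 : \mathbf{Y} \to \mathbb{R}$ be orthonormal Hecke eigenfunctions of mean zero, $T_n \Psi_k = \sqrt{n}\,\lambda_{\Psi_k}(n)\Psi_k$ for $n \ge 1$, with $L^2(\mathbf{Y}) = \mathbb{C}\oplus\mathbb{C}\Psi_1\oplus\mathbb{C}\Psi_2$. Put $L_2(\Psi_k,s) = (1-\lambda_{\Psi_k}(2)2^{-s}+2^{-2s})^{-1}$ and $\zeta_p(s) = (1-p^{-s})^{-1}$. Let $\Xi_k$ be the normalized spherical matrix coefficient of $\Psi_k$, i.e. the function on $\mathrm{PGL}_2(\mathbb{Q}_2)$ induced by $$g \mapsto \langle \Psi_k(\cdot\, g),\Psi_k\rangle_{L^2(\mathbf{X})}/\langle\Psi_k,\Psi_k\rangle_{L^2(\mathbf{X})}.$$ Let $\kappa_0>0$ be defined by $\kappa_0^{-2}2^{-2} = \big((4\pi)^2\,\zeta^{(S)}(2)\,\zeta_2(1)\,\zeta_{23}(1)\big)^{-1}$, where $S=\{2,23\}$ and $\zeta^{(S)}(s) = \zeta(s)/\prod_{p\in S}\zeta_p(s)$. Define functions $\chi_1,\chi_2,\chi_3$ on the trace-zero subspace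 $M_2(\mathbb{Q}_2)^0$ of $M_2(\mathbb{Q}_2)$ by $$\chi_1,\chi_2,\chi_3 \begin{pmatrix} a & 2b\\ 2c& -a\end{pmatrix} = (-1)^{b+c},\ (-1)^{a+c},\ (-1)^{a+b}\qquad (a,b,c\in\mathbb{Z}_2)$$ and by zero elsewhere. Put $\phi''(\beta) = 2^{-3}\kappa_0\sum_{i=1}^3\chi_i(4\beta)$, and let $\phi = 1_{\mathbb{Z}_2^\times}\otimes\phi''$, i.e. $\phi(m+\beta) = 1_{\mathbb{Z}_2^\times}(m)\,\phi''(\beta)$ for $m\in\mathbb{Q}_2$, $\beta\in M_2(\mathbb{Q}_2)^0$; then $\phi \in \mathcal{S}(M_2(\mathbb{Q}_2))$ (locally constant, compactly supported). Let $\mathrm{Ad}(g)\phi(\alpha) = \phi(g^{-1}\alpha g)$, and define $\langle\,,\rangle$ on $L^2(M_2(\mathbb{Q}_2))$ by the Haar measure that is self-dual for the Fourier transform attached to an unramified character of $\mathbb{Q}_2$ and the pairing $\langle\alpha,\alpha'\rangle=\mathrm{tr}(\alpha\alpha'^{\iota})$, where $\iota$ is the main involution. Equip $\mathrm{PGL}_2(\mathbb{Q}_2)$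 with the Haar measure giving $\mathrm{PGL}_2(\mathbb{Z}_2)$ volume one. Then for $k=1,2$ the integral $\int_{\mathrm{PGL}_2(\mathbb{Q}_2)}\langle \mathrm{Ad}(g)\phi,\phi\rangle\,\Xi_k(g)\,dg$ converges absolutely and $$\int_{\mathrm{PGL}_2(\mathbb{Q}_2)}\langle \mathrm{Ad}(g)\phi,\phi\rangle\,\Xi_k(g)\,dg = 2^{-4}\kappa_0^2\left(2+\frac{L_2(\Psi_k,\tfrac12)}{\zeta_2(2)}\right).$$ -/

import Mathlib

open MeasureTheory
open scoped Quaternion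

noncomputable section

/-! ### The `2`-adic groups -/

/-- `M₂(ℚ₂)`, with its product topology. -/
abbrev M2 : Type := Matrix (Fin 2) (Fin 2) ℚ_[2]

/-- `GL₂(ℚ₂)`. -/
abbrev GL2 : Type := GL (Fin 2) ℚ_[2]

/-- `PGL₂(ℚ₂)`: the quotient of `GL₂(ℚ₂)` by its centre. -/
abbrev PGL2 : Type := GL2 ⧸ Subgroup.center GL2

instance instMeasurableSpaceM2 : MeasurableSpace M2 := borel M2

instance instBorelSpaceM2 : BorelSpace M2 := ⟨rfl⟩

/-- `M₂(ℤ₂)`, as a subset of `M₂(ℚ₂)`. -/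
def integralM2 : Set M2 := {β | ∀ i j, ‖β i j‖ ≤ 1}

/-- `K = GL₂(ℤ₂)`, as a subgroup of `GL₂(ℚ₂)`. -/
def K2 : Subgroup GL2 :=
  (Matrix.GeneralLinearGroup.map (n := Fin 2) (algebraMap ℤ_[2] ℚ_[2])).range

/-- `PGL₂(ℤ₂)`: the image of `GL₂(ℤ₂)` in `PGL₂(ℚ₂)`. -/
def PK2 : Subgroup PGL2 := K2.map (QuotientGroup.mk' (Subgroup.center GL2))

/-- `2`, as a unit of `ℚ₂`. -/
def twoUnit : ℚ_[2]ˣ := Units.mk0 2 two_ne_zero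

/-- An element of the centre of `GL₂(ℚ₂)` is a power of `2` times an element of `GL₂(ℤ₂)`. -/
theorem center_decomp (z : GL2) (hz : z ∈ Subgroup.center GL2) :
    ∃ (m : ℤ) (u : GL2), u ∈ K2 ∧
      z = (Matrix.GeneralLinearGroup.scalar (Fin 2) twoUnit) ^ m * u := by
  rw [Matrix.GeneralLinearGroup.center_eq_range_scalar] at hz
  obtain ⟨c, rfl⟩ := hz
  set m : ℤ := (c : ℚ_[2]).valuation with hm
  have hn : ‖((twoUnit ^ (-m) * c : ℚ_[2]ˣ) : ℚ_[2])‖ = 1 := by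
    have h2 : ‖(2 : ℚ_[2])‖ = 2⁻¹ := by
      have := Padic.norm_p (p := 2)
      simpa using this
    have hc := Padic.norm_eq_zpow_neg_valuation (p := 2) c.ne_zero
    rw [← hm] at hc
    simp only [twoUnit, Units.val_mul, Units.val_zpow_eq_zpow_val, Units.val_mk0, norm_mul,
      norm_zpow, h2, hc]
    push_cast
    rw [inv_zpow', neg_neg, ← zpow_add₀ (by norm_num)]
    simp
  let v : ℤ_[2]ˣ := PadicInt.mkUnits hn
  refine ⟨m, Matrix.GeneralLinearGroup.scalar (Fin 2) (twoUnit ^ (-m) * c),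
    ⟨Matrix.GeneralLinearGroup.scalar (Fin 2) v, ?_⟩, ?_⟩
  · ext i j
    change (((Matrix.scalar (Fin 2) ((v : ℤ_[2])) : Matrix (Fin 2) (Fin 2) ℤ_[2]) i j : ℤ_[2]) : ℚ_[2])
      = (Matrix.scalar (Fin 2) ((twoUnit ^ (-m) * c : ℚ_[2]ˣ) : ℚ_[2]) : M2) i j
    rw [Matrix.scalar_apply, Matrix.scalar_apply, Matrix.diagonal_apply, Matrix.diagonal_apply]
    split_ifs
    · rfl
    · rfl
  · rw [← map_zpow, ← map_mul]
    simp

/-- Conjugation of `M₂(ℚ₂)` by `GL₂(ℚ₂)`. -/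
def conjM2 : GL2 →* Function.End M2 where
  toFun g := fun β => (g : M2) * β * ((g⁻¹ : GL2) : M2)
  map_one' := by
    funext β
    change ((1 : GL2) : M2) * β * (((1 : GL2)⁻¹ : GL2) : M2) = β
    simp
  map_mul' g h := by
    funext β
    change ((g * h : GL2) : M2) * β * (((g * h)⁻¹ : GL2) : M2)
      = (g : M2) * ((h : M2) * β * ((h⁻¹ : GL2) : M2)) * ((g⁻¹ : GL2) : M2)
    rw [mul_inv_rev]
    simp only [Units.val_mul, mul_assoc]

theorem conjM2_center (z : GL2) (hz : z ∈ Subgroup.center GL2) : conjM2 z = 1 := by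
  rw [Matrix.GeneralLinearGroup.center_eq_range_scalar] at hz
  obtain ⟨c, rfl⟩ := hz
  funext β
  change ((Matrix.GeneralLinearGroup.scalar (Fin 2) c : GL2) : M2) * β *
    (((Matrix.GeneralLinearGroup.scalar (Fin 2) c)⁻¹ : GL2) : M2) = β
  have h : ((Matrix.GeneralLinearGroup.scalar (Fin 2) c : GL2) : M2) * β
      = β * ((Matrix.GeneralLinearGroup.scalar (Fin 2) c : GL2) : M2) :=
    (Matrix.scalar_commute (n := Fin 2) (c : ℚ_[2]) (fun r => Commute.all _ r) β).eq
  rw [h, mul_assoc, Units.mul_inv, mul_one]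

/-- The adjoint action of `PGL₂(ℚ₂)` on `M₂(ℚ₂)`: the class of `g` acts by `β ↦ g β g⁻¹`. -/
def Ad : PGL2 →* Function.End M2 :=
  QuotientGroup.lift (Subgroup.center GL2) conjM2 conjM2_center

/-- `(Ad(g) φ)(β) = φ(Ad(g)⁻¹ β)`. -/
def AdFun (g : PGL2) (φ : M2 → ℂ) : M2 → ℂ := fun β => φ (Ad g⁻¹ β)

/-! ### The Fourier transform and the inner product on `M₂(ℚ₂)` -/

/-- The trace pairing `⟨α, β⟩ = tr(α β^ι)`, where `β^ι` is the main involution. -/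
def tracePairing (α β : M2) : ℚ_[2] := (α * β.adjugate).trace

/-- `ψ` is an unramified character of `ℚ₂`: continuous, with
`{x | ψ is trivial on x ℤ₂} = ℤ₂`. -/
def IsUnramifiedChar (ψ : AddChar ℚ_[2] Circle) : Prop :=
  Continuous ψ ∧ ∀ x : ℚ_[2], (∀ y : ℚ_[2], ‖y‖ ≤ 1 → ψ (x * y) = 1) ↔ ‖x‖ ≤ 1

/-- The Fourier transform on `M₂(ℚ₂)` with respect to `ψ`, the trace pairing and `ν`. -/
def fourierM2 (ψ : AddChar ℚ_[2] Circle) (ν : Measure M2) (φ : M2 → ℂ) (α : M2) : ℂ :=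
  ∫ β, φ β * (ψ (tracePairing α β) : ℂ) ∂ν

/-- Schwartz--Bruhat functions on `M₂(ℚ₂)`. -/
def IsSchwartzBruhat (φ : M2 → ℂ) : Prop := IsLocallyConstant φ ∧ HasCompactSupport φ

/-- `ν` is self-dual for the Fourier transform: `𝓕 𝓕 φ (α) = φ (-α)` for all Schwartz--Bruhat
`φ`. -/
def IsSelfDual (ψ : AddChar ℚ_[2] Circle) (ν : Measure M2) : Prop :=
  ∀ φ : M2 → ℂ, IsSchwartzBruhat φ → ∀ α, fourierM2 ψ ν (fourierM2 ψ ν φ) α = φ (-α)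

/-- The inner product of `L²(M₂(ℚ₂), ν)`. -/
def innerM2 (ν : Measure M2) (φ₁ φ₂ : M2 → ℂ) : ℂ := ∫ α, φ₁ α * star (φ₂ α) ∂ν

/-! ### The constant `κ₀` -/

/-- `ζ_p(s) = (1 - p^{-s})⁻¹`. -/
def zetaLocal (p : ℕ) (s : ℝ) : ℝ := (1 - (p : ℝ) ^ (-s))⁻¹

/-- `κ₁ = 1 / ((4π)² ζ^{(S)}(2) ζ₂(1) ζ₂₃(1))`, where `S = {2, 23}` and `ζ^{(S)}` is the zeta
function without its Euler factors in `S`. -/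
def kappa1 : ℝ :=
  1 / ((4 * Real.pi) ^ 2 * ((riemannZeta 2).re / (zetaLocal 2 2 * zetaLocal 23 2)) *
    zetaLocal 2 1 * zetaLocal 23 1)

/-- The positive number `κ₀` with `κ₁ = κ₀⁻² 2⁻²`. -/
def kappa0 : ℝ := (2 * √kappa1)⁻¹

theorem kappa1_pos : 0 < kappa1 := by
  have h : (riemannZeta 2).re = Real.pi ^ 2 / 6 := by
    rw [riemannZeta_two]
    norm_cast
  have hp := Real.pi_pos
  unfold kappa1
  rw [h]
  norm_num [zetaLocal, Real.rpow_neg, Real.rpow_two]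
  positivity

theorem kappa0_spec : 0 < kappa0 ∧ kappa1 = kappa0 ^ (-2 : ℤ) * 2 ^ (-2 : ℤ) := by
  have h := kappa1_pos
  have h' := Real.sqrt_pos.2 h
  refine ⟨by unfold kappa0; positivity, ?_⟩
  have h2 := Real.sq_sqrt h.le
  unfold kappa0
  rw [inv_zpow, zpow_neg, inv_inv, zpow_neg]
  norm_cast
  rw [mul_pow, h2]
  norm_num
  ring

/-! ### The Schwartz--Bruhat function `φ` -/

/-- The quadratic character of `ℤ₂ / 2ℤ₂`, that is `x ↦ (-1)^x`. -/
def sgn2 (x : ℚ_[2]) : ℂ := if ‖x‖ < 1 then 1 else -1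

open Classical in
/-- For `β` in the trace-zero lattice `S⁰` of all `(a, 2b; 2c, -a)` with `a, b, c ∈ ℤ₂`,
`χ₁(β) = (-1)^{b+c}`, `χ₂(β) = (-1)^{a+c}`, `χ₃(β) = (-1)^{a+b}`; extended by zero. The index
`0, 1, 2` stands for `1, 2, 3`. -/
def chi (i : Fin 3) (β : M2) : ℂ :=
  let a := β 0 0
  let b := β 0 1 / 2
  let c := β 1 0 / 2
  if β.trace = 0 ∧ ‖a‖ ≤ 1 ∧ ‖b‖ ≤ 1 ∧ ‖c‖ ≤ 1 then
    ![sgn2 (b + c), sgn2 (a + c), sgn2 (a + b)] i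
  else 0

/-- `φ'' (β) = 2⁻³ κ₀ ∑ᵢ χᵢ(4β)` for trace-zero `β`. -/
def phi'' (β : M2) : ℂ := 2 ^ (-3 : ℤ) * (kappa0 : ℂ) * ∑ i : Fin 3, chi i ((4 : ℚ_[2]) • β)

/-- `φ'`, the characteristic function of `ℤ₂ˣ`. -/
def phi' (m : ℚ_[2]) : ℂ := if ‖m‖ = 1 then 1 else 0

/-- `φ(m + β) = φ'(m) φ''(β)` for scalar `m` and trace-zero `β`. -/
def phi (α : M2) : ℂ :=
  let m := α.trace / 2
  phi' m * phi'' (α - Matrix.scalar (Fin 2) m)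

/-! ### The quaternion algebra and the group `Γ` -/

/-- The quaternion algebra `(a, b / ℚ)` is ramified exactly at `∞` and `23`. -/
def IsRamifiedAtInftyAnd23 (a b : ℚ) : Prop :=
  (∀ x : ℍ[ℝ, (a : ℝ), (b : ℝ)], x ≠ 0 → IsUnit x) ∧
  ∀ (p : ℕ) [Fact p.Prime],
    (p = 23 → ∀ x : ℍ[ℚ_[p], (a : ℚ_[p]), (b : ℚ_[p])], x ≠ 0 → IsUnit x) ∧
    (p ≠ 23 → Nonempty (ℍ[ℚ_[p], (a : ℚ_[p]), (b : ℚ_[p])] ≃ₐ[ℚ_[p]]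
      Matrix (Fin 2) (Fin 2) ℚ_[p]))

section Quaternion

variable {a b : ℚ}

/-- `R` is an order: a subring, finitely generated over `ℤ`, that spans the algebra over `ℚ`. -/
def IsOrder (R : Subring ℍ[ℚ, a, b]) : Prop :=
  R.toAddSubgroup.FG ∧ Submodule.span ℚ (R : Set ℍ[ℚ, a, b]) = ⊤

/-- `R[1/2]`. -/
def invertTwo (R : Subring ℍ[ℚ, a, b]) : Subring ℍ[ℚ, a, b] where
  carrier := {x | ∃ n : ℕ, (2 : ℚ) ^ n • x ∈ R}
  zero_mem' := ⟨0, by simp⟩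
  one_mem' := ⟨0, by simp⟩
  mul_mem' := by
    rintro x y ⟨m, hm⟩ ⟨n, hn⟩
    refine ⟨m + n, ?_⟩
    have h := R.mul_mem hm hn
    rwa [smul_mul_smul_comm, ← pow_add] at h
  add_mem' := by
    rintro x y ⟨m, hm⟩ ⟨n, hn⟩
    refine ⟨m + n, ?_⟩
    have key : ∀ (k : ℕ) (z : ℍ[ℚ, a, b]), z ∈ R → (2 : ℚ) ^ k • z ∈ R := by
      intro k z hz
      have h := R.nsmul_mem hz (2 ^ k)
      rwa [← Nat.cast_smul_eq_nsmul ℚ, Nat.cast_pow, Nat.cast_ofNat] at h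
    rw [smul_add]
    refine R.add_mem ?_ ?_
    · rw [pow_add, mul_comm, mul_smul]
      exact key n _ hm
    · rw [pow_add, mul_smul]
      exact key m _ hn
  neg_mem' := by
    rintro x ⟨n, hn⟩
    exact ⟨n, by rw [smul_neg]; exact R.neg_mem hn⟩

/-- The reduced norm. -/
def reducedNorm (x : ℍ[ℚ, a, b]) : ℚ := (x * star x).re

/-- `Γ`: the image of `R[1/2]ˣ` in `GL₂(ℚ₂)`. -/
def Gam (R : Subring ℍ[ℚ, a, b]) (ι : ℍ[ℚ, a, b] →ₐ[ℚ] M2) : Subgroup GL2 :=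
  (Units.map ((ι : ℍ[ℚ, a, b] →* M2).comp ((invertTwo R).subtype : invertTwo R →* ℍ[ℚ, a, b]))).range

theorem scalar_two_mem_Gam (R : Subring ℍ[ℚ, a, b]) (ι : ℍ[ℚ, a, b] →ₐ[ℚ] M2) :
    Matrix.GeneralLinearGroup.scalar (Fin 2) twoUnit ∈ Gam R ι := by
  have h2 : (2 : ℍ[ℚ, a, b]) ∈ invertTwo R :=
    ⟨0, by rw [pow_zero, one_smul, ← one_add_one_eq_two]; exact R.add_mem R.one_mem R.one_mem⟩
  have e : (2 : ℚ) • algebraMap ℚ ℍ[ℚ, a, b] (1 / 2) = 1 := by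
    rw [Algebra.smul_def, ← map_mul]
    norm_num
  have hh : algebraMap ℚ ℍ[ℚ, a, b] (1 / 2) ∈ invertTwo R :=
    ⟨1, by rw [pow_one, e]; exact R.one_mem⟩
  have e1 : (2 : ℍ[ℚ, a, b]) * algebraMap ℚ ℍ[ℚ, a, b] (1 / 2) = 1 := by
    rw [← map_ofNat (algebraMap ℚ ℍ[ℚ, a, b]) 2, ← map_mul]
    norm_num
  have e2 : algebraMap ℚ ℍ[ℚ, a, b] (1 / 2) * 2 = 1 := by
    rw [← map_ofNat (algebraMap ℚ ℍ[ℚ, a, b]) 2, ← map_mul]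
    norm_num
  refine ⟨⟨⟨2, h2⟩, ⟨_, hh⟩, Subtype.ext e1, Subtype.ext e2⟩, ?_⟩
  ext1
  change ι 2 = Matrix.scalar (Fin 2) (2 : ℚ_[2])
  rw [map_ofNat, map_ofNat]

/-- A real-valued function on `𝐘 = Γ \ GL₂(ℚ₂) / GL₂(ℤ₂)`. -/
structure FunY (R : Subring ℍ[ℚ, a, b]) (ι : ℍ[ℚ, a, b] →ₐ[ℚ] M2) where
  toFun : GL2 → ℝ
  left_inv : ∀ γ ∈ Gam R ι, ∀ x, toFun (γ * x) = toFun x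
  right_inv : ∀ k ∈ K2, ∀ x, toFun (x * k) = toFun x

/-! ### Hecke operators -/

/-- `M_m = {α ∈ R[1/2] : nr(α) ∈ m ℤ[1/2]ˣ}`, as a subset of `GL₂(ℚ₂)`. -/
def heckeSet (R : Subring ℍ[ℚ, a, b]) (ι : ℍ[ℚ, a, b] →ₐ[ℚ] M2) (m : ℕ) : Set GL2 :=
  {g | ∃ α ∈ invertTwo R, ι α = (g : M2) ∧
    ∃ k : ℤ, reducedNorm α = m * 2 ^ k ∨ reducedNorm α = -(m * 2 ^ k)}

/-- For odd `m`, `T_m φ (x) = ∑_{α ∈ M_m / Γ} φ(α⁻¹ x)`, for left `Γ`-invariant `φ`. -/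
def heckeOdd (R : Subring ℍ[ℚ, a, b]) (ι : ℍ[ℚ, a, b] →ₐ[ℚ] M2) (m : ℕ) (φ : GL2 → ℝ) :
    GL2 → ℝ := fun x =>
  ∑ᶠ (c : GL2 ⧸ Gam R ι) (_ : c ∈ (QuotientGroup.mk '' heckeSet R ι m : Set (GL2 ⧸ Gam R ι))),
    φ (c.out⁻¹ * x)

/-- `T_{2^r} φ (x) = ∑ φ(x h)`, for right `K`-invariant `φ`; the sum is over the cosets `h K` of
integral matrices `h` whose determinant has valuation `r`. -/
def heckeTwoPow (r : ℕ) (φ : GL2 → ℝ) : GL2 → ℝ := fun x =>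
  ∑ᶠ (c : GL2 ⧸ K2) (_ : c ∈ (QuotientGroup.mk ''
      {h : GL2 | (h : M2) ∈ integralM2 ∧ ‖(h : M2).det‖ = 2 ^ (-(r : ℤ))} : Set (GL2 ⧸ K2))),
    φ (x * c.out)

/-- The Hecke operator `T_n` on functions on `𝐘`: `T_{2^r m} = T_m T_{2^r}` for odd `m`. -/
def hecke (R : Subring ℍ[ℚ, a, b]) (ι : ℍ[ℚ, a, b] →ₐ[ℚ] M2) (n : ℕ) (φ : GL2 → ℝ) :
    GL2 → ℝ :=
  heckeOdd R ι (n / 2 ^ n.factorization 2) (heckeTwoPow (n.factorization 2) φ)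

/-! ### The eigenfunctions and their spherical matrix coefficients -/

/-- `⟨f₁, f₂⟩` in `L²(Γ \ GL₂(ℚ₂))`, for real-valued left `Γ`-invariant functions, where the
quotient measure is computed on a fundamental domain `D` for `Γ`. -/
def innerX (μ : Measure GL2) (D : Set GL2) (f₁ f₂ : GL2 → ℝ) : ℝ := ∫ x in D, f₁ x * f₂ x ∂μ

/-- `Ψ₁, Ψ₂` are real-valued Hecke eigenfunctions on `𝐘`, with `T_n Ψ_k = √n λ_k(n) Ψ_k`, which are
orthonormal and of mean zero, and `L²(𝐘)` is the span of `1, Ψ₁, Ψ₂`. The index `0, 1` stands for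
`1, 2`. -/
structure IsHeckeBasis {R : Subring ℍ[ℚ, a, b]} {ι : ℍ[ℚ, a, b] →ₐ[ℚ] M2}
    (μ : Measure GL2) (D : Set GL2) (Ψ : Fin 2 → FunY R ι) (lam : Fin 2 → ℕ → ℝ) : Prop where
  eigen : ∀ k, ∀ n : ℕ, 1 ≤ n → ∀ x,
    hecke R ι n (Ψ k).toFun x = √n * lam k n * (Ψ k).toFun x
  mean_zero : ∀ k, innerX μ D (Ψ k).toFun (fun _ => 1) = 0
  orthonormal : ∀ k l, innerX μ D (Ψ k).toFun (Ψ l).toFun = if k = l then 1 else 0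
  span : ∀ f : FunY R ι, ∃ c₀ c₁ c₂ : ℝ, ∀ x,
    f.toFun x = c₀ + c₁ * (Ψ 0).toFun x + c₂ * (Ψ 1).toFun x

variable {R : Subring ℍ[ℚ, a, b]} {ι : ℍ[ℚ, a, b] →ₐ[ℚ] M2}

/-- The normalized matrix coefficient `⟨π(g) Ψ, Ψ⟩ / ⟨Ψ, Ψ⟩`, where `GL₂(ℚ₂)` acts on
`L²(Γ \ GL₂(ℚ₂))` by right translation. -/
def matCoeff (μ : Measure GL2) (D : Set GL2) (Ψ : FunY R ι) (g : GL2) : ℝ :=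
  innerX μ D (fun x => Ψ.toFun (x * g)) Ψ.toFun / innerX μ D Ψ.toFun Ψ.toFun

theorem FunY.mul_center (Ψ : FunY R ι) (z : GL2) (hz : z ∈ Subgroup.center GL2) (x : GL2) :
    Ψ.toFun (x * z) = Ψ.toFun x := by
  obtain ⟨m, u, hu, rfl⟩ := center_decomp z hz
  have hc : (Matrix.GeneralLinearGroup.scalar (Fin 2) twoUnit) ^ m ∈ Subgroup.center GL2 := by
    rw [Matrix.GeneralLinearGroup.center_eq_range_scalar]
    exact Subgroup.zpow_mem _ (MonoidHom.mem_range.2 ⟨_, rfl⟩) m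
  rw [← mul_assoc, Ψ.right_inv u hu, Subgroup.mem_center_iff.1 hc x]
  exact Ψ.left_inv _ (Subgroup.zpow_mem _ (scalar_two_mem_Gam R ι) m) x

/-- `Ξ`: the normalized spherical matrix coefficient of `Ψ`, as a function on `PGL₂(ℚ₂)`. -/
def Xi (μ : Measure GL2) (D : Set GL2) (Ψ : FunY R ι) : PGL2 → ℝ :=
  Quotient.lift (matCoeff μ D Ψ) (by
    intro g h hgh
    have hz : g⁻¹ * h ∈ Subgroup.center GL2 := QuotientGroup.leftRel_apply.1 hgh
    have e : h = g * (g⁻¹ * h) := by group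
    have hf : (fun x => Ψ.toFun (x * h)) = fun x => Ψ.toFun (x * g) := by
      funext x
      rw [e, ← mul_assoc, Ψ.mul_center _ hz]
    unfold matCoeff
    rw [hf])

end Quaternion

/-- The Euler factor at `2` of `L(Ψ, s) = ∑ λ(n) n^{-s}`, in terms of `λ(2)`:
`L₂(Ψ, s) = (1 - λ(2) 2^{-s} + 2^{-2s})⁻¹`. -/
def eulerFactorTwo (lam : ℕ → ℝ) (s : ℝ) : ℝ :=
  (1 - lam 2 * 2 ^ (-s) + 2 ^ (-(2 * s)))⁻¹

end

noncomputable section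

/-! ### The topology of `GL₂(ℚ₂)` and `PGL₂(ℚ₂)` -/

/-! Write K = GL₂(ℤ₂), s = √2 λ(2) and C = 2⁻⁴κ₀². Both factors of the integrand are bi-invariant
under the image of K in PGL₂(ℚ₂), so by the Cartan decomposition they depend only on the n for which
g lies in the sphere Sₙ = K diag(1,2ⁿ) K of the 3-regular tree. The integral is the sum over n of
vol(Sₙ)·⟨Ad(diag(1,2ⁿ))φ,φ⟩·ξₙ, where ξₙ is the spherical function on Sₙ, vol(S₀) = 1 and vol(Sₙ) =
3·2ⁿ⁻¹ for n ≥ 1 (`measure_sphere_succ`, `integrable_of_const_on_spheres`).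

The coefficient of φ: self-duality forces M₂(ℤ₂) to have volume one (`measure_integralM2`). After a
linear change of variables the integrand depends only on residues modulo 2, and orthogonality of
characters of (ℤ/2)³ gives 3C for n = 0 and C·2⁻ⁿ for n ≥ 1 (`innerM2_dia_zero`,
`innerM2_dia_succ`).

The spherical function: T₂ sums over the three neighbours of a vertex, so ξ₀ = 1, 3ξ₁ = s and ξₙ +
2ξₙ₊₂ = sξₙ₊₁. Summing the recurrence gives Σ_{n≥1} ξₙ = (2s−3)/(3(3−s)) (`hasSum_of_recurrence`).
The powers of 2 cancel, and the integral is C(3 + (3/2)Σ_{n≥1} ξₙ) = C(2 + 3/(2(3−s))), whose last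
term is L₂(Ψ,1/2)/ζ₂(2).

Absolute convergence thus amounts to Σ|ξₙ| < ∞, for which |s| < 3 suffices
(`summable_of_recurrence`); the Ramanujan bound is not needed. The maximum principle on the finite
quotient graph gives |s| ≤ 3. Equality s = 3 makes Ψ constant, against mean zero. Equality s = −3
makes the graph bipartite. By the dimension of L²(𝐘) it has exactly three vertices, so one colour
class is a single vertex. Counting edges weighted by the orders of vertex stabilizers in Γ then
forces one of these orders to be divisible by 12. Such a stabilizer contains elements of orders 3
and 4, and an explicit zero divisor over ℚ₂₃ excludes this (`not_exists_order_three_four`,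
`not_dvd_card_stab`, `abs_eigenvalue_lt_three`). -/

instance instPolishSpaceM2 : PolishSpace M2 :=
  inferInstanceAs (PolishSpace (Fin 2 → Fin 2 → ℚ_[2]))

instance instLocallyCompactSpaceM2 : LocallyCompactSpace M2 :=
  inferInstanceAs (LocallyCompactSpace (Fin 2 → Fin 2 → ℚ_[2]))

/-- Inversion is A ↦ det(A)⁻¹ adj(A), continuous where det ≠ 0, so the topology of the unit group is
the subspace topology of an open set. The Polish, locally compact and Borel structures on `GL2` come
from this. -/
theorem GL2.isOpenEmbedding_val : Topology.IsOpenEmbedding (Units.val : GL2 → M2) := by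
  refine ⟨Units.isEmbedding_val_mk' (f := fun A : M2 => A.det⁻¹ • A.adjugate) ?_ ?_, ?_⟩
  · refine ContinuousOn.smul (ContinuousOn.inv₀
      (by fun_prop : Continuous fun A : M2 => A.det).continuousOn ?_)
      (by fun_prop : Continuous fun A : M2 => A.adjugate).continuousOn
    intro A hA
    exact ((Matrix.isUnit_iff_isUnit_det A).1 hA).ne_zero
  · intro u
    rw [Matrix.coe_units_inv, Matrix.inv_def, Ring.inverse_eq_inv]
  · have : Set.range (Units.val : GL2 → M2) = {A | A.det ≠ 0} := by
      ext A
      rw [Set.mem_ofPred_eq, ← isUnit_iff_ne_zero, ← Matrix.isUnit_iff_isUnit_det]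
      exact Iff.rfl
    rw [this]
    exact isOpen_ne.preimage (by fun_prop : Continuous fun A : M2 => A.det)

instance instPolishSpaceGL2 : PolishSpace GL2 := by
  have := GL2.isOpenEmbedding_val.isOpen_range.polishSpace
  exact GL2.isOpenEmbedding_val.isEmbedding.toHomeomorph.isClosedEmbedding.polishSpace

instance instLocallyCompactSpaceGL2 : LocallyCompactSpace GL2 :=
  GL2.isOpenEmbedding_val.locallyCompactSpace

instance instBorelSpaceGL2 : BorelSpace GL2 := by
  constructor
  rw [GL2.isOpenEmbedding_val.eq_induced, borel_comap]
  rfl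

/-- With the Polish topology on `GL2`, closedness of the centre makes the quotient σ-algebra on
`PGL2` Borel. -/
instance instIsClosedCenter : IsClosed (Subgroup.center GL2 : Set GL2) := by
  have : (Subgroup.center GL2 : Set GL2) = ⋂ g : GL2, {z | g * z = z * g} := by
    ext z
    simp [Subgroup.mem_center_iff]
  rw [this]
  exact isClosed_iInter fun g => isClosed_eq (by fun_prop) (by fun_prop)

/-! ### Norms of matrices over `ℚ₂` -/

theorem norm_two_padic : ‖(2 : ℚ_[2])‖ = 2⁻¹ := by
  simpa using Padic.norm_p (p := 2)

/-- The maximum norm of a matrix. -/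
def maxNorm (β : M2) : ℝ := ‖(fun i j => β i j : Fin 2 → Fin 2 → ℚ_[2])‖

theorem maxNorm_nonneg (β : M2) : 0 ≤ maxNorm β := norm_nonneg _

theorem maxNorm_le_iff {β : M2} {r : ℝ} (hr : 0 ≤ r) : maxNorm β ≤ r ↔ ∀ i j, ‖β i j‖ ≤ r := by
  simp only [maxNorm, pi_norm_le_iff_of_nonneg hr]

theorem norm_entry_le_maxNorm (β : M2) (i j : Fin 2) : ‖β i j‖ ≤ maxNorm β :=
  (maxNorm_le_iff (maxNorm_nonneg β)).1 le_rfl i j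

theorem exists_norm_entry_eq_maxNorm (β : M2) : ∃ i j, ‖β i j‖ = maxNorm β := by
  obtain ⟨p, -, hp⟩ := Finset.exists_max_image (Finset.univ : Finset (Fin 2 × Fin 2))
    (fun p => ‖β p.1 p.2‖) Finset.univ_nonempty
  exact ⟨p.1, p.2, le_antisymm (norm_entry_le_maxNorm β _ _)
    ((maxNorm_le_iff (norm_nonneg _)).2 fun i j => hp (i, j) (Finset.mem_univ _))⟩

theorem maxNorm_mul_le (β γ : M2) : maxNorm (β * γ) ≤ maxNorm β * maxNorm γ := by
  refine (maxNorm_le_iff (mul_nonneg (maxNorm_nonneg _) (maxNorm_nonneg _))).2 fun i j => ?_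
  rw [Matrix.mul_apply, Fin.sum_univ_two]
  refine (Padic.nonarchimedean _ _).trans (max_le ?_ ?_) <;> rw [norm_mul] <;>
    exact mul_le_mul (norm_entry_le_maxNorm _ _ _) (norm_entry_le_maxNorm _ _ _) (norm_nonneg _)
      (maxNorm_nonneg _)

theorem maxNorm_smul (c : ℚ_[2]) (β : M2) : maxNorm (c • β) = ‖c‖ * maxNorm β :=
  norm_smul c (fun i j => β i j : Fin 2 → Fin 2 → ℚ_[2])

theorem maxNorm_transpose (β : M2) : maxNorm β.transpose = maxNorm β := by
  refine le_antisymm ?_ ?_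
  · exact (maxNorm_le_iff (maxNorm_nonneg _)).2 fun i j => norm_entry_le_maxNorm β j i
  · exact (maxNorm_le_iff (maxNorm_nonneg _)).2 fun i j => norm_entry_le_maxNorm β.transpose j i

theorem maxNorm_le_one_of_mem_K2 {k : GL2} (hk : k ∈ K2) : maxNorm (k : M2) ≤ 1 := by
  obtain ⟨u, rfl⟩ := hk
  exact (maxNorm_le_iff zero_le_one).2 fun i j => PadicInt.norm_le_one _

theorem norm_det_of_mem_K2 {k : GL2} (hk : k ∈ K2) : ‖(k : M2).det‖ = 1 := by
  obtain ⟨u, rfl⟩ := hk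
  have h : ((Matrix.GeneralLinearGroup.map (n := Fin 2) (algebraMap ℤ_[2] ℚ_[2]) u : GL2) : M2).det
      = algebraMap ℤ_[2] ℚ_[2] ((u : Matrix (Fin 2) (Fin 2) ℤ_[2]).det) :=
    (RingHom.map_det _ _).symm
  rw [h]
  have hu : IsUnit (u : Matrix (Fin 2) (Fin 2) ℤ_[2]).det :=
    (Matrix.isUnit_iff_isUnit_det _).1 u.isUnit
  exact PadicInt.isUnit_iff.1 hu

theorem mem_K2_iff {k : GL2} : k ∈ K2 ↔ maxNorm (k : M2) ≤ 1 ∧ ‖(k : M2).det‖ = 1 := by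
  refine ⟨fun h => ⟨maxNorm_le_one_of_mem_K2 h, norm_det_of_mem_K2 h⟩, fun ⟨h1, h2⟩ => ?_⟩
  rw [maxNorm_le_iff zero_le_one] at h1
  let A : Matrix (Fin 2) (Fin 2) ℤ_[2] := fun i j => ⟨(k : M2) i j, h1 i j⟩
  have hA : algebraMap ℤ_[2] ℚ_[2] A.det = (k : M2).det := RingHom.map_det _ _
  have hu : IsUnit A := by
    rw [Matrix.isUnit_iff_isUnit_det, PadicInt.isUnit_iff]
    have : ‖algebraMap ℤ_[2] ℚ_[2] A.det‖ = 1 := by rw [hA, h2]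
    exact this
  refine ⟨hu.unit, ?_⟩
  ext i j
  rfl

theorem maxNorm_mul_of_mem_K2 {k : GL2} (hk : k ∈ K2) (β : M2) :
    maxNorm ((k : M2) * β) = maxNorm β := by
  have key : ∀ k' ∈ K2, ∀ γ : M2, maxNorm (((k' : GL2) : M2) * γ) ≤ maxNorm γ := fun k' hk' γ =>
    (maxNorm_mul_le _ _).trans
      (mul_le_of_le_one_left (maxNorm_nonneg _) (maxNorm_le_one_of_mem_K2 hk'))
  refine le_antisymm (key k hk β) ?_
  have := key k⁻¹ (K2.inv_mem hk) ((k : M2) * β)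
  rwa [← mul_assoc, ← Units.val_mul, inv_mul_cancel, Units.val_one, one_mul] at this

theorem maxNorm_mul_of_mem_K2' {k : GL2} (hk : k ∈ K2) (β : M2) :
    maxNorm (β * (k : M2)) = maxNorm β := by
  have key : ∀ k' ∈ K2, ∀ γ : M2, maxNorm (γ * ((k' : GL2) : M2)) ≤ maxNorm γ := fun k' hk' γ =>
    (maxNorm_mul_le _ _).trans
      (mul_le_of_le_one_right (maxNorm_nonneg _) (maxNorm_le_one_of_mem_K2 hk'))
  refine le_antisymm (key k hk β) ?_
  have := key k⁻¹ (K2.inv_mem hk) (β * (k : M2))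
  rwa [mul_assoc, ← Units.val_mul, mul_inv_cancel, Units.val_one, mul_one] at this

theorem isOpen_K2 : IsOpen (K2 : Set GL2) := by
  have h : (K2 : Set GL2) = Units.val ⁻¹' ({β : M2 | ∀ i j, β i j ∈ Metric.closedBall 0 1} ∩
      {β : M2 | β.det ∈ Metric.sphere 0 1}) := by
    ext k
    simp [mem_K2_iff, maxNorm_le_iff]
  rw [h]
  refine (IsOpen.inter ?_ ?_).preimage Units.continuous_val
  · simp only [Set.ofPred_forall]
    refine isOpen_iInter_of_finite fun i => isOpen_iInter_of_finite fun j => ?_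
    exact (IsUltrametricDist.isOpen_closedBall 0 one_ne_zero).preimage (by fun_prop)
  · exact (IsUltrametricDist.isOpen_sphere 0 one_ne_zero).preimage
      (by fun_prop : Continuous fun A : M2 => A.det)

/-! ### The Cartan decomposition -/

theorem det_ne_zero_GL2 (g : GL2) : (g : M2).det ≠ 0 :=
  ((Matrix.isUnit_iff_isUnit_det _).1 g.isUnit).ne_zero

/-- The function `‖g‖² / |det g|` on `GL₂(ℚ₂)`: the exponential of the distance on the tree from
the base vertex to its image under `g`. -/
def size (g : GL2) : ℝ := maxNorm (g : M2) ^ 2 / ‖(g : M2).det‖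

/-- The matrices `diag(1, 2ⁿ)`. -/
def dia (n : ℕ) : GL2 := Matrix.GeneralLinearGroup.mkOfDetNeZero !![1, 0; 0, 2 ^ n] (by simp)

theorem dia_val (n : ℕ) : (dia n : M2) = !![1, 0; 0, 2 ^ n] := rfl

/-- Representatives for the three cosets of `K2` in the double coset of `diag(1, 2)`. -/
def nbrM (i : Fin 3) : M2 := ![!![2, 0; 0, 1], !![2, 1; 0, 1], !![1, 0; 0, 2]] i

theorem det_nbrM (i : Fin 3) : (nbrM i).det = 2 := by
  fin_cases i <;> simp [nbrM, Matrix.det_fin_two]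

def nbr (i : Fin 3) : GL2 :=
  Matrix.GeneralLinearGroup.mkOfDetNeZero (nbrM i) (by rw [det_nbrM]; norm_num)

theorem nbr_val (i : Fin 3) : (nbr i : M2) = nbrM i := rfl

/-- `g` is in `Z K diag(1, 2ⁿ) K`. -/
def InCartan (n : ℕ) (g : GL2) : Prop :=
  ∃ z ∈ Subgroup.center GL2, ∃ k₁ ∈ K2, ∃ k₂ ∈ K2, g = z * k₁ * dia n * k₂

theorem InCartan.K2_mul {n : ℕ} {g k : GL2} (hk : k ∈ K2) (h : InCartan n g) :
    InCartan n (k * g) := by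
  obtain ⟨z, hz, k₁, h₁, k₂, h₂, rfl⟩ := h
  refine ⟨z, hz, k * k₁, K2.mul_mem hk h₁, k₂, h₂, ?_⟩
  have := Subgroup.mem_center_iff.1 hz k
  simp only [← mul_assoc, this]

theorem InCartan.mul_K2 {n : ℕ} {g k : GL2} (hk : k ∈ K2) (h : InCartan n g) :
    InCartan n (g * k) := by
  obtain ⟨z, hz, k₁, h₁, k₂, h₂, rfl⟩ := h
  exact ⟨z, hz, k₁, h₁, k₂ * k, K2.mul_mem h₂ hk, by simp only [mul_assoc]⟩

/-- The Weyl element. -/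
def weyl : GL2 := Matrix.GeneralLinearGroup.mkOfDetNeZero !![0, 1; 1, 0] (by simp)

theorem weyl_mem : weyl ∈ K2 := by
  rw [mem_K2_iff, maxNorm_le_iff zero_le_one]
  refine ⟨fun i j => ?_, ?_⟩
  · change ‖(!![0, 1; 1, 0] : M2) i j‖ ≤ 1
    fin_cases i <;> fin_cases j <;> simp
  · change ‖(!![0, 1; 1, 0] : M2).det‖ = 1
    simp [Matrix.det_fin_two]

theorem weyl_mul_weyl : weyl * weyl = 1 := by
  ext i j
  change ((!![0, 1; 1, 0] : M2) * (!![0, 1; 1, 0] : M2) : M2) i j = (1 : M2) i j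
  fin_cases i <;> fin_cases j <;> simp

/-- Elimination with the entry of largest norm as pivot: all quotients by it are integral, so the
row and column operations lie in `K2`, and the remaining diagonal entry is a unit times a power of
2. -/
theorem exists_inCartan_of_norm_le (g : GL2) (hg : ∀ i j, ‖(g : M2) i j‖ ≤ ‖(g : M2) 0 0‖) :
    ∃ n, InCartan n g := by
  set c := (g : M2) 0 0 with hc
  have hdet := det_ne_zero_GL2 g
  have hc0 : c ≠ 0 := by
    intro h0
    refine hdet ?_
    have : ∀ i j, (g : M2) i j = 0 := fun i j => by simpa [h0] using hg i j
    simp [Matrix.det_fin_two, this]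
  have hb : ∀ i j, ∃ q, c * q = (g : M2) i j ∧ ‖q‖ ≤ 1 := fun i j =>
    ⟨(g : M2) i j / c, mul_div_cancel₀ _ hc0, by
      rw [norm_div]
      exact div_le_one_of_le₀ (hg i j) (norm_nonneg _)⟩
  obtain ⟨q, h01, hq⟩ := hb 0 1
  obtain ⟨r, h10, hr⟩ := hb 1 0
  obtain ⟨s, h11, hs⟩ := hb 1 1
  set d := s - r * q with hd
  have hd0 : d ≠ 0 := by
    intro h0
    refine hdet ?_
    rw [Matrix.det_fin_two, ← hc, ← h01, ← h10, ← h11]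
    linear_combination c ^ 2 * h0
  have hd1 : ‖d‖ ≤ 1 := by
    have h1 : ‖r * q‖ ≤ 1 := by
      rw [norm_mul]
      exact mul_le_one₀ hr (norm_nonneg _) hq
    rw [hd, sub_eq_add_neg]
    exact (Padic.nonarchimedean _ _).trans (max_le hs (by rwa [norm_neg]))
  obtain ⟨n, hn⟩ : ∃ n : ℕ, ‖d‖ = 2⁻¹ ^ n := by
    have hv : 0 ≤ d.valuation := (Padic.norm_le_one_iff_val_nonneg d).1 hd1
    obtain ⟨n, hn⟩ := Int.eq_ofNat_of_zero_le hv
    refine ⟨n, ?_⟩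
    have := Padic.norm_eq_zpow_neg_valuation hd0
    rw [this, hn]
    simp
  have h2n : (2 : ℚ_[2]) ^ n ≠ 0 := pow_ne_zero _ two_ne_zero
  set u := d / 2 ^ n with hu
  have hu1 : ‖u‖ = 1 := by
    rw [hu, norm_div, norm_pow, norm_two_padic, hn, div_self (by positivity)]
  have hu0 : u ≠ 0 := by
    rw [← norm_ne_zero_iff, hu1]
    exact one_ne_zero
  refine ⟨n, Matrix.GeneralLinearGroup.scalar (Fin 2) (Units.mk0 c hc0), ?_,
    Matrix.GeneralLinearGroup.mkOfDetNeZero !![1, 0; r, u] (by simpa using hu0), ?_,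
    Matrix.GeneralLinearGroup.mkOfDetNeZero !![1, q; 0, 1] (by simp), ?_, ?_⟩
  · rw [Matrix.GeneralLinearGroup.center_eq_range_scalar]
    exact ⟨_, rfl⟩
  · rw [mem_K2_iff, maxNorm_le_iff zero_le_one]
    refine ⟨fun i j => ?_, ?_⟩
    · change ‖(!![1, 0; r, u] : M2) i j‖ ≤ 1
      fin_cases i <;> fin_cases j <;> simp [hu1, hr]
    · change ‖(!![1, 0; r, u] : M2).det‖ = 1
      simp [Matrix.det_fin_two, hu1]
  · rw [mem_K2_iff, maxNorm_le_iff zero_le_one]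
    refine ⟨fun i j => ?_, ?_⟩
    · change ‖(!![1, q; 0, 1] : M2) i j‖ ≤ 1
      fin_cases i <;> fin_cases j <;> simp [hq]
    · change ‖(!![1, q; 0, 1] : M2).det‖ = 1
      simp [Matrix.det_fin_two]
  · have hu2 : u * 2 ^ n = s - r * q := by rw [hu, div_mul_cancel₀ _ h2n]
    have e : (g : M2) = Matrix.scalar (Fin 2) c * !![1, 0; r, u] * !![1, 0; 0, 2 ^ n] *
        !![1, q; 0, 1] := by
      ext i j
      fin_cases i <;> fin_cases j <;>
        simp [Matrix.mul_apply, Fin.sum_univ_two, Matrix.scalar_apply, ← hc, h01, h10, ← h11]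
      linear_combination (-c) * hu2 + q * h10
    ext1
    exact e

theorem exists_inCartan (g : GL2) : ∃ n, InCartan n g := by
  obtain ⟨i, j, hij⟩ := exists_norm_entry_eq_maxNorm (g : M2)
  have hmax : ∀ i' j', ‖(g : M2) i' j'‖ ≤ ‖(g : M2) i j‖ := fun i' j' =>
    hij ▸ norm_entry_le_maxNorm _ _ _
  have hl : ∀ (h : GL2) i' j', ((weyl * h : GL2) : M2) i' j' = (h : M2) (1 - i') j' := by
    intro h i' j'
    change ((!![0, 1; 1, 0] : M2) * (h : M2)) i' j' = _
    fin_cases i' <;> simp [Matrix.mul_apply, Fin.sum_univ_two]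
  have hr : ∀ (h : GL2) i' j', ((h * weyl : GL2) : M2) i' j' = (h : M2) i' (1 - j') := by
    intro h i' j'
    change ((h : M2) * (!![0, 1; 1, 0] : M2)) i' j' = _
    fin_cases j' <;> simp [Matrix.mul_apply, Fin.sum_univ_two]
  have el : ∀ h : GL2, h = weyl * (weyl * h) := fun h => by
    rw [← mul_assoc, weyl_mul_weyl, one_mul]
  have er : ∀ h : GL2, h = h * weyl * weyl := fun h => by
    rw [mul_assoc, weyl_mul_weyl, mul_one]
  fin_cases i <;> fin_cases j
  · exact exists_inCartan_of_norm_le g hmax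
  · obtain ⟨n, hn⟩ := exists_inCartan_of_norm_le (g * weyl) fun i' j' => by
      simpa [hr] using hmax i' (1 - j')
    exact ⟨n, er g ▸ hn.mul_K2 weyl_mem⟩
  · obtain ⟨n, hn⟩ := exists_inCartan_of_norm_le (weyl * g) fun i' j' => by
      simpa [hl] using hmax (1 - i') j'
    exact ⟨n, el g ▸ hn.K2_mul weyl_mem⟩
  · obtain ⟨n, hn⟩ := exists_inCartan_of_norm_le (weyl * (g * weyl)) fun i' j' => by
      simpa [hl, hr] using hmax (1 - i') (1 - j')
    have h2 := hn.K2_mul weyl_mem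
    rw [← el] at h2
    exact ⟨n, er g ▸ h2.mul_K2 weyl_mem⟩

theorem size_mul_K2 (g : GL2) {k : GL2} (hk : k ∈ K2) : size (g * k) = size g := by
  rw [size, size, Units.val_mul, maxNorm_mul_of_mem_K2' hk, Matrix.det_mul, norm_mul,
    norm_det_of_mem_K2 hk, mul_one]

theorem size_K2_mul (g : GL2) {k : GL2} (hk : k ∈ K2) : size (k * g) = size g := by
  rw [size, size, Units.val_mul, maxNorm_mul_of_mem_K2 hk, Matrix.det_mul, norm_mul,
    norm_det_of_mem_K2 hk, one_mul]

theorem size_center_mul (g : GL2) {z : GL2} (hz : z ∈ Subgroup.center GL2) :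
    size (z * g) = size g := by
  rw [Matrix.GeneralLinearGroup.center_eq_range_scalar] at hz
  obtain ⟨c, rfl⟩ := hz
  have h : ((Matrix.GeneralLinearGroup.scalar (Fin 2) c * g : GL2) : M2)
      = (c : ℚ_[2]) • (g : M2) := by
    change Matrix.scalar (Fin 2) (c : ℚ_[2]) * (g : M2) = _
    rw [Matrix.scalar_apply, ← Matrix.smul_eq_diagonal_mul]
  rw [size, size, h, maxNorm_smul, Matrix.det_smul, norm_mul, norm_pow, Fintype.card_fin, mul_pow,
    mul_div_mul_left]
  exact pow_ne_zero _ (norm_ne_zero_iff.2 c.ne_zero)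

theorem maxNorm_eq_of_entry {β : M2} {r : ℝ} (i j : Fin 2) (h : ‖β i j‖ = r)
    (h' : ∀ i j, ‖β i j‖ ≤ r) : maxNorm β = r :=
  le_antisymm ((maxNorm_le_iff (h ▸ norm_nonneg _)).2 h') (h ▸ norm_entry_le_maxNorm β i j)

theorem norm_two_pow_le_one (n : ℕ) : ‖(2 : ℚ_[2]) ^ n‖ ≤ 1 := by
  rw [norm_pow, norm_two_padic]
  exact pow_le_one₀ (by norm_num) (by norm_num)

theorem size_dia (n : ℕ) : size (dia n) = 2 ^ n := by
  have h : maxNorm (dia n : M2) = 1 := by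
    refine maxNorm_eq_of_entry 0 0 (by simp [dia_val]) fun i j => ?_
    have := norm_two_pow_le_one n
    fin_cases i <;> fin_cases j <;> simp_all [dia_val]
  rw [size, h, dia_val, Matrix.det_fin_two]
  simp [norm_two_padic]

theorem InCartan.size_eq {n : ℕ} {g : GL2} (h : InCartan n g) : size g = 2 ^ n := by
  obtain ⟨z, hz, k₁, h₁, k₂, h₂, rfl⟩ := h
  rw [size_mul_K2 _ h₂, mul_assoc, size_center_mul _ hz, size_K2_mul _ h₁, size_dia]

/-- The radius n is determined by g, because `size` is invariant under the centre and under `K2` on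
both sides and takes distinct values on the `dia n`. -/
theorem inCartan_iff {n : ℕ} {g : GL2} : InCartan n g ↔ size g = 2 ^ n := by
  refine ⟨InCartan.size_eq, fun h => ?_⟩
  obtain ⟨m, hm⟩ := exists_inCartan g
  rw [hm.size_eq] at h
  rwa [← Nat.pow_right_injective (le_refl 2) (by exact_mod_cast h : 2 ^ m = 2 ^ n)]

/-! ### Parity in `ℤ₂` -/

theorem toZMod_eq_zero_iff (x : ℤ_[2]) : PadicInt.toZMod x = 0 ↔ ‖(x : ℚ_[2])‖ < 1 := by
  rw [← RingHom.mem_ker, PadicInt.ker_toZMod, IsLocalRing.mem_maximalIdeal, PadicInt.mem_nonunits]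
  rfl

theorem norm_half_le_one {x : ℚ_[2]} (h : ‖x‖ < 1) : ‖2⁻¹ * x‖ ≤ 1 := by
  have h2 : ‖x‖ ≤ 2⁻¹ := by
    have := (Padic.norm_le_pow_iff_norm_lt_pow_add_one x (-1)).2 (by simpa using h)
    simpa using this
  rw [norm_mul, norm_inv, norm_two_padic, inv_inv]
  linarith

/-! ### Neighbours of a vertex in the tree -/

/-- An integral matrix whose determinant has valuation `1` lies in one of the three cosets of
`GL₂(ℤ₂)` represented by `nbr`. -/
theorem exists_eq_nbr_mul {h : GL2} (h1 : maxNorm (h : M2) ≤ 1) (h2 : ‖(h : M2).det‖ = 2⁻¹) :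
    ∃ i, ∃ k ∈ K2, h = nbr i * k := by
  rw [maxNorm_le_iff zero_le_one] at h1
  -- h lies in the coset of `nbr i` exactly when `(nbr i)⁻¹ * h`, which is half of adj(`nbrM i`)·h,
  -- is integral; its determinant is then automatically a unit.
  have key : ∀ i, (∀ a b, ‖2⁻¹ * ((nbrM i).adjugate a 0 * (h : M2) 0 b +
      (nbrM i).adjugate a 1 * (h : M2) 1 b)‖ ≤ 1) →
      ∃ i, ∃ k ∈ K2, h = nbr i * k := by
    intro i hi
    refine ⟨i, (nbr i)⁻¹ * h, ?_, by group⟩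
    have e : (((nbr i)⁻¹ * h : GL2) : M2) = (2⁻¹ : ℚ_[2]) • ((nbrM i).adjugate * (h : M2)) := by
      rw [Units.val_mul, Matrix.coe_units_inv, nbr_val, Matrix.inv_def, det_nbrM,
        Ring.inverse_eq_inv, Matrix.smul_mul]
    rw [mem_K2_iff, maxNorm_le_iff zero_le_one, e]
    refine ⟨fun a b => ?_, ?_⟩
    · rw [Matrix.smul_apply, Matrix.mul_apply, Fin.sum_univ_two]
      exact hi a b
    rw [← e, Units.val_mul, Matrix.det_mul, norm_mul, h2, Matrix.coe_units_inv, Matrix.det_nonsing_inv,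
      nbr_val, det_nbrM, Ring.inverse_eq_inv, norm_inv, norm_two_padic]
    norm_num
  let A : Matrix (Fin 2) (Fin 2) ℤ_[2] := fun i j => ⟨(h : M2) i j, h1 i j⟩
  have hdet : PadicInt.toZMod (A 0 0 * A 1 1 - A 0 1 * A 1 0) = 0 := by
    rw [toZMod_eq_zero_iff]
    have : ((A 0 0 * A 1 1 - A 0 1 * A 1 0 : ℤ_[2]) : ℚ_[2]) = (h : M2).det := by
      rw [Matrix.det_fin_two]
      rfl
    rw [this, h2]
    norm_num
  -- A singular matrix over 𝔽₂ has first row zero, equal rows, or second row zero; these are the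
  -- three cosets.
  have par : ∀ a b c d : ZMod 2, a * d - b * c = 0 →
      (a = 0 ∧ b = 0) ∨ (a - c = 0 ∧ b - d = 0) ∨ (c = 0 ∧ d = 0) := by decide
  rw [map_sub, map_mul, map_mul] at hdet
  have hsub : ∀ j, ‖((A 0 j - A 1 j : ℤ_[2]) : ℚ_[2])‖ = ‖(h : M2) 0 j - (h : M2) 1 j‖ :=
    fun j => rfl
  have hA : ∀ i j, ‖((A i j : ℤ_[2]) : ℚ_[2])‖ = ‖(h : M2) i j‖ := fun i j => rfl
  rcases par _ _ _ _ hdet with ⟨ha, hb⟩ | ⟨ha, hb⟩ | ⟨ha, hb⟩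
  · rw [toZMod_eq_zero_iff, hA] at ha hb
    have ha' := norm_half_le_one ha
    have hb' := norm_half_le_one hb
    refine key 0 fun a b => ?_
    fin_cases a <;> fin_cases b <;> simp [nbrM, Matrix.adjugate_fin_two, -norm_mul, h1, ha', hb']
  · rw [← map_sub, toZMod_eq_zero_iff, hsub] at ha hb
    have ha' := norm_half_le_one ha
    have hb' := norm_half_le_one hb
    refine key 1 fun a b => ?_
    fin_cases a <;> fin_cases b <;>
      simp [nbrM, Matrix.adjugate_fin_two, -norm_mul, h1, ha', hb', ← sub_eq_add_neg]
  · rw [toZMod_eq_zero_iff, hA] at ha hb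
    have ha' := norm_half_le_one ha
    have hb' := norm_half_le_one hb
    refine key 2 fun a b => ?_
    fin_cases a <;> fin_cases b <;> simp [nbrM, Matrix.adjugate_fin_two, -norm_mul, h1, ha', hb']

theorem two_mul_ne_one {x : ℚ_[2]} (hx : ‖x‖ ≤ 1) : 2 * x ≠ 1 := by
  intro h
  have := congrArg norm h
  rw [norm_mul, norm_two_padic, norm_one] at this
  linarith

theorem nbr_mul_injective {i j : Fin 3} {k : GL2} (hk : k ∈ K2) (h : nbr i * k = nbr j) :
    i = j := by
  have hk1 := (maxNorm_le_iff zero_le_one).1 (maxNorm_le_one_of_mem_K2 hk)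
  have e : ∀ a b, (nbrM i * (k : M2) : M2) a b = nbrM j a b := fun a b =>
    congrArg (fun g : GL2 => (g : M2) a b) h
  have n00 := two_mul_ne_one (hk1 0 0)
  have n01 := two_mul_ne_one (hk1 0 1)
  have n11 := two_mul_ne_one (hk1 1 1)
  have m01 := two_mul_ne_one (x := -(k : M2) 0 1) (by rw [norm_neg]; exact hk1 0 1)
  have e00 := e 0 0
  have e01 := e 0 1
  have e10 := e 1 0
  have e11 := e 1 1
  clear e h
  fin_cases i <;> fin_cases j <;>
    simp [nbrM, Matrix.mul_apply, Fin.sum_univ_two] at e00 e01 e10 e11 ⊢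
  · exact n01 e01
  · exact n00 e00
  · exact m01 (by linear_combination e11 - e01)
  · exact n00 (by linear_combination e00 - e10)
  · exact n11 e11
  · exact n11 e11

theorem maxNorm_nbr_le (i : Fin 3) : maxNorm (nbr i : M2) ≤ 1 := by
  rw [maxNorm_le_iff zero_le_one, nbr_val]
  intro a b
  fin_cases i <;> fin_cases a <;> fin_cases b <;> simp [nbrM, norm_two_padic] <;> norm_num

theorem norm_det_nbr (i : Fin 3) : ‖(nbr i : M2).det‖ = 2⁻¹ := by
  rw [nbr_val, det_nbrM, norm_two_padic]

/-- The sum over the neighbours of a vertex does not depend on the representative. -/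
theorem sum_mul_nbr_of_mem_K2 {α : Type*} [AddCommMonoid α] (u : GL2 → α)
    (hu : ∀ x, ∀ k ∈ K2, u (x * k) = u x) (x : GL2) {k : GL2} (hk : k ∈ K2) :
    ∑ i, u (x * k * nbr i) = ∑ i, u (x * nbr i) := by
  have h : ∀ i, ∃ j, ∃ k' ∈ K2, k * nbr i = nbr j * k' := fun i => by
    refine exists_eq_nbr_mul ?_ ?_
    · rw [Units.val_mul, maxNorm_mul_of_mem_K2 hk]
      exact maxNorm_nbr_le i
    · rw [Units.val_mul, Matrix.det_mul, norm_mul, norm_det_of_mem_K2 hk, one_mul, norm_det_nbr]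
  choose σ k' hk' hσ using h
  -- Left multiplication by k permutes the three cosets.
  have hinj : Function.Injective σ := by
    intro i j hij
    have h1 := hσ i
    rw [hij] at h1
    have h2 := hσ j
    refine nbr_mul_injective (k := (k' i)⁻¹ * k' j) (K2.mul_mem (K2.inv_mem (hk' i)) (hk' j)) ?_
    have h3 : nbr i = k⁻¹ * nbr (σ j) * k' i := by
      rw [mul_assoc, ← h1]
      group
    rw [h3, mul_assoc, mul_assoc, mul_inv_cancel_left, ← h2, inv_mul_cancel_left]
  calc ∑ i, u (x * k * nbr i) = ∑ i, u (x * nbr (σ i)) := Finset.sum_congr rfl fun i _ => by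
        rw [mul_assoc, hσ, ← mul_assoc, hu _ _ (hk' i)]
    _ = ∑ i, u (x * nbr i) :=
        (Finite.injective_iff_bijective.1 hinj).sum_comp fun i => u (x * nbr i)

theorem size_of_val_eq {g : GL2} {β : M2} (h : (g : M2) = β) {r : ℝ} {n : ℕ} (i j : Fin 2)
    (hr : ‖β i j‖ = r) (hr' : ∀ i j, ‖β i j‖ ≤ r) (hd : r ^ 2 / ‖β.det‖ = 2 ^ n) :
    InCartan n g := by
  rw [inCartan_iff, size, h, maxNorm_eq_of_entry i j hr hr', hd]

/-- The product is twice `dia n`: this is the one neighbour closer to the base vertex. The other two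
are farther away. -/
theorem dia_mul_nbr_zero (n : ℕ) : InCartan n (dia (n + 1) * nbr 0) := by
  refine size_of_val_eq (β := !![2, 0; 0, 2 ^ (n + 1)]) (r := 2⁻¹) ?_ 0 0 ?_ ?_ ?_
  · rw [Units.val_mul, dia_val, nbr_val]
    simp [nbrM]
  · simp [norm_two_padic]
  · intro i j
    have := pow_le_one₀ (n := n) (by norm_num : (0 : ℝ) ≤ 2⁻¹) (by norm_num)
    fin_cases i <;> fin_cases j <;> simp [norm_two_padic, pow_succ] <;> simpa using this
  · simp [Matrix.det_fin_two, norm_two_padic, pow_succ]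
    field_simp

theorem dia_mul_nbr_one (n : ℕ) : InCartan (n + 1) (dia n * nbr 1) := by
  have := norm_two_pow_le_one n
  refine size_of_val_eq (β := !![2, 1; 0, 2 ^ n]) (r := 1) ?_ 0 1 ?_ ?_ ?_
  · rw [Units.val_mul, dia_val, nbr_val]
    simp [nbrM]
  · simp
  · intro i j
    fin_cases i <;> fin_cases j <;> simp_all [norm_two_padic]
    norm_num
  · simp [Matrix.det_fin_two, norm_two_padic, pow_succ, mul_comm]

theorem dia_mul_nbr_two (n : ℕ) : InCartan (n + 1) (dia n * nbr 2) := by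
  have := norm_two_pow_le_one (n + 1)
  refine size_of_val_eq (β := !![1, 0; 0, 2 ^ (n + 1)]) (r := 1) ?_ 0 0 ?_ ?_ ?_
  · rw [Units.val_mul, dia_val, nbr_val]
    simp [nbrM, pow_succ]
  · simp
  · intro i j
    fin_cases i <;> fin_cases j <;> simp_all
  · simp [Matrix.det_fin_two, norm_two_padic]

theorem dia_zero : dia 0 = 1 := by
  ext i j
  change (!![1, 0; 0, 2 ^ 0] : M2) i j = (1 : M2) i j
  fin_cases i <;> fin_cases j <;> simp

theorem nbr_inCartan (i : Fin 3) : InCartan 1 (nbr i) := by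
  have h := dia_mul_nbr_one 0
  have h' := dia_mul_nbr_two 0
  rw [dia_zero, one_mul] at h h'
  fin_cases i
  · refine size_of_val_eq (β := !![2, 0; 0, 1]) (r := 1) rfl 1 1 (by simp) ?_ ?_
    · intro i j
      fin_cases i <;> fin_cases j <;> simp [norm_two_padic]
      norm_num
    · simp [Matrix.det_fin_two, norm_two_padic]
  · exact h
  · exact h'

/-- A function on `Z K \ GL₂(ℚ₂) / K`, summed over the neighbours of a vertex at distance `n`. -/
theorem sum_mul_nbr {α : Type*} [AddCommMonoid α] {u : GL2 → α} {v : ℕ → α}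
    (hu : ∀ n g, InCartan n g → u g = v n) {n : ℕ} {g : GL2} (hg : InCartan (n + 1) g) :
    ∑ i, u (g * nbr i) = v n + 2 • v (n + 2) := by
  obtain ⟨z, hz, k₁, h₁, k₂, h₂, rfl⟩ := hg
  have hK : ∀ x, ∀ k ∈ K2, u (x * k) = u x := fun x k hk => by
    obtain ⟨m, hm⟩ := exists_inCartan x
    rw [hu m x hm, hu m _ (hm.mul_K2 hk)]
  have hl : ∀ m x, InCartan m x → u (z * k₁ * x) = v m := fun m x hx => by
    refine hu m _ ?_
    rw [inCartan_iff, mul_assoc, size_center_mul _ hz, size_K2_mul _ h₁, hx.size_eq]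
  rw [sum_mul_nbr_of_mem_K2 u hK _ h₂, Fin.sum_univ_three, mul_assoc, mul_assoc _ _ (nbr 1),
    mul_assoc _ _ (nbr 2), hl _ _ (dia_mul_nbr_zero n), hl _ _ (dia_mul_nbr_one _),
    hl _ _ (dia_mul_nbr_two _), two_nsmul, add_assoc]

theorem sum_nbr {α : Type*} [AddCommMonoid α] {u : GL2 → α} {v : ℕ → α}
    (hu : ∀ n g, InCartan n g → u g = v n) {g : GL2} (hg : InCartan 0 g) :
    ∑ i, u (g * nbr i) = 3 • v 1 := by
  obtain ⟨z, hz, k₁, h₁, k₂, h₂, rfl⟩ := hg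
  have h : ∀ i, u (z * k₁ * dia 0 * k₂ * nbr i) = v 1 := fun i => by
    refine hu 1 _ ?_
    rw [inCartan_iff, dia_zero, mul_one, mul_assoc, mul_assoc, size_center_mul _ hz,
      size_K2_mul _ h₁, size_K2_mul _ h₂, (nbr_inCartan i).size_eq]
  simp [h]

/-! ### Integral elements of quaternion algebras -/

section QuaternionArithmetic

variable {a b : ℚ}

open Polynomial in
/-- The reduced trace of an integral element is an integer. -/
theorem exists_int_eq_trace_of_isIntegral {x : ℍ[ℚ, a, b]} (hx : IsIntegral ℤ x) :
    ∃ n : ℤ, 2 * x.re = n := by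
  have hxQ : IsIntegral ℚ x := hx.tower_top
  obtain ⟨q, hq, hqx⟩ := hx
  -- By Gauss's lemma the minimal polynomial over ℚ has integer coefficients. It divides X² − tr(x)X
  -- + nr(x), so either it equals this polynomial or x is a rational integer.
  set m := minpoly ℚ x with hm
  have hmm : m.Monic := minpoly.monic hxQ
  have hdvd : m ∣ q.map (algebraMap ℤ ℚ) := minpoly.dvd ℚ x (by
    rw [aeval_map_algebraMap]
    exact hqx)
  obtain ⟨m', hm'⟩ := IsIntegrallyClosed.eq_map_mul_C_of_dvd ℚ hq hdvd
  rw [hmm.leadingCoeff, C_1, mul_one] at hm'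
  have hcoeff : ∀ i, ∃ n : ℤ, m.coeff i = n := fun i => ⟨m'.coeff i, by rw [← hm', coeff_map]; rfl⟩
  let p : ℚ[X] := X ^ 2 + C (-(2 * x.re)) * X + C (x * star x).re
  have hpx : aeval x p = 0 := by
    have h : (star x) = algebraMap ℚ ℍ[ℚ, a, b] (2 * x.re) - x := by
      rw [QuaternionAlgebra.star_eq_two_re_sub, zero_mul, add_zero]
      rfl
    have h2 : algebraMap ℚ ℍ[ℚ, a, b] (x * star x).re = x * star x :=
      (QuaternionAlgebra.mul_star_eq_coe x).symm
    simp only [p, map_add, map_mul, map_pow, aeval_X, aeval_C, h2]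
    rw [h, map_neg, mul_sub, ← Algebra.commutes]
    noncomm_ring
  have hp2 : p.natDegree = 2 := by
    simp only [p]
    compute_degree!
  have hpm : p.Monic := by
    simp only [p]
    monicity!
  have hmp : m ∣ p := minpoly.dvd ℚ x hpx
  have hle : m.natDegree ≤ 2 := hp2 ▸ natDegree_le_of_dvd hmp hpm.ne_zero
  have hpos : 0 < m.natDegree := minpoly.natDegree_pos hxQ
  obtain h1 | h2 : m.natDegree = 1 ∨ m.natDegree = 2 := by omega
  · obtain ⟨n, hn⟩ := hcoeff 0
    have e : m = X + C (n : ℚ) := by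
      rw [hmm.eq_X_add_C h1, hn]
    have hx0 : aeval x m = 0 := minpoly.aeval ℚ x
    rw [e, map_add, aeval_X, aeval_C] at hx0
    refine ⟨-2 * n, ?_⟩
    have := congrArg QuaternionAlgebra.re hx0
    have h3 : x.re + n = 0 := this
    push_cast
    linarith
  · have e : m = p := (eq_of_monic_of_dvd_of_natDegree_le hmm hpm hmp (by omega)).symm
    obtain ⟨n, hn⟩ := hcoeff 1
    refine ⟨-n, ?_⟩
    have h3 : p.coeff 1 = -(2 * x.re) := by simp [p, coeff_C]
    rw [e, h3] at hn
    push_cast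
    linarith

theorem IsOrder.isIntegral {R : Subring ℍ[ℚ, a, b]} (hR : IsOrder R) {x : ℍ[ℚ, a, b]}
    (hx : x ∈ R) : IsIntegral ℤ x := by
  refine IsIntegral.of_mem_of_fg (subalgebraOfSubring R) ?_ x hx
  rw [Submodule.fg_iff_addSubgroup_fg]
  exact hR.1

/-- The conjugate is the trace minus the element, and traces of elements of R are integers. -/
theorem star_mem_invertTwo {R : Subring ℍ[ℚ, a, b]} (hR : IsOrder R) {x : ℍ[ℚ, a, b]}
    (hx : x ∈ invertTwo R) : star x ∈ invertTwo R := by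
  obtain ⟨n, hn⟩ := hx
  refine ⟨n, ?_⟩
  obtain ⟨t, ht⟩ := exists_int_eq_trace_of_isIntegral (hR.isIntegral hn)
  have h : (2 : ℚ) ^ n • star x = ((t : ℤ) : ℍ[ℚ, a, b]) - (2 : ℚ) ^ n • x := by
    rw [← QuaternionAlgebra.star_smul', QuaternionAlgebra.star_eq_two_re_sub, zero_mul, add_zero, ht,
      QuaternionAlgebra.coe_intCast]
  rw [h]
  exact R.sub_mem (intCast_mem R t) hn

theorem two_zpow_smul_mem_invertTwo {R : Subring ℍ[ℚ, a, b]} {x : ℍ[ℚ, a, b]}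
    (hx : x ∈ invertTwo R) (k : ℤ) : (2 : ℚ) ^ k • x ∈ invertTwo R := by
  obtain ⟨n, hn⟩ := hx
  refine ⟨n + k.natAbs, ?_⟩
  obtain ⟨j, hj⟩ : ∃ j : ℕ, (k.natAbs : ℤ) + k = j := ⟨(k.natAbs + k).toNat, by omega⟩
  have e : (2 : ℚ) ^ (n + k.natAbs) • (2 : ℚ) ^ k • x = (2 ^ j : ℕ) • ((2 : ℚ) ^ n • x) := by
    rw [← Nat.cast_smul_eq_nsmul ℚ, smul_smul, smul_smul, Nat.cast_pow, Nat.cast_ofNat, pow_add,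
      mul_assoc, mul_comm, ← zpow_natCast (2 : ℚ) k.natAbs, ← zpow_add₀ two_ne_zero, hj,
      zpow_natCast]
  rw [e]
  exact R.nsmul_mem hn _

/-! ### The Hecke operators at 1 and at 2 -/

variable {R : Subring ℍ[ℚ, a, b]} {ι : ℍ[ℚ, a, b] →ₐ[ℚ] M2}

theorem mem_Gam_iff {g : GL2} :
    g ∈ Gam R ι ↔ ∃ u : (invertTwo R)ˣ, ι (u : invertTwo R) = (g : M2) := by
  constructor
  · rintro ⟨u, rfl⟩
    exact ⟨u, rfl⟩
  · rintro ⟨u, hu⟩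
    exact ⟨u, Units.ext hu⟩

/-- If nr(α) = ε·2ᵏ with ε = ±1, then ε·2⁻ᵏ times the conjugate of α is an inverse of α in R[1/2].
-/
theorem heckeSet_one_subset (hR : IsOrder R) : heckeSet R ι 1 ⊆ Gam R ι := by
  rintro g ⟨α, hα, hg, k, hk⟩
  obtain ⟨ε, hε, hk⟩ : ∃ ε : ℚ, (ε = 1 ∨ ε = -1) ∧ reducedNorm α = ε * 2 ^ k := by
    rcases hk with hk | hk
    · exact ⟨1, Or.inl rfl, by rw [hk]; simp⟩
    · exact ⟨-1, Or.inr rfl, by rw [hk]; simp⟩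
  have hε2 : ε * ε = 1 := by rcases hε with rfl | rfl <;> norm_num
  set β : ℍ[ℚ, a, b] := ε • (2 : ℚ) ^ (-k) • star α with hβ
  have hβm : β ∈ invertTwo R := by
    have := two_zpow_smul_mem_invertTwo (star_mem_invertTwo hR hα) (-k)
    rcases hε with rfl | rfl
    · rwa [hβ, one_smul]
    · rw [hβ, neg_one_smul]
      exact neg_mem this
  have hn : ε * 2 ^ (-k) * (ε * 2 ^ k) = 1 := by
    have h2 : (2 : ℚ) ^ (-k) * 2 ^ k = 1 := by
      rw [← zpow_add₀ two_ne_zero, neg_add_cancel, zpow_zero]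
    linear_combination h2 + (2 : ℚ) ^ (-k) * 2 ^ k * hε2
  have h1 : α * star α = ((ε * 2 ^ k : ℚ) : ℍ[ℚ, a, b]) := by
    rw [QuaternionAlgebra.mul_star_eq_coe, ← hk]
    rfl
  have h2 : star α * α = ((ε * 2 ^ k : ℚ) : ℍ[ℚ, a, b]) := by
    rw [← h1]
    have : star α = ((2 * α.re : ℚ) : ℍ[ℚ, a, b]) - α := by
      rw [QuaternionAlgebra.star_eq_two_re_sub, zero_mul, add_zero]
    rw [this, sub_mul, mul_sub, QuaternionAlgebra.coe_commutes]
  have e1 : α * β = 1 := by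
    rw [hβ, mul_smul_comm, mul_smul_comm, h1, smul_smul, QuaternionAlgebra.smul_coe, hn,
      QuaternionAlgebra.coe_one]
  have e2 : β * α = 1 := by
    rw [hβ, smul_mul_assoc, smul_mul_assoc, h2, smul_smul, QuaternionAlgebra.smul_coe, hn,
      QuaternionAlgebra.coe_one]
  exact mem_Gam_iff.2 ⟨⟨⟨α, hα⟩, ⟨β, hβm⟩, Subtype.ext e1, Subtype.ext e2⟩, hg⟩

theorem one_mem_heckeSet_one : (1 : GL2) ∈ heckeSet R ι 1 :=
  ⟨1, one_mem _, map_one ι, 0, Or.inl (by simp [reducedNorm])⟩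

/-- Only the trivial coset occurs. This is needed because the eigenvalue equation at n = 2 is stated
for T₁T₂. -/
theorem heckeOdd_one (hR : IsOrder R) {φ : GL2 → ℝ} (hφ : ∀ γ ∈ Gam R ι, ∀ x, φ (γ * x) = φ x) :
    heckeOdd R ι 1 φ = φ := by
  have h : (QuotientGroup.mk '' heckeSet R ι 1 : Set (GL2 ⧸ Gam R ι)) = {((1 : GL2) : GL2 ⧸ Gam R ι)} := by
    refine Set.eq_singleton_iff_unique_mem.2 ⟨⟨1, one_mem_heckeSet_one, rfl⟩, ?_⟩
    rintro _ ⟨g, hg, rfl⟩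
    rw [QuotientGroup.eq, mul_one]
    exact inv_mem (heckeSet_one_subset hR hg)
  funext x
  rw [heckeOdd, h, finsum_mem_singleton]
  refine hφ _ (inv_mem ?_) x
  have := QuotientGroup.mk_out_eq_mul (Gam R ι) (1 : GL2)
  obtain ⟨γ, hγ⟩ := this
  rw [hγ, one_mul]
  exact γ.2

theorem heckeTwoPow_one {φ : GL2 → ℝ} (hφ : ∀ k ∈ K2, ∀ x, φ (x * k) = φ x) (x : GL2) :
    heckeTwoPow 1 φ x = ∑ i, φ (x * nbr i) := by
  have hinj : Function.Injective fun i => ((nbr i : GL2) : GL2 ⧸ K2) := by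
    intro i j hij
    exact nbr_mul_injective (QuotientGroup.eq.1 hij) (mul_inv_cancel_left _ _)
  have h : (QuotientGroup.mk '' {h : GL2 | (h : M2) ∈ integralM2 ∧
      ‖(h : M2).det‖ = 2 ^ (-((1 : ℕ) : ℤ))} : Set (GL2 ⧸ K2))
      = Set.range fun i => ((nbr i : GL2) : GL2 ⧸ K2) := by
    ext c
    constructor
    · rintro ⟨h, ⟨h1, h2⟩, rfl⟩
      obtain ⟨i, k, hk, rfl⟩ := exists_eq_nbr_mul ((maxNorm_le_iff zero_le_one).2 h1)
        (h2.trans (by norm_num))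
      exact ⟨i, (QuotientGroup.mk_mul_of_mem _ hk).symm⟩
    · rintro ⟨i, rfl⟩
      exact ⟨nbr i, ⟨(maxNorm_le_iff zero_le_one).1 (maxNorm_nbr_le i),
        (norm_det_nbr i).trans (by norm_num)⟩, rfl⟩
  rw [heckeTwoPow, h, finsum_mem_range hinj, finsum_eq_sum_of_fintype]
  refine Finset.sum_congr rfl fun i _ => ?_
  obtain ⟨k, hk⟩ := QuotientGroup.mk_out_eq_mul K2 (nbr i)
  rw [hk, ← mul_assoc, hφ _ k.2]

theorem hecke_two (hR : IsOrder R) (φ : FunY R ι) (x : GL2) :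
    hecke R ι 2 φ.toFun x = ∑ i, φ.toFun (x * nbr i) := by
  have h2 : heckeTwoPow 1 φ.toFun = fun x => ∑ i, φ.toFun (x * nbr i) :=
    funext fun x => heckeTwoPow_one φ.right_inv x
  have hf : Nat.factorization 2 2 = 1 := Nat.Prime.factorization_self Nat.prime_two
  rw [hecke, hf, pow_one, Nat.div_self two_pos, h2, heckeOdd_one hR]
  intro γ hγ x
  simp only [mul_assoc, φ.left_inv γ hγ]

/-! ### No large finite groups of units -/

theorem sq_eq_of_re_eq_zero {F : Type*} [CommRing F] {c₁ c₃ : F} (v : ℍ[F, c₁, c₃])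
    (w : ℍ[F, c₁, c₃]) :
    (v * w).re = v.re * w.re + c₁ * (v.imI * w.imI) + c₃ * (v.imJ * w.imJ)
      - c₁ * c₃ * (v.imK * w.imK) := by
  rw [QuaternionAlgebra.re_mul]
  ring

/-- An element whose square is a negative number is pure. -/
theorem re_eq_zero_of_sq {v : ℍ[ℚ, a, b]} {c : ℚ} (hc : 0 < c) (hv : v * v = ((-c : ℚ) : ℍ[ℚ, a, b])) :
    v.re = 0 ∧ a * (v.imI * v.imI) + b * (v.imJ * v.imJ) - a * b * (v.imK * v.imK) = -c := by
  have h0 := congrArg QuaternionAlgebra.re hv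
  have h1 := congrArg QuaternionAlgebra.imI hv
  have h2 := congrArg QuaternionAlgebra.imJ hv
  have h3 := congrArg QuaternionAlgebra.imK hv
  rw [sq_eq_of_re_eq_zero, QuaternionAlgebra.re_coe] at h0
  simp only [QuaternionAlgebra.imI_mul, QuaternionAlgebra.imI_coe, zero_mul, add_zero] at h1
  simp only [QuaternionAlgebra.imJ_mul, QuaternionAlgebra.imJ_coe, zero_mul, add_zero] at h2
  simp only [QuaternionAlgebra.imK_mul, QuaternionAlgebra.imK_coe] at h3
  -- The imaginary part of v² is 2 re(v) times that of v, so re(v) ≠ 0 would make v a rational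
  -- number with negative square.
  have hre : v.re = 0 := by
    by_contra hne
    have e1 : v.imI = 0 := by
      have : 2 * v.re * v.imI = 0 := by linear_combination h1
      simpa [hne] using this
    have e2 : v.imJ = 0 := by
      have : 2 * v.re * v.imJ = 0 := by linear_combination h2
      simpa [hne] using this
    have e3 : v.imK = 0 := by
      have : 2 * v.re * v.imK = 0 := by linear_combination h3
      simpa [hne] using this
    rw [e1, e2, e3] at h0
    nlinarith [mul_self_nonneg v.re]
  refine ⟨hre, ?_⟩
  rw [hre] at h0
  linarith

theorem not_isUnit_of_mul_eq_zero {M : Type*} [MonoidWithZero M] {x y : M} (hxy : x * y = 0)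
    (hy : y ≠ 0) : ¬ IsUnit x := fun ⟨u, hu⟩ => hy (by rwa [← hu, Units.mul_right_eq_zero] at hxy)

/-- If a ≥ 0 then √a + i and √a − i are zero divisors over ℝ, and likewise for b with j. -/
theorem neg_of_isRamified (hB : IsRamifiedAtInftyAnd23 a b) : a < 0 ∧ b < 0 := by
  constructor
  · by_contra! h
    have hs : √(a : ℝ) * √(a : ℝ) = a := Real.mul_self_sqrt (by exact_mod_cast h)
    refine not_isUnit_of_mul_eq_zero (x := (⟨√(a : ℝ), 1, 0, 0⟩ : ℍ[ℝ, (a : ℝ), (b : ℝ)]))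
      (y := ⟨√(a : ℝ), -1, 0, 0⟩) ?_ ?_ (hB.1 _ ?_)
    · ext <;> simp [hs]
    · intro h0
      simpa using congrArg QuaternionAlgebra.imI h0
    · intro h0
      simpa using congrArg QuaternionAlgebra.imI h0
  · by_contra! h
    have hs : √(b : ℝ) * √(b : ℝ) = b := Real.mul_self_sqrt (by exact_mod_cast h)
    refine not_isUnit_of_mul_eq_zero (x := (⟨√(b : ℝ), 0, 1, 0⟩ : ℍ[ℝ, (a : ℝ), (b : ℝ)]))
      (y := ⟨√(b : ℝ), 0, -1, 0⟩) ?_ ?_ (hB.1 _ ?_)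
    · ext <;> simp [hs]
    · intro h0
      simpa using congrArg QuaternionAlgebra.imJ h0
    · intro h0
      simpa using congrArg QuaternionAlgebra.imJ h0

/-- Since a, b < 0, the norm form is positive definite over ℚ, so every nonzero element is inverted
by its conjugate over its norm. -/
theorem isUnit_of_isRamified (hB : IsRamifiedAtInftyAnd23 a b) {x : ℍ[ℚ, a, b]} (hx : x ≠ 0) :
    IsUnit x := by
  obtain ⟨ha, hb⟩ := neg_of_isRamified hB
  have hN : (x * star x).re = x.re * x.re - a * (x.imI * x.imI) - b * (x.imJ * x.imJ)
      + a * b * (x.imK * x.imK) := by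
    rw [sq_eq_of_re_eq_zero]
    simp
    ring
  have hab := mul_pos_of_neg_of_neg ha hb
  have hN0 : (x * star x).re ≠ 0 := by
    intro h0
    rw [hN] at h0
    have p0 := mul_self_nonneg x.re
    have p1 := mul_nonneg (neg_pos.2 ha).le (mul_self_nonneg x.imI)
    have p2 := mul_nonneg (neg_pos.2 hb).le (mul_self_nonneg x.imJ)
    have p3 := mul_nonneg hab.le (mul_self_nonneg x.imK)
    refine hx ?_
    have q0 : x.re * x.re = 0 := by linarith
    have q1 : -a * (x.imI * x.imI) = 0 := by linarith
    have q2 : -b * (x.imJ * x.imJ) = 0 := by linarith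
    have q3 : a * b * (x.imK * x.imK) = 0 := by linarith
    ext
    · simpa using q0
    · simpa [ha.ne] using q1
    · simpa [hb.ne] using q2
    · simpa [ha.ne, hb.ne] using q3
  have h1 : x * ((x * star x).re⁻¹ • star x) = 1 := by
    rw [mul_smul_comm, QuaternionAlgebra.mul_star_eq_coe, QuaternionAlgebra.re_coe,
      QuaternionAlgebra.smul_coe, inv_mul_cancel₀ hN0, QuaternionAlgebra.coe_one]
  have hs : star x * x = x * star x := by
    have : star x = ((2 * x.re : ℚ) : ℍ[ℚ, a, b]) - x := by
      rw [QuaternionAlgebra.star_eq_two_re_sub, zero_mul, add_zero]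
    rw [this, sub_mul, mul_sub, QuaternionAlgebra.coe_commutes]
  have h2 : ((x * star x).re⁻¹ • star x) * x = 1 := by
    rw [smul_mul_assoc, hs, ← mul_smul_comm, h1]
  exact ⟨⟨x, _, h1, h2⟩, rfl⟩

instance fact_prime_twentythree : Fact (Nat.Prime 23) := ⟨by norm_num⟩

-- Hensel's lemma at 23; the second divisibility condition says that c is a simple root of X² + m
-- modulo 23.
open Polynomial in
theorem exists_padic_sq {m c : ℤ} (h : (23 : ℤ) ∣ c ^ 2 + m) (hc : ¬ (23 : ℤ) ∣ 2 * c) :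
    ∃ x : ℚ_[23], x ≠ 0 ∧ x ^ 2 = -(m : ℚ_[23]) := by
  have h1 : ‖((c ^ 2 + m : ℤ) : ℤ_[23])‖ < 1 := PadicInt.norm_int_lt_one_iff_dvd _ |>.2 h
  have h2 : ‖((2 * c : ℤ) : ℤ_[23])‖ = 1 := by
    refine le_antisymm (PadicInt.norm_le_one _) (not_lt.1 fun hlt => hc ?_)
    exact PadicInt.norm_int_lt_one_iff_dvd _ |>.1 hlt
  obtain ⟨z, hz, hz', -⟩ := hensels_lemma (p := 23) (F := (X ^ 2 + C (m : ℤ_[23]) : ℤ_[23][X]))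
    (a := (c : ℤ_[23])) (by
      have e1 : aeval (c : ℤ_[23]) (X ^ 2 + C (m : ℤ_[23]) : ℤ_[23][X]) = ((c ^ 2 + m : ℤ) : ℤ_[23]) := by
        simp
      have e2 : aeval (c : ℤ_[23]) (derivative (X ^ 2 + C (m : ℤ_[23]) : ℤ_[23][X]))
          = ((2 * c : ℤ) : ℤ_[23]) := by
        simp [one_add_one_eq_two]
      rw [e1, e2, h2]
      simpa using h1)
  have hz2 : z ^ 2 = -(m : ℤ_[23]) := by
    have : z ^ 2 + (m : ℤ_[23]) = 0 := by simpa using hz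
    linear_combination this
  refine ⟨z, ?_, by rw [← PadicInt.coe_pow, hz2]; simp⟩
  rintro h0
  have hz0 : z = 0 := Subtype.ext h0
  have e2 : aeval (c : ℤ_[23]) (derivative (X ^ 2 + C (m : ℤ_[23]) : ℤ_[23][X]))
      = ((2 * c : ℤ) : ℤ_[23]) := by
    simp [one_add_one_eq_two]
  rw [e2, h2, hz0, zero_sub, norm_neg] at hz'
  have : ‖((2 * c : ℤ) : ℤ_[23])‖ ≤ ‖(c : ℤ_[23])‖ := by
    push_cast
    rw [norm_mul]
    exact mul_le_of_le_one_left (norm_nonneg _) (PadicInt.norm_le_one _)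
  rw [h2] at this
  linarith

/-- The quaternion algebra ramified at `∞` and `23` has no finite group of units containing elements
of order `3` and `4`. -/
theorem not_exists_order_three_four (hB : IsRamifiedAtInftyAnd23 a b) {i ω : ℍ[ℚ, a, b]}
    (hi : i * i = -1) (hω : ω * ω + ω + 1 = 0) (hint : IsIntegral ℤ (i * ω)) : False := by
  obtain ⟨ha, hb⟩ := neg_of_isRamified hB
  obtain ⟨t, ht⟩ := exists_int_eq_trace_of_isIntegral hint
  -- This q is a pure quaternion with square −3, and re(iq) = 2 re(iω) is the integer t.
  set q : ℍ[ℚ, a, b] := 2 * ω + 1 with hq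
  have hqq : q * q = ((-3 : ℚ) : ℍ[ℚ, a, b]) := by
    have e : q * q = (4 : ℕ) • (ω * ω + ω + 1) - (1 + 1 + 1) := by
      rw [hq]
      noncomm_ring
    rw [e, hω, smul_zero, zero_sub, ← QuaternionAlgebra.coe_one, ← QuaternionAlgebra.coe_add,
      ← QuaternionAlgebra.coe_add, ← QuaternionAlgebra.coe_neg]
    norm_num
  have hii : i * i = ((-1 : ℚ) : ℍ[ℚ, a, b]) := by
    rw [hi, QuaternionAlgebra.coe_neg, QuaternionAlgebra.coe_one]
  obtain ⟨i0, iN⟩ := re_eq_zero_of_sq one_pos hii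
  obtain ⟨q0, qN⟩ := re_eq_zero_of_sq three_pos hqq
  have hB1 : a * (i.imI * q.imI) + b * (i.imJ * q.imJ) - a * b * (i.imK * q.imK) = t := by
    have e : i * q = (2 : ℚ) • (i * ω) + i := by
      rw [hq, two_smul]
      noncomm_ring
    have h1 : (i * q).re = t := by
      rw [e, QuaternionAlgebra.re_add, QuaternionAlgebra.re_smul, smul_eq_mul, ht, i0, add_zero]
    rw [sq_eq_of_re_eq_zero, i0, zero_mul, zero_add] at h1
    exact h1
  have hab := mul_pos_of_neg_of_neg ha hb
  -- q + t i is orthogonal to i and has square t² − 3, which is nonpositive by definiteness. Hence t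
  -- is −1, 0 or 1.
  have ht3 : t ^ 2 ≤ 3 := by
    have p1 := mul_nonneg (neg_pos.2 ha).le (mul_self_nonneg (q.imI + t * i.imI))
    have p2 := mul_nonneg (neg_pos.2 hb).le (mul_self_nonneg (q.imJ + t * i.imJ))
    have p3 := mul_nonneg hab.le (mul_self_nonneg (q.imK + t * i.imK))
    have : (t : ℚ) ^ 2 ≤ 3 := by linear_combination p1 + p2 + p3 - qN - 2 * t * hB1 - t ^ 2 * iN
    exact_mod_cast this
  -- For t = 0 take y = 4, with x² = −19 and 19 ≡ −2²; for t = ±1 take y = 3, with x² = −11 and 11 ≡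
  -- −9² modulo 23.
  have hsol : ∃ x y : ℚ_[23], x ≠ 0 ∧ x ^ 2 + y ^ 2 + (3 - (t : ℚ_[23]) ^ 2) = 0 := by
    have h1 : -1 ≤ t := by nlinarith
    have h2 : t ≤ 1 := by nlinarith
    obtain ⟨x, hx0, hx⟩ := exists_padic_sq (m := 19) (c := 2) (by norm_num) (by norm_num)
    obtain ⟨x', hx0', hx'⟩ := exists_padic_sq (m := 11) (c := 9) (by norm_num) (by norm_num)
    push_cast at hx hx'
    interval_cases t
    · exact ⟨x', 3, hx0', by push_cast; linear_combination hx'⟩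
    · exact ⟨x, 4, hx0, by push_cast; linear_combination hx⟩
    · exact ⟨x', 3, hx0', by push_cast; linear_combination hx'⟩
  obtain ⟨x, y, hx0, hxy⟩ := hsol
  have cN := congrArg (fun r : ℚ => (r : ℚ_[23])) iN
  have cM := congrArg (fun r : ℚ => (r : ℚ_[23])) qN
  have cB := congrArg (fun r : ℚ => (r : ℚ_[23])) hB1
  push_cast at cN cM cB
  -- This is z = x + y i + (q + t i), of norm x² + y² + 3 − t² = 0: a zero divisor over ℚ₂₃.
  let z : ℍ[ℚ_[23], (a : ℚ_[23]), (b : ℚ_[23])] :=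
    ⟨x, y * i.imI + (q.imI + t * i.imI), y * i.imJ + (q.imJ + t * i.imJ),
      y * i.imK + (q.imK + t * i.imK)⟩
  have hz : z * star z = 0 := by
    rw [QuaternionAlgebra.mul_star_eq_coe, ← QuaternionAlgebra.coe_zero, sq_eq_of_re_eq_zero]
    congr 1
    simp only [z, QuaternionAlgebra.star_mk, zero_mul, add_zero]
    linear_combination hxy - (y + t) ^ 2 * cN - cM - 2 * (y + t) * cB
  refine not_isUnit_of_mul_eq_zero hz ?_ ((hB.2 23).1 rfl z ?_)
  · intro h0
    have := congrArg QuaternionAlgebra.re h0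
    simp [z] at this
    exact hx0 this
  · intro h0
    exact hx0 (congrArg QuaternionAlgebra.re h0)

end QuaternionArithmetic

/-! ### Integration on `Γ \ GL₂(ℚ₂)` -/

section Quotient

variable {a b : ℚ} {R : Subring ℍ[ℚ, a, b]} {ι : ℍ[ℚ, a, b] →ₐ[ℚ] M2}

instance countable_Gam : Countable (Gam R ι) := by
  have : Countable ℍ[ℚ, a, b] := (QuaternionAlgebra.equivTuple a 0 b).injective.countable
  have : Countable (invertTwo R)ˣ := Units.val_injective.countable
  rw [Gam, MonoidHom.range_eq_map]
  exact Set.countable_coe_iff.2 ((Set.countable_univ (α := (invertTwo R)ˣ)).image _)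

/-- The right translate of μ is again a left Haar measure, and comparing the finite nonzero volumes
of K, which is stable under k, shows that the scale factor is 1. -/
theorem map_mul_right_eq {μ : Measure GL2} [μ.IsHaarMeasure] (hμ : μ (K2 : Set GL2) ≠ ⊤) {k : GL2}
    (hk : k ∈ K2) : μ.map (· * k) = μ := by
  have h := Measure.isMulLeftInvariant_eq_smul (μ.map (· * k)) μ
  set c := (μ.map (· * k)).haarScalarFactor μ
  have hK : (μ.map (· * k)) (K2 : Set GL2) = μ (K2 : Set GL2) := by
    rw [Measure.map_apply (measurable_mul_const k) isOpen_K2.measurableSet]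
    congr 1
    ext x
    exact K2.mul_mem_cancel_right hk
  have hpos : μ (K2 : Set GL2) ≠ 0 := (isOpen_K2.measure_pos μ ⟨1, K2.one_mem⟩).ne'
  have hc : (c : ENNReal) = 1 := by
    rw [h, Measure.smul_apply, ENNReal.smul_def, smul_eq_mul] at hK
    exact (ENNReal.mul_eq_right hpos hμ).1 hK
  rw [h, ENNReal.coe_eq_one.1 hc, one_smul]

variable {μ : Measure GL2} {D : Set GL2}

/-- Right translation by k carries D to another fundamental domain for Γ, and the integral of a
Γ-invariant function does not depend on the domain. -/
theorem setIntegral_mul_right [μ.IsHaarMeasure] (hμ : μ (K2 : Set GL2) ≠ ⊤) (hD : IsFundamentalDomain (Gam R ι) D μ)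
    {f : GL2 → ℝ} (hf : ∀ γ ∈ Gam R ι, ∀ x, f (γ * x) = f x) {k : GL2} (hk : k ∈ K2) :
    ∫ x in D, f (x * k) ∂μ = ∫ x in D, f x ∂μ := by
  have hmp : ∀ k ∈ K2, MeasurePreserving (· * k) μ μ := fun k hk =>
    ⟨measurable_mul_const k, map_mul_right_eq hμ hk⟩
  have hD' : IsFundamentalDomain (Gam R ι) ((· * k⁻¹) ⁻¹' D) μ :=
    hD.preimage_of_equiv (hmp _ (inv_mem hk)).quasiMeasurePreserving (e := id)
      Function.bijective_id fun γ x => mul_assoc _ _ _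
  have h := (hmp k hk).setIntegral_preimage_emb (Homeomorph.mulRight k).measurableEmbedding f
    ((· * k⁻¹) ⁻¹' D)
  have e : (· * k) ⁻¹' ((· * k⁻¹) ⁻¹' D) = D := by
    ext x
    simp
  rw [e] at h
  rw [h]
  exact hD'.setIntegral_eq hD fun γ x => hf γ γ.2 x

/-- The set `Y = Γ \ GL₂(ℚ₂) / GL₂(ℤ₂)`. -/
abbrev SetY (R : Subring ℍ[ℚ, a, b]) (ι : ℍ[ℚ, a, b] →ₐ[ℚ] M2) : Type :=
  DoubleCoset.Quotient (Gam R ι : Set GL2) (K2 : Set GL2)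

theorem FunY.eq_of_mk_eq (φ : FunY R ι) {x y : GL2}
    (h : DoubleCoset.mk (Gam R ι) K2 x = DoubleCoset.mk (Gam R ι) K2 y) : φ.toFun x = φ.toFun y := by
  obtain ⟨γ, hγ, k, hk, rfl⟩ := (DoubleCoset.eq _ _ _ _).1 h
  rw [φ.right_inv k hk, φ.left_inv γ hγ]

theorem mk_mul_mem_K2 (x : GL2) {k : GL2} (hk : k ∈ K2) :
    DoubleCoset.mk (Gam R ι) K2 (x * k) = DoubleCoset.mk (Gam R ι) K2 x :=
  ((DoubleCoset.eq _ _ _ _).2 ⟨1, one_mem _, k, hk, by rw [one_mul]⟩).symm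

theorem mk_Gam_mul (x : GL2) {γ : GL2} (hγ : γ ∈ Gam R ι) :
    DoubleCoset.mk (Gam R ι) K2 (γ * x) = DoubleCoset.mk (Gam R ι) K2 x :=
  ((DoubleCoset.eq _ _ _ _).2 ⟨γ, hγ, 1, one_mem _, by rw [mul_one]⟩).symm

/-- A function on `Y`, as a function on `GL₂(ℚ₂)`. -/
def FunY.ofFun (f : SetY R ι → ℝ) : FunY R ι where
  toFun x := f (DoubleCoset.mk _ _ x)
  left_inv γ hγ x := by rw [mk_Gam_mul x hγ]
  right_inv k hk x := by rw [mk_mul_mem_K2 x hk]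

theorem measure_left_coset [μ.IsHaarMeasure] (x : GL2) : μ ((x * ·) '' (K2 : Set GL2)) = μ (K2 : Set GL2) := by
  rw [Set.image_mul_left, measure_preimage_mul]

-- The part of D over the class of x is covered by the pieces γxK ∩ D, whose measures add up to
-- μ(xK).
open scoped Pointwise in
theorem measure_inter_mk_le [μ.IsHaarMeasure] (hD : IsFundamentalDomain (Gam R ι) D μ) (x : GL2) :
    μ (D ∩ DoubleCoset.mk (Gam R ι) K2 ⁻¹' {DoubleCoset.mk (Gam R ι) K2 x}) ≤ μ (K2 : Set GL2) := by
  rw [← measure_left_coset x, hD.measure_eq_tsum ((x * ·) '' (K2 : Set GL2))]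
  refine (measure_mono (μ := μ) ?_).trans (measure_iUnion_le
    fun γ : Gam R ι => γ • ((x * ·) '' (K2 : Set GL2)) ∩ D)
  rintro y ⟨hy, hy'⟩
  obtain ⟨γ, hγ, k, hk, rfl⟩ := (DoubleCoset.eq _ _ _ _).1 (Eq.symm hy')
  exact Set.mem_iUnion.2 ⟨⟨γ, hγ⟩, ⟨x * k, ⟨k, hk, rfl⟩, (mul_assoc _ _ _).symm⟩, hy⟩

theorem measure_fundamentalDomain_lt_top [μ.IsHaarMeasure] [Finite (SetY R ι)] (hμ : μ (K2 : Set GL2) ≠ ⊤)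
    (hD : IsFundamentalDomain (Gam R ι) D μ) : μ D < ⊤ := by
  have h : D = ⋃ y : SetY R ι, D ∩ DoubleCoset.mk (Gam R ι) K2 ⁻¹' {y} := by
    ext x
    simp
  have := Fintype.ofFinite (SetY R ι)
  rw [h]
  refine (measure_iUnion_fintype_le _ _).trans_lt (ENNReal.sum_lt_top.2 fun y _ => ?_)
  obtain ⟨x, rfl⟩ := Quotient.exists_rep y
  exact (measure_inter_mk_le hD x).trans_lt hμ.lt_top

theorem FunY.continuous (φ : FunY R ι) : Continuous φ.toFun := by
  refine IsLocallyConstant.continuous ((IsLocallyConstant.iff_exists_open _).2 fun x => ?_)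
  refine ⟨(x⁻¹ * ·) ⁻¹' K2, isOpen_K2.preimage (by fun_prop), by simp, fun y hy => ?_⟩
  have := φ.right_inv _ hy x
  rwa [mul_inv_cancel_left] at this

theorem FunY.bounded [Finite (SetY R ι)] (φ : FunY R ι) : ∃ C, ∀ x, ‖φ.toFun x‖ ≤ C := by
  have hfin : (Set.range φ.toFun).Finite := by
    refine (Set.finite_range fun y : SetY R ι => φ.toFun (Quotient.out y)).subset ?_
    rintro _ ⟨x, rfl⟩
    exact ⟨DoubleCoset.mk _ _ x, φ.eq_of_mk_eq (Quotient.out_eq _)⟩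
  obtain ⟨C, hC⟩ := hfin.isBounded.exists_norm_le
  exact ⟨C, fun x => hC _ ⟨x, rfl⟩⟩

theorem FunY.integrable_mul [μ.IsHaarMeasure] [Finite (SetY R ι)] (hμ : μ (K2 : Set GL2) ≠ ⊤)
    (hD : IsFundamentalDomain (Gam R ι) D μ) (φ₁ φ₂ : FunY R ι) (g : GL2) :
    IntegrableOn (fun x => φ₁.toFun (x * g) * φ₂.toFun x) D μ := by
  have : IsFiniteMeasure (μ.restrict D) :=
    isFiniteMeasure_restrict.2 (measure_fundamentalDomain_lt_top hμ hD).ne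
  obtain ⟨C₁, h₁⟩ := φ₁.bounded
  obtain ⟨C₂, h₂⟩ := φ₂.bounded
  refine Integrable.of_bound (C := C₁ * C₂) ?_ (Filter.Eventually.of_forall fun x => ?_)
  · exact ((φ₁.continuous.comp (continuous_mul_const g)).mul φ₂.continuous).aestronglyMeasurable
  · rw [norm_mul]
    exact mul_le_mul (h₁ _) (h₂ _) (norm_nonneg _) ((norm_nonneg _).trans (h₁ x))

theorem FunY.integrableOn [μ.IsHaarMeasure] [Finite (SetY R ι)] (hμ : μ (K2 : Set GL2) ≠ ⊤)
    (hD : IsFundamentalDomain (Gam R ι) D μ) (φ : FunY R ι) : IntegrableOn φ.toFun D μ := by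
  simpa [FunY.ofFun] using FunY.integrable_mul hμ hD φ (FunY.ofFun fun _ => 1) 1

/-! ### The finite set `Y` -/

variable {Ψ : Fin 2 → FunY R ι} {lam : Fin 2 → ℕ → ℝ}

/-- The linear combinations of `1, Ψ₁, Ψ₂`. -/
def combination (Ψ : Fin 2 → FunY R ι) : (Fin 3 → ℝ) →ₗ[ℝ] (SetY R ι → ℝ) where
  toFun c y := c 0 + c 1 * (Ψ 0).toFun (Quotient.out y) + c 2 * (Ψ 1).toFun (Quotient.out y)
  map_add' c d := by
    funext y
    simp only [Pi.add_apply]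
    ring
  map_smul' r c := by
    funext y
    simp only [Pi.smul_apply, smul_eq_mul, RingHom.id_apply]
    ring

theorem combination_surjective (hΨ : IsHeckeBasis μ D Ψ lam) :
    Function.Surjective (combination Ψ) := by
  intro f
  obtain ⟨c₀, c₁, c₂, h⟩ := hΨ.span (FunY.ofFun f)
  refine ⟨![c₀, c₁, c₂], funext fun y => ?_⟩
  have := h (Quotient.out y)
  change f (DoubleCoset.mk _ _ (Quotient.out y)) = _ at this
  rw [show DoubleCoset.mk (Gam R ι) K2 (Quotient.out y) = y from Quotient.out_eq y] at this
  exact this.symm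

/-- Three functions span all functions on Y, so Y cannot contain four points. -/
theorem finite_SetY (hΨ : IsHeckeBasis μ D Ψ lam) : Finite (SetY R ι) := by
  by_contra hinf
  rw [not_finite_iff_infinite] at hinf
  let e : Fin 4 ↪ SetY R ι := Fin.valEmbedding.trans (Infinite.natEmbedding _)
  have hs := (LinearMap.funLeft_surjective_of_injective ℝ ℝ e e.injective).comp
    (combination_surjective hΨ)
  rw [← LinearMap.coe_comp] at hs
  have := LinearMap.finrank_le_finrank_of_surjective hs
  simp at this

/-- Pair a vanishing combination with Ψ₁ and Ψ₂ to kill their coefficients; the constant term then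
vanishes as well. -/
theorem combination_injective [μ.IsHaarMeasure] (hΨ : IsHeckeBasis μ D Ψ lam) (hμ : μ (K2 : Set GL2) ≠ ⊤)
    (hD : IsFundamentalDomain (Gam R ι) D μ) : Function.Injective (combination Ψ) := by
  have := finite_SetY hΨ
  rw [injective_iff_map_eq_zero]
  intro c hc
  have h : ∀ x, c 0 + c 1 * (Ψ 0).toFun x + c 2 * (Ψ 1).toFun x = 0 := by
    intro x
    have := congrFun hc (DoubleCoset.mk _ _ x)
    have hout : DoubleCoset.mk (Gam R ι) K2 (Quotient.out (DoubleCoset.mk (Gam R ι) K2 x))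
        = DoubleCoset.mk (Gam R ι) K2 x := Quotient.out_eq _
    rw [← (Ψ 0).eq_of_mk_eq hout, ← (Ψ 1).eq_of_mk_eq hout]
    exact this
  have hint : ∀ k, c 0 * innerX μ D (Ψ k).toFun (fun _ => 1)
      + c 1 * innerX μ D (Ψ 0).toFun (Ψ k).toFun + c 2 * innerX μ D (Ψ 1).toFun (Ψ k).toFun = 0 := by
    intro k
    have hm : ∀ l, IntegrableOn (fun x => (Ψ l).toFun x * (Ψ k).toFun x) D μ := fun l => by
      simpa using FunY.integrable_mul hμ hD (Ψ l) (Ψ k) 1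
    have h1 : IntegrableOn (fun x => (Ψ k).toFun x * 1) D μ := by
      simpa using (Ψ k).integrableOn hμ hD
    simp only [innerX]
    have h2 : IntegrableOn (fun x => c 0 * ((Ψ k).toFun x * 1)
        + c 1 * ((Ψ 0).toFun x * (Ψ k).toFun x)) D μ := (h1.const_mul _).add ((hm 0).const_mul _)
    rw [← integral_const_mul, ← integral_const_mul, ← integral_const_mul,
      ← integral_add (h1.const_mul _) ((hm 0).const_mul _), ← integral_add h2 ((hm 1).const_mul _)]
    refine integral_eq_zero_of_ae (Filter.Eventually.of_forall fun x => ?_)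
    change c 0 * ((Ψ k).toFun x * 1) + c 1 * ((Ψ 0).toFun x * (Ψ k).toFun x)
      + c 2 * ((Ψ 1).toFun x * (Ψ k).toFun x) = 0
    linear_combination (Ψ k).toFun x * h x
  have h0 := hint 0
  have h1 := hint 1
  simp only [hΨ.mean_zero, hΨ.orthonormal] at h0 h1
  have e1 : c 1 = 0 := by simpa using h0
  have e2 : c 2 = 0 := by simpa using h1
  have e0 : c 0 = 0 := by simpa [e1, e2] using h 1
  funext i
  fin_cases i <;> simp [e0, e1, e2]

theorem card_SetY [μ.IsHaarMeasure] (hΨ : IsHeckeBasis μ D Ψ lam) (hμ : μ (K2 : Set GL2) ≠ ⊤)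
    (hD : IsFundamentalDomain (Gam R ι) D μ) : Nat.card (SetY R ι) = 3 := by
  have := finite_SetY hΨ
  have := Fintype.ofFinite (SetY R ι)
  have h := (LinearEquiv.ofBijective (combination Ψ)
    ⟨combination_injective hΨ hμ hD, combination_surjective hΨ⟩).finrank_eq
  simp only [Module.finrank_fintype_fun_eq_card, Fintype.card_fin] at h
  rw [Nat.card_eq_fintype_card, ← h]

/-! ### The spherical function -/

theorem matCoeff_eq (hΨ : IsHeckeBasis μ D Ψ lam) (k : Fin 2) (g : GL2) :
    matCoeff μ D (Ψ k) g = ∫ x in D, (Ψ k).toFun (x * g) * (Ψ k).toFun x ∂μ := by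
  rw [matCoeff, hΨ.orthonormal, if_pos rfl, div_one]
  rfl

theorem matCoeff_mul_K2 (φ : FunY R ι) (g : GL2) {k : GL2} (hk : k ∈ K2) :
    matCoeff μ D φ (g * k) = matCoeff μ D φ g := by
  simp only [matCoeff, ← mul_assoc, φ.right_inv k hk]

theorem matCoeff_center_mul (φ : FunY R ι) (g : GL2) {z : GL2} (hz : z ∈ Subgroup.center GL2) :
    matCoeff μ D φ (z * g) = matCoeff μ D φ g := by
  simp only [matCoeff, ← Subgroup.mem_center_iff.1 hz g, ← mul_assoc, φ.mul_center z hz]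

/-- Substitute xk for x in the integral; the second factor is unchanged because Ψ is right
K-invariant. -/
theorem matCoeff_K2_mul [μ.IsHaarMeasure] (hμ : μ (K2 : Set GL2) ≠ ⊤) (hD : IsFundamentalDomain (Gam R ι) D μ)
    (φ : FunY R ι) (g : GL2) {k : GL2} (hk : k ∈ K2) :
    matCoeff μ D φ (k * g) = matCoeff μ D φ g := by
  have h := setIntegral_mul_right hμ hD (f := fun x => φ.toFun (x * g) * φ.toFun x)
    (fun γ hγ x => by simp only [mul_assoc, φ.left_inv γ hγ]) hk
  simp only [φ.right_inv k hk] at h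
  simp only [matCoeff, innerX, ← mul_assoc, h]

theorem matCoeff_eq_of_inCartan [μ.IsHaarMeasure] (hμ : μ (K2 : Set GL2) ≠ ⊤)
    (hD : IsFundamentalDomain (Gam R ι) D μ) (φ : FunY R ι) {n : ℕ} {g : GL2} (hg : InCartan n g) :
    matCoeff μ D φ g = matCoeff μ D φ (dia n) := by
  obtain ⟨z, hz, k₁, h₁, k₂, h₂, rfl⟩ := hg
  rw [matCoeff_mul_K2 _ _ h₂, mul_assoc, matCoeff_center_mul _ _ hz, matCoeff_K2_mul hμ hD _ _ h₁]

/-- The eigenvalue equation at `2`. -/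
theorem sum_nbr_eigen (hR : IsOrder R) (hΨ : IsHeckeBasis μ D Ψ lam) (k : Fin 2) (x : GL2) :
    ∑ i, (Ψ k).toFun (x * nbr i) = √2 * lam k 2 * (Ψ k).toFun x := by
  rw [← hecke_two hR, hΨ.eigen k 2 one_le_two]
  norm_num

/-- Apply the eigenvalue equation of Ψ at the point xg under the integral sign. -/
theorem sum_matCoeff_nbr [μ.IsHaarMeasure] (hR : IsOrder R) (hΨ : IsHeckeBasis μ D Ψ lam)
    (hμ : μ (K2 : Set GL2) ≠ ⊤) (hD : IsFundamentalDomain (Gam R ι) D μ) (k : Fin 2) (g : GL2) :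
    ∑ i, matCoeff μ D (Ψ k) (g * nbr i) = √2 * lam k 2 * matCoeff μ D (Ψ k) g := by
  have := finite_SetY hΨ
  simp only [matCoeff_eq hΨ]
  rw [← integral_finsetSum _ fun i _ => FunY.integrable_mul hμ hD (Ψ k) (Ψ k) (g * nbr i),
    ← integral_const_mul]
  refine integral_congr_ae (Filter.Eventually.of_forall fun x => ?_)
  simp only [← mul_assoc, ← Finset.sum_mul, sum_nbr_eigen hR hΨ]

theorem matCoeff_dia_zero (hΨ : IsHeckeBasis μ D Ψ lam) (k : Fin 2) :
    matCoeff μ D (Ψ k) (dia 0) = 1 := by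
  have h := hΨ.orthonormal k k
  rw [if_pos rfl] at h
  simp only [dia_zero, matCoeff, mul_one, h, div_one]

theorem matCoeff_dia_one [μ.IsHaarMeasure] (hR : IsOrder R) (hΨ : IsHeckeBasis μ D Ψ lam)
    (hμ : μ (K2 : Set GL2) ≠ ⊤) (hD : IsFundamentalDomain (Gam R ι) D μ) (k : Fin 2) :
    3 * matCoeff μ D (Ψ k) (dia 1) = √2 * lam k 2 := by
  have h := sum_nbr (u := matCoeff μ D (Ψ k)) (v := fun n => matCoeff μ D (Ψ k) (dia n))
    (fun n g hg => matCoeff_eq_of_inCartan hμ hD _ hg) (inCartan_iff.2 (size_dia 0))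
  rw [sum_matCoeff_nbr hR hΨ hμ hD, matCoeff_dia_zero hΨ, mul_one, nsmul_eq_mul] at h
  exact h.symm

/-- Of the three neighbours of a vertex at distance n + 1, one is at distance n and two are at
distance n + 2. -/
theorem matCoeff_dia_add_two [μ.IsHaarMeasure] (hR : IsOrder R) (hΨ : IsHeckeBasis μ D Ψ lam)
    (hμ : μ (K2 : Set GL2) ≠ ⊤) (hD : IsFundamentalDomain (Gam R ι) D μ) (k : Fin 2) (n : ℕ) :
    matCoeff μ D (Ψ k) (dia n) + 2 * matCoeff μ D (Ψ k) (dia (n + 2))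
      = √2 * lam k 2 * matCoeff μ D (Ψ k) (dia (n + 1)) := by
  have h := sum_mul_nbr (u := matCoeff μ D (Ψ k)) (v := fun n => matCoeff μ D (Ψ k) (dia n))
    (fun n g hg => matCoeff_eq_of_inCartan hμ hD _ hg) (inCartan_iff.2 (size_dia (n + 1)))
  rw [sum_matCoeff_nbr hR hΨ hμ hD, nsmul_eq_mul] at h
  exact h.symm

end Quotient

/-! ### The quotient graph -/

section Graph

variable {a b : ℚ}

/-- The stabilizer in `Γ` of the vertex `x K`. -/
def stab (R : Subring ℍ[ℚ, a, b]) (ι : ℍ[ℚ, a, b] →ₐ[ℚ] M2) (x : GL2) : Subgroup GL2 :=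
  Gam R ι ⊓ K2.comap (MulAut.conj x⁻¹).toMonoidHom

variable {R : Subring ℍ[ℚ, a, b]} {ι : ℍ[ℚ, a, b] →ₐ[ℚ] M2} {μ : Measure GL2} {D : Set GL2}

theorem mem_stab_iff {x γ : GL2} : γ ∈ stab R ι x ↔ γ ∈ Gam R ι ∧ x⁻¹ * γ * x ∈ K2 := by
  simp [stab, Subgroup.mem_inf]

-- μ(xK) is the sum over Γ of the measures of γxK ∩ D. One term is nonzero, and it is repeated for
-- every element of the stabilizer; the sum is finite, so there are finitely many.
open scoped Pointwise in
theorem finite_stab [μ.IsHaarMeasure] (hμ : μ (K2 : Set GL2) ≠ ⊤)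
    (hD : IsFundamentalDomain (Gam R ι) D μ) (x : GL2) : Finite (stab R ι x) := by
  set t : Set GL2 := (x * ·) '' (K2 : Set GL2) with ht
  have hsum := hD.measure_eq_tsum t
  have hμt : μ t = μ (K2 : Set GL2) := measure_left_coset x
  have hpos : μ t ≠ 0 := hμt ▸ (isOpen_K2.measure_pos μ ⟨1, K2.one_mem⟩).ne'
  obtain ⟨γ₀, hγ₀⟩ : ∃ γ : Gam R ι, μ (γ • t ∩ D) ≠ 0 := by
    by_contra! h
    exact hpos (by rw [hsum, ENNReal.tsum_eq_zero.2 h])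
  have hfin := ENNReal.finite_const_le_of_tsum_ne_top (by rw [← hsum, hμt]; exact hμ) hγ₀
  have hinv : ∀ δ : stab R ι x, (⟨δ, (mem_stab_iff.1 δ.2).1⟩ : Gam R ι) • t = t := by
    rintro ⟨δ, hδ⟩
    obtain ⟨hδ1, hδ2⟩ := mem_stab_iff.1 hδ
    ext y
    constructor
    · rintro ⟨_, ⟨k, hk, rfl⟩, rfl⟩
      refine ⟨x⁻¹ * δ * x * k, K2.mul_mem hδ2 hk, ?_⟩
      change x * (x⁻¹ * δ * x * k) = δ * (x * k)
      group
    · rintro ⟨k, hk, rfl⟩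
      refine ⟨x * ((x⁻¹ * δ * x)⁻¹ * k), ⟨_, K2.mul_mem (K2.inv_mem hδ2) hk, rfl⟩, ?_⟩
      change δ * (x * ((x⁻¹ * δ * x)⁻¹ * k)) = x * k
      group
  have := hfin.to_subtype
  refine Finite.of_injective (fun δ : stab R ι x =>
    (⟨γ₀ * ⟨δ, (mem_stab_iff.1 δ.2).1⟩, ?_⟩ : {γ : Gam R ι | μ (γ₀ • t ∩ D) ≤ μ (γ • t ∩ D)})) ?_
  · rw [Set.mem_ofPred_eq, mul_smul, hinv]
  · intro δ δ' h
    have h1 := congrArg (fun z => (z.1 : GL2)) h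
    exact Subtype.ext (mul_left_cancel h1)

/-- The number of edges from `x` to the class of `y`. -/
def edgeCount (R : Subring ℍ[ℚ, a, b]) (ι : ℍ[ℚ, a, b] →ₐ[ℚ] M2) (x y : GL2) : ℕ :=
  Nat.card {i : Fin 3 // DoubleCoset.mk (Gam R ι) K2 y = DoubleCoset.mk (Gam R ι) K2 (x * nbr i)}

/-- The elements of `Γ` that take the vertex `y K` to a neighbour of `x K`. -/
def transporter (R : Subring ℍ[ℚ, a, b]) (ι : ℍ[ℚ, a, b] →ₐ[ℚ] M2) (x y : GL2) : Set GL2 :=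
  {γ | γ ∈ Gam R ι ∧ ∃ i, ∃ k ∈ K2, γ * y = x * nbr i * k}

/-- Sending γ to the index i with γyK = x·`nbr i`·K fibres the transporter over the edges from x to
the class of y, and each fibre is a coset of the stabilizer of y. -/
theorem card_transporter (x y : GL2) :
    Nat.card (transporter R ι x y) = edgeCount R ι x y * Nat.card (stab R ι y) := by
  have h : ∀ i : {i : Fin 3 // DoubleCoset.mk (Gam R ι) K2 y
      = DoubleCoset.mk (Gam R ι) K2 (x * nbr i)}, ∃ γ ∈ Gam R ι, ∃ k ∈ K2, γ * y = x * nbr i * k := by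
    rintro ⟨i, hi⟩
    obtain ⟨γ, hγ, k, hk, h⟩ := (DoubleCoset.eq _ _ _ _).1 hi
    exact ⟨γ, hγ, k⁻¹, K2.inv_mem hk, by rw [h, mul_inv_cancel_right]⟩
  choose γ hγ k hk hγk using h
  have hmem : ∀ p : {i : Fin 3 // DoubleCoset.mk (Gam R ι) K2 y
      = DoubleCoset.mk (Gam R ι) K2 (x * nbr i)} × stab R ι y, γ p.1 * p.2 ∈ transporter R ι x y := by
    intro p
    obtain ⟨h1, h2⟩ := mem_stab_iff.1 p.2.2
    refine ⟨mul_mem (hγ _) h1, p.1, _, K2.mul_mem (hk p.1) h2, ?_⟩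
    calc γ p.1 * p.2 * y = γ p.1 * y * (y⁻¹ * p.2 * y) := by group
      _ = _ := by rw [hγk]; group
  rw [edgeCount, ← Nat.card_prod]
  refine (Nat.card_congr (Equiv.ofBijective (fun p => ⟨γ p.1 * p.2, hmem p⟩) ⟨?_, ?_⟩)).symm
  · rintro ⟨i, δ⟩ ⟨j, ε⟩ h
    have h1 : γ i * δ = γ j * ε := congrArg Subtype.val h
    have hδ := (mem_stab_iff.1 δ.2).2
    have hε := (mem_stab_iff.1 ε.2).2
    have e : ∀ (i) (δ : GL2), γ i * δ * y = x * nbr i * (k i * (y⁻¹ * δ * y)) := fun i δ => by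
      calc γ i * δ * y = γ i * y * (y⁻¹ * δ * y) := by group
        _ = _ := by rw [hγk]; group
    have h2 : x * nbr i * (k i * (y⁻¹ * δ * y)) = x * nbr j * (k j * (y⁻¹ * ε * y)) := by
      rw [← e, ← e, h1]
    have hij : i = j := by
      refine Subtype.ext (nbr_mul_injective (k := k i * (y⁻¹ * δ * y) * (k j * (y⁻¹ * ε * y))⁻¹)
        (K2.mul_mem (K2.mul_mem (hk i) hδ) (K2.inv_mem (K2.mul_mem (hk j) hε))) ?_)
      rw [← mul_assoc, mul_inv_eq_iff_eq_mul]
      rw [mul_assoc x, mul_assoc x] at h2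
      exact mul_left_cancel h2
    subst hij
    exact Prod.ext rfl (Subtype.ext (mul_left_cancel h1))
  · rintro ⟨g, hg, i, l, hl, hgl⟩
    have hi : DoubleCoset.mk (Gam R ι) K2 y = DoubleCoset.mk (Gam R ι) K2 (x * nbr i) :=
      (DoubleCoset.eq _ _ _ _).2 ⟨g, hg, l⁻¹, K2.inv_mem hl, by rw [hgl, mul_inv_cancel_right]⟩
    refine ⟨⟨⟨i, hi⟩, ⟨(γ ⟨i, hi⟩)⁻¹ * g, mem_stab_iff.2 ⟨mul_mem (inv_mem (hγ _)) hg, ?_⟩⟩⟩, ?_⟩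
    · have e : y⁻¹ * ((γ ⟨i, hi⟩)⁻¹ * g) * y = (γ ⟨i, hi⟩ * y)⁻¹ * (g * y) := by group
      rw [e, hgl, hγk]
      have e2 : (x * nbr i * k ⟨i, hi⟩)⁻¹ * (x * nbr i * l) = (k ⟨i, hi⟩)⁻¹ * l := by group
      rw [e2]
      exact K2.mul_mem (K2.inv_mem (hk _)) hl
    · exact Subtype.ext (mul_inv_cancel_left _ _)

/-- The scalar matrix `2`. -/
def twoGL : GL2 := Matrix.GeneralLinearGroup.scalar (Fin 2) twoUnit

theorem twoGL_comm (g : GL2) : g * twoGL = twoGL * g := by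
  refine Subgroup.mem_center_iff.1 ?_ g
  rw [Matrix.GeneralLinearGroup.center_eq_range_scalar]
  exact ⟨_, rfl⟩

theorem exists_twoGL_mul_nbr_inv (i : Fin 3) : ∃ j, ∃ k ∈ K2, twoGL * (nbr i)⁻¹ = nbr j * k := by
  have h : ((twoGL * (nbr i)⁻¹ : GL2) : M2) = (nbrM i).adjugate := by
    have h2 : (twoGL : M2) = (2 : ℚ_[2]) • (1 : M2) := by
      change Matrix.scalar (Fin 2) (2 : ℚ_[2]) = _
      rw [Matrix.scalar_apply, ← Matrix.smul_one_eq_diagonal]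
    rw [Units.val_mul, Matrix.coe_units_inv, nbr_val, Matrix.inv_def, det_nbrM, Ring.inverse_eq_inv,
      h2, smul_mul_smul_comm, one_mul, mul_inv_cancel₀ two_ne_zero, one_smul]
  refine exists_eq_nbr_mul ?_ ?_
  · rw [h, maxNorm_le_iff zero_le_one]
    have := (maxNorm_le_iff zero_le_one).1 (maxNorm_nbr_le i)
    rw [nbr_val] at this
    intro j l
    fin_cases j <;> fin_cases l <;> simp [Matrix.adjugate_fin_two, this]
  · rw [h, Matrix.det_adjugate, det_nbrM]
    simp [norm_two_padic]

/-- Adjacency is symmetric because 2·`nbr i`⁻¹ is again integral of determinant 2, and the scalar 2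
lies in Γ. -/
theorem transporter_symm {x y γ : GL2} (h : γ ∈ transporter R ι x y) :
    twoGL * γ⁻¹ ∈ transporter R ι y x := by
  obtain ⟨hγ, i, k, hk, e⟩ := h
  refine ⟨mul_mem (scalar_two_mem_Gam R ι) (inv_mem hγ), ?_⟩
  obtain ⟨j, l, hl, hj⟩ := exists_twoGL_mul_nbr_inv i
  obtain ⟨m, l', hl', hm⟩ : ∃ m, ∃ l' ∈ K2, k⁻¹ * nbr j = nbr m * l' := by
    refine exists_eq_nbr_mul ?_ ?_
    · rw [Units.val_mul, maxNorm_mul_of_mem_K2 (K2.inv_mem hk)]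
      exact maxNorm_nbr_le j
    · rw [Units.val_mul, Matrix.det_mul, norm_mul, norm_det_of_mem_K2 (K2.inv_mem hk), one_mul,
        norm_det_nbr]
  refine ⟨m, l' * l, K2.mul_mem hl' hl, ?_⟩
  have e1 : γ⁻¹ * x = y * k⁻¹ * (nbr i)⁻¹ := by
    have : γ = x * nbr i * k * y⁻¹ := by rw [← e, mul_inv_cancel_right]
    rw [this]
    group
  calc twoGL * γ⁻¹ * x = y * k⁻¹ * (twoGL * (nbr i)⁻¹) := by
        rw [mul_assoc, e1, ← mul_assoc, ← twoGL_comm, mul_assoc]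
    _ = y * (k⁻¹ * nbr j) * l := by
        rw [hj]
        group
    _ = y * nbr m * (l' * l) := by
        rw [hm]
        group

theorem card_transporter_symm (x y : GL2) :
    Nat.card (transporter R ι x y) = Nat.card (transporter R ι y x) := by
  have h : ∀ γ : GL2, twoGL * (twoGL * γ⁻¹)⁻¹ = γ := fun γ => by
    rw [mul_inv_rev, inv_inv, ← mul_assoc, ← twoGL_comm, mul_inv_cancel_right]
  exact Nat.card_congr ⟨fun γ => ⟨_, transporter_symm γ.2⟩, fun γ => ⟨_, transporter_symm γ.2⟩,
    fun γ => Subtype.ext (h γ), fun γ => Subtype.ext (h γ)⟩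

theorem edgeCount_mul_card_stab (x y : GL2) :
    edgeCount R ι x y * Nat.card (stab R ι y) = edgeCount R ι y x * Nat.card (stab R ι x) := by
  rw [← card_transporter, ← card_transporter, card_transporter_symm]

/-! ### The stabilizers have order not divisible by `12` -/

theorem injective_of_isRamified (hB : IsRamifiedAtInftyAnd23 a b) : Function.Injective ι := by
  rw [injective_iff_map_eq_zero]
  intro x hx
  by_contra hne
  have := (isUnit_of_isRamified hB hne).map ι
  rw [hx] at this
  exact not_isUnit_zero this

theorem neg_one_mem_stab (x : GL2) : (-1 : GL2) ∈ stab R ι x := by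
  refine mem_stab_iff.2 ⟨mem_Gam_iff.2 ⟨-1, ?_⟩, ?_⟩
  · simp
  · have : x⁻¹ * -1 * x = -1 := by simp
    rw [this, mem_K2_iff, maxNorm_le_iff zero_le_one]
    refine ⟨fun i j => ?_, ?_⟩
    · fin_cases i <;> fin_cases j <;> simp
    · simp [Matrix.det_neg]

theorem neg_one_ne_one_GL2 : (-1 : GL2) ≠ 1 := by
  intro h
  have := congrArg (fun g : GL2 => (g : M2) 0 0) h
  norm_num at this

theorem two_dvd_card_stab (x : GL2) : 2 ∣ Nat.card (stab R ι x) := by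
  have h : orderOf (⟨-1, neg_one_mem_stab x⟩ : stab R ι x) = 2 := by
    refine orderOf_eq_prime ?_ ?_
    · exact Subtype.ext (by simp)
    · intro h
      exact neg_one_ne_one_GL2 (congrArg Subtype.val h)
  have hd := orderOf_dvd_natCard (⟨-1, neg_one_mem_stab x⟩ : stab R ι x)
  rwa [h] at hd

/-- By the Cauchy and Sylow theorems such a group has an element of order 3 and a subgroup of order
4. As the quaternion algebra has no zero divisors, these lift to ω with ω² + ω + 1 = 0 and i with i²
= −1. Their product has finite order, hence is integral. -/
theorem not_dvd_card_stab (hB : IsRamifiedAtInftyAnd23 a b) (x : GL2) [Finite (stab R ι x)] :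
    ¬ 12 ∣ Nat.card (stab R ι x) := by
  intro hdvd
  have hinj := injective_of_isRamified (ι := ι) hB
  have hlift : ∀ γ ∈ stab R ι x, ∃ u : ℍ[ℚ, a, b], ι u = (γ : M2) := fun γ hγ => by
    obtain ⟨u, hu⟩ := mem_Gam_iff.1 (mem_stab_iff.1 hγ).1
    exact ⟨_, hu⟩
  have hdom : ∀ y z : ℍ[ℚ, a, b], y * z = 0 → y = 0 ∨ z = 0 := fun y z hyz => by
    by_contra! h
    exact not_isUnit_of_mul_eq_zero hyz h.2 (isUnit_of_isRamified hB h.1)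
  have : Fact (Nat.Prime 3) := ⟨Nat.prime_three⟩
  obtain ⟨w, hw⟩ := exists_prime_orderOf_dvd_card' (G := stab R ι x) 3
    ((by norm_num : 3 ∣ 12).trans hdvd)
  obtain ⟨ω, hω⟩ := hlift w w.2
  have hω3 : ω ^ 3 = 1 := by
    refine hinj ?_
    have h1 : (w : GL2) ^ 3 = 1 := by
      have := pow_orderOf_eq_one w
      rw [hw] at this
      exact congrArg Subtype.val this
    rw [map_pow, hω, map_one, ← Units.val_pow_eq_pow_val, h1, Units.val_one]
  have hω1 : ω ≠ 1 := by
    rintro rfl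
    rw [map_one] at hω
    have : w = 1 := Subtype.ext (Units.ext hω.symm)
    rw [this, orderOf_one] at hw
    norm_num at hw
  have hω2 : ω * ω + ω + 1 = 0 := by
    refine (hdom (ω - 1) _ ?_).resolve_left (sub_ne_zero.2 hω1)
    have : (ω - 1) * (ω * ω + ω + 1) = ω ^ 3 - 1 := by noncomm_ring
    rw [this, hω3, sub_self]
  obtain ⟨P, hP⟩ := Sylow.exists_subgroup_card_pow_prime (G := stab R ι x) 2 (n := 2)
    ((by norm_num : 2 ^ 2 ∣ 12).trans hdvd)
  -- A group of order 4 is not contained in {1, −1}.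
  obtain ⟨v, hv, hv1, hvn⟩ : ∃ v ∈ P, (v : GL2) ≠ 1 ∧ (v : GL2) ≠ -1 := by
    by_contra! h
    have hsub : (fun v : P => ((v : stab R ι x) : GL2)).Injective :=
      Subtype.val_injective.comp Subtype.val_injective
    have hm : ∀ v : P, ((v : stab R ι x) : GL2) ∈ ({1, -1} : Set GL2) := fun v => by
      by_cases h1 : ((v : stab R ι x) : GL2) = 1
      · exact Or.inl h1
      · exact Or.inr (h v v.2 h1)
    let f : P → ({1, -1} : Set GL2) := fun v => ⟨((v : stab R ι x) : GL2), hm v⟩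
    have hf : f.Injective := fun v v' hvv =>
      hsub (congrArg (fun z : ({1, -1} : Set GL2) => (z : GL2)) hvv)
    have hle := Nat.card_le_card_of_injective f hf
    have h2 : Nat.card ({1, -1} : Set GL2) ≤ 2 := by
      rw [Nat.card_coe_set_eq]
      exact Set.ncard_insert_le _ _ |>.trans (by simp)
    omega
  obtain ⟨i, hi⟩ := hlift v v.2
  have hi4 : i ^ 4 = 1 := by
    refine hinj ?_
    have h1 : (v : GL2) ^ 4 = 1 := by
      have h4 := pow_card_eq_one' (x := (⟨v, hv⟩ : P))
      rw [hP] at h4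
      have := congrArg (fun z : P => ((z : stab R ι x) : GL2)) h4
      simpa using this
    rw [map_pow, hi, map_one, ← Units.val_pow_eq_pow_val, h1, Units.val_one]
  have hine : i ≠ 1 := by
    rintro rfl
    rw [map_one] at hi
    exact hv1 (Units.ext hi.symm)
  have hine' : i ≠ -1 := by
    rintro rfl
    rw [map_neg, map_one] at hi
    exact hvn (Units.ext hi.symm)
  have hi2 : i * i = -1 := by
    have h1 : (i - 1) * ((i + 1) * (i * i + 1)) = 0 := by
      have : (i - 1) * ((i + 1) * (i * i + 1)) = i ^ 4 - 1 := by noncomm_ring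
      rw [this, hi4, sub_self]
    have h2 := (hdom _ _ h1).resolve_left (sub_ne_zero.2 hine)
    have h3 := (hdom _ _ h2).resolve_left (fun h => hine' (eq_neg_of_add_eq_zero_left h))
    exact eq_neg_of_add_eq_zero_left h3
  have hint : IsIntegral ℤ (i * ω) := by
    refine IsIntegral.of_pow (Nat.card_pos (α := stab R ι x)) ?_
    have h1 : (i * ω) ^ Nat.card (stab R ι x) = 1 := by
      refine hinj ?_
      have h2 : ((v * w : stab R ι x) : GL2) ^ Nat.card (stab R ι x) = 1 :=
        congrArg Subtype.val (pow_card_eq_one' (x := v * w))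
      rw [map_pow, map_mul, hi, hω, map_one, ← Units.val_mul, ← Units.val_pow_eq_pow_val]
      exact congrArg Units.val h2
    rw [h1]
    exact isIntegral_one
  exact not_exists_order_three_four hB hi2 hω2 hint

/-! ### The quotient graph is not bipartite -/

/-- Here x₁ is alone in its colour class. All three edges from x₂ and from x₃ go to x₁, so, with w
the stabilizer orders, e(x₁,x₂)w₂ = 3w₁ = e(x₁,x₃)w₃, where the two edge counts add up to 3. -/
theorem not_bipartite_aux [μ.IsHaarMeasure] (hμ : μ (K2 : Set GL2) ≠ ⊤)
    (hD : IsFundamentalDomain (Gam R ι) D μ) (hB : IsRamifiedAtInftyAnd23 a b) {v : FunY R ι}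
    (hv : ∀ x i, v.toFun (x * nbr i) = -v.toFun x) (hv0 : ∀ x, v.toFun x ≠ 0) {x₁ x₂ x₃ : GL2}
    (hcover : ∀ x, DoubleCoset.mk (Gam R ι) K2 x₁ = DoubleCoset.mk (Gam R ι) K2 x ∨
      DoubleCoset.mk (Gam R ι) K2 x₂ = DoubleCoset.mk (Gam R ι) K2 x ∨
      DoubleCoset.mk (Gam R ι) K2 x₃ = DoubleCoset.mk (Gam R ι) K2 x)
    (h23 : DoubleCoset.mk (Gam R ι) K2 x₂ ≠ DoubleCoset.mk (Gam R ι) K2 x₃)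
    (h2 : v.toFun x₂ = -v.toFun x₁) (h3 : v.toFun x₃ = -v.toFun x₁) : False := by
  have := finite_stab (ι := ι) hμ hD
  have hne : ∀ x, v.toFun x ≠ -v.toFun x := fun x h => hv0 x (by linarith)
  have hN : ∀ y, v.toFun y = -v.toFun x₁ → edgeCount R ι y x₁ = 3 := by
    intro y hy
    have h : ∀ i, DoubleCoset.mk (Gam R ι) K2 x₁ = DoubleCoset.mk (Gam R ι) K2 (y * nbr i) := by
      intro i
      have hvi : v.toFun (y * nbr i) = v.toFun x₁ := by rw [hv, hy, neg_neg]
      rcases hcover (y * nbr i) with h | h | h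
      · exact h
      · exact absurd (hvi.symm.trans ((v.eq_of_mk_eq h).symm.trans h2)) (hne x₁)
      · exact absurd (hvi.symm.trans ((v.eq_of_mk_eq h).symm.trans h3)) (hne x₁)
    rw [edgeCount, Nat.card_congr (Equiv.subtypeUnivEquiv h), Nat.card_eq_fintype_card,
      Fintype.card_fin]
  have hsum : edgeCount R ι x₁ x₂ + edgeCount R ι x₁ x₃ = 3 := by
    have h : ∀ i, DoubleCoset.mk (Gam R ι) K2 x₃ = DoubleCoset.mk (Gam R ι) K2 (x₁ * nbr i) ↔
        ¬ DoubleCoset.mk (Gam R ι) K2 x₂ = DoubleCoset.mk (Gam R ι) K2 (x₁ * nbr i) := by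
      intro i
      refine ⟨fun h3 h2 => h23 (h2.trans h3.symm), fun h2 => ?_⟩
      rcases hcover (x₁ * nbr i) with h | h | h
      · exact absurd ((v.eq_of_mk_eq h).trans (hv x₁ i)) (hne x₁)
      · exact absurd h h2
      · exact h
    classical
    rw [edgeCount, edgeCount, Nat.card_congr (Equiv.subtypeEquivRight h), ← Nat.card_sum,
      Nat.card_congr (Equiv.sumCompl _), Nat.card_eq_fintype_card, Fintype.card_fin]
  have e2 := edgeCount_mul_card_stab (R := R) (ι := ι) x₁ x₂
  have e3 := edgeCount_mul_card_stab (R := R) (ι := ι) x₁ x₃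
  rw [hN x₂ h2] at e2
  rw [hN x₃ h3] at e3
  have p1 : 0 < Nat.card (stab R ι x₁) := Nat.card_pos
  have d2 := two_dvd_card_stab (R := R) (ι := ι) x₂
  have d3 := two_dvd_card_stab (R := R) (ι := ι) x₃
  have n2 := not_dvd_card_stab (R := R) (ι := ι) hB x₂
  have n3 := not_dvd_card_stab (R := R) (ι := ι) hB x₃
  obtain h | h | h | h : edgeCount R ι x₁ x₂ = 0 ∨ edgeCount R ι x₁ x₂ = 1 ∨
      edgeCount R ι x₁ x₂ = 2 ∨ edgeCount R ι x₁ x₂ = 3 := by omega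
  · rw [h] at e2
    omega
  -- Now w₂ = 3w₁ and 2w₃ = 3w₁. Then 3 divides w₃, which is even because of −1, so 12 divides w₂ =
  -- 2w₃.
  · have h' : edgeCount R ι x₁ x₃ = 2 := by omega
    rw [h] at e2
    rw [h'] at e3
    omega
  · have h' : edgeCount R ι x₁ x₃ = 1 := by omega
    rw [h] at e2
    rw [h'] at e3
    omega
  · have h' : edgeCount R ι x₁ x₃ = 0 := by omega
    rw [h'] at e3
    omega

/-- A two-colouring of three vertices is constant, which is impossible since neighbours have
opposite signs, or isolates one vertex; the eight cases only identify that vertex. -/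
theorem not_bipartite [μ.IsHaarMeasure] (hμ : μ (K2 : Set GL2) ≠ ⊤)
    (hD : IsFundamentalDomain (Gam R ι) D μ) (hB : IsRamifiedAtInftyAnd23 a b)
    (hcard : Nat.card (SetY R ι) = 3) {v : FunY R ι}
    (hv : ∀ x i, v.toFun (x * nbr i) = -v.toFun x) (hv1 : ∀ x, v.toFun x = 1 ∨ v.toFun x = -1) :
    False := by
  have hv0 : ∀ x, v.toFun x ≠ 0 := fun x => by rcases hv1 x with h | h <;> rw [h] <;> norm_num
  obtain ⟨e⟩ : Nonempty (SetY R ι ≃ Fin 3) := by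
    have : Finite (SetY R ι) := Nat.finite_of_card_ne_zero (by omega)
    exact ⟨(Finite.equivFinOfCardEq hcard)⟩
  have hrep : ∀ i, ∃ x, DoubleCoset.mk (Gam R ι) K2 x = e.symm i := fun i =>
    Quotient.exists_rep (e.symm i)
  choose x hx using hrep
  have hcover : ∀ y, DoubleCoset.mk (Gam R ι) K2 (x 0) = DoubleCoset.mk (Gam R ι) K2 y ∨
      DoubleCoset.mk (Gam R ι) K2 (x 1) = DoubleCoset.mk (Gam R ι) K2 y ∨
      DoubleCoset.mk (Gam R ι) K2 (x 2) = DoubleCoset.mk (Gam R ι) K2 y := by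
    intro y
    simp only [hx, Equiv.symm_apply_eq]
    generalize e (DoubleCoset.mk (Gam R ι) K2 y) = j
    fin_cases j <;> simp
  have hne : ∀ i j, i ≠ j →
      DoubleCoset.mk (Gam R ι) K2 (x i) ≠ DoubleCoset.mk (Gam R ι) K2 (x j) := by
    intro i j hij h
    rw [hx, hx] at h
    exact hij (e.symm.injective h)
  have aux := @not_bipartite_aux a b R ι μ D _ hμ hD hB v hv hv0
  have hconst : ¬ (v.toFun (x 0) = v.toFun (x 1) ∧ v.toFun (x 0) = v.toFun (x 2)) := by
    rintro ⟨h1, h2⟩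
    have hall : ∀ y, v.toFun y = v.toFun (x 0) := by
      intro y
      rcases hcover y with h | h | h
      · exact (v.eq_of_mk_eq h).symm
      · exact (v.eq_of_mk_eq h).symm.trans h1.symm
      · exact (v.eq_of_mk_eq h).symm.trans h2.symm
    have := hv 1 0
    rw [hall (1 * nbr 0), hall 1] at this
    exact hv0 (x 0) (by linarith)
  rcases hv1 (x 0) with h0 | h0 <;> rcases hv1 (x 1) with h1 | h1 <;>
    rcases hv1 (x 2) with h2 | h2
  · exact hconst ⟨h0.trans h1.symm, h0.trans h2.symm⟩
  · exact aux (fun y => by have := hcover y; tauto) (hne 0 1 (by decide)) (x₁ := x 2) (by rw [h0, h2, neg_neg]) (by rw [h1, h2, neg_neg])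
  · exact aux (fun y => by have := hcover y; tauto) (hne 0 2 (by decide)) (x₁ := x 1) (by rw [h0, h1, neg_neg]) (by rw [h2, h1, neg_neg])
  · exact aux (fun y => by have := hcover y; tauto) (hne 1 2 (by decide)) (x₁ := x 0) (by rw [h0, h1]) (by rw [h2, h0])
  · exact aux (fun y => by have := hcover y; tauto) (hne 1 2 (by decide)) (x₁ := x 0) (by rw [h0, h1, neg_neg]) (by rw [h2, h0, neg_neg])
  · exact aux (fun y => by have := hcover y; tauto) (hne 0 2 (by decide)) (x₁ := x 1) (by rw [h0, h1]) (by rw [h2, h1])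
  · exact aux (fun y => by have := hcover y; tauto) (hne 0 1 (by decide)) (x₁ := x 2) (by rw [h0, h2]) (by rw [h1, h2])
  · exact hconst ⟨h0.trans h1.symm, h0.trans h2.symm⟩

end Graph

/-! ### The strict bound for the Hecke eigenvalue at 2 -/

section Eigenvalue

variable {a b : ℚ} {R : Subring ℍ[ℚ, a, b]} {ι : ℍ[ℚ, a, b] →ₐ[ℚ] M2} {μ : Measure GL2} {D : Set GL2}

theorem eq_of_sum_eq_three_mul {u : Fin 3 → ℝ} {η : ℝ} (hu : ∀ i, |u i| ≤ 1) (hη : η = 1 ∨ η = -1)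
    (h : ∑ i, u i = 3 * η) (i : Fin 3) : u i = η := by
  rw [Fin.sum_univ_three] at h
  have h0 := abs_le.1 (hu 0)
  have h1 := abs_le.1 (hu 1)
  have h2 := abs_le.1 (hu 2)
  rcases hη with rfl | rfl <;> fin_cases i <;> simp only [Fin.mk_zero, Fin.mk_one, Fin.reduceFinMk,
    Fin.isValue] <;> linarith

/-- Maximum principle: where |v| attains its maximum 1 and the eigenvalue is ±3, all three
neighbours take the extreme value, so the extreme values propagate along the tree. -/
theorem eq_pow_of_eigenvalue_eq {v : FunY R ι} {x₀ : GL2} {ε : ℝ} (hε : ε = 1 ∨ ε = -1)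
    (hv : ∀ x, |v.toFun x| ≤ 1) (h0 : v.toFun x₀ = 1)
    (hs : ∀ x, ∑ i, v.toFun (x * nbr i) = 3 * ε * v.toFun x) {n : ℕ} {g : GL2} (hg : InCartan n g) :
    v.toFun (x₀ * g) = ε ^ n := by
  have hpow : ∀ n : ℕ, ε ^ n = 1 ∨ ε ^ n = -1 := fun n => by
    rcases hε with rfl | rfl
    · exact Or.inl (one_pow n)
    · exact neg_one_pow_eq_or ℝ n
  induction n generalizing g with
  | zero =>
    obtain ⟨z, hz, k₁, h₁, k₂, h₂, rfl⟩ := hg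
    rw [dia_zero, mul_one, ← mul_assoc, v.right_inv k₂ h₂, ← mul_assoc, v.right_inv k₁ h₁,
      v.mul_center z hz, h0, pow_zero]
  | succ n ih =>
    obtain ⟨z, hz, k₁, h₁, k₂, h₂, rfl⟩ := hg
    have hd : dia (n + 1) = dia n * nbr 2 := by
      ext1
      rw [Units.val_mul, dia_val, dia_val, nbr_val]
      simp [nbrM, pow_succ]
    have h1 : InCartan n (z * k₁ * dia n) := ⟨z, hz, k₁, h₁, 1, one_mem _, by rw [mul_one]⟩
    have h2 := hs (x₀ * (z * k₁ * dia n))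
    rw [ih h1, mul_assoc 3 ε, ← pow_succ'] at h2
    have h3 := eq_of_sum_eq_three_mul (fun i => hv _) (hpow _) h2 2
    rw [← mul_assoc, v.right_inv k₂ h₂, hd, ← h3]
    simp only [mul_assoc]

theorem abs_eigenvalue_lt_three [μ.IsHaarMeasure] (hB : IsRamifiedAtInftyAnd23 a b)
    (hR : IsOrder R) (hμ : μ (K2 : Set GL2) ≠ ⊤) (hD : IsFundamentalDomain (Gam R ι) D μ)
    {Ψ : Fin 2 → FunY R ι} {lam : Fin 2 → ℕ → ℝ} (hΨ : IsHeckeBasis μ D Ψ lam) (k : Fin 2) :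
    |√2 * lam k 2| < 3 := by
  have := finite_SetY hΨ
  set s := √2 * lam k 2 with hs
  have heig : ∀ x, ∑ i, (Ψ k).toFun (x * nbr i) = s * (Ψ k).toFun x := sum_nbr_eigen hR hΨ k
  -- Normalize Ψ by its value at a point of maximal absolute value.
  obtain ⟨y₀, hy₀⟩ := Finite.exists_max fun y : SetY R ι => |(Ψ k).toFun (Quotient.out y)|
  set x₀ := Quotient.out y₀ with hx₀
  have hmax : ∀ x, |(Ψ k).toFun x| ≤ |(Ψ k).toFun x₀| := fun x => by
    rw [← (Ψ k).eq_of_mk_eq (x := Quotient.out (DoubleCoset.mk (Gam R ι) K2 x)) (Quotient.out_eq _)]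
    exact hy₀ _
  have hnorm := hΨ.orthonormal k k
  rw [if_pos rfl] at hnorm
  set c := (Ψ k).toFun x₀ with hc
  have hc0 : c ≠ 0 := by
    intro h0
    have : ∀ x, (Ψ k).toFun x = 0 := fun x => by simpa [h0] using hmax x
    simp [innerX, this] at hnorm
  let v : FunY R ι :=
    { toFun := fun x => (Ψ k).toFun x / c
      left_inv := fun γ hγ x => by rw [(Ψ k).left_inv γ hγ]
      right_inv := fun l hl x => by rw [(Ψ k).right_inv l hl] }
  have hvdef : ∀ x, v.toFun x = (Ψ k).toFun x / c := fun x => rfl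
  have hv : ∀ x, |v.toFun x| ≤ 1 := fun x => by
    rw [hvdef, abs_div]
    exact div_le_one_of_le₀ (hmax x) (abs_nonneg _)
  have hv0 : v.toFun x₀ = 1 := div_self hc0
  have hvs : ∀ x, ∑ i, v.toFun (x * nbr i) = s * v.toFun x := fun x => by
    simp only [hvdef]
    rw [← Finset.sum_div, heig, mul_div_assoc]
  have hle : |s| ≤ 3 := by
    have h := hvs x₀
    rw [hv0, mul_one] at h
    rw [← h]
    calc |∑ i, v.toFun (x₀ * nbr i)| ≤ ∑ i, |v.toFun (x₀ * nbr i)| := Finset.abs_sum_le_sum_abs _ _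
      _ ≤ ∑ _i : Fin 3, (1 : ℝ) := Finset.sum_le_sum fun i _ => hv _
      _ = 3 := by simp
  refine lt_of_le_of_ne hle fun heq => ?_
  rcases (abs_eq three_pos.le).1 heq with h3 | h3
  · have hvall : ∀ x, (Ψ k).toFun x = c := by
      intro x
      obtain ⟨n, hn⟩ := exists_inCartan (x₀⁻¹ * x)
      have h := eq_pow_of_eigenvalue_eq (Or.inl rfl) hv hv0 (fun x => by rw [hvs, h3, mul_one]) hn
      rw [mul_inv_cancel_left, one_pow, hvdef] at h
      exact (div_eq_one_iff_eq hc0).1 h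
    have h0 := hΨ.mean_zero k
    simp only [innerX, hvall, mul_one] at h0 hnorm
    rw [integral_const_mul, h0, mul_zero] at hnorm
    exact zero_ne_one hnorm
  · have hv1 : ∀ x, v.toFun x = 1 ∨ v.toFun x = -1 := by
      intro x
      obtain ⟨n, hn⟩ := exists_inCartan (x₀⁻¹ * x)
      have h := eq_pow_of_eigenvalue_eq (Or.inr rfl) hv hv0 (fun x => by rw [hvs, h3]; ring) hn
      rw [mul_inv_cancel_left] at h
      rw [h]
      exact neg_one_pow_eq_or ℝ n
    refine not_bipartite hμ hD hB (card_SetY hΨ hμ hD) (v := v) (fun x i => ?_) hv1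
    refine eq_of_sum_eq_three_mul (u := fun i => v.toFun (x * nbr i)) (fun i => hv _) ?_ ?_ i
    · rcases hv1 x with h | h <;> simp [h]
    · rw [hvs, h3]
      ring

end Eigenvalue

/-! ### A linear recurrence -/

theorem summable_of_le_mul_add {f g : ℕ → ℝ} {r : ℝ} (hf : ∀ n, 0 ≤ f n) (hg : ∀ n, 0 ≤ g n)
    (hgs : Summable g) (hr : 0 ≤ r) (hr1 : r < 1) (h : ∀ n, f (n + 1) ≤ r * f n + g n) :
    Summable f := by
  have h1 : 0 < 1 - r := sub_pos.2 hr1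
  refine summable_of_sum_range_le (c := (f 0 + ∑' n, g n) / (1 - r)) hf fun n => ?_
  induction n with
  | zero =>
    rw [Finset.sum_range_zero]
    exact div_nonneg (add_nonneg (hf 0) (tsum_nonneg hg)) h1.le
  | succ n ih =>
    rw [Finset.sum_range_succ']
    have h2 : ∑ i ∈ Finset.range n, f (i + 1)
        ≤ r * ∑ i ∈ Finset.range n, f i + ∑ i ∈ Finset.range n, g i := by
      rw [Finset.mul_sum, ← Finset.sum_add_distrib]
      exact Finset.sum_le_sum fun i _ => h i
    have h3 : ∑ i ∈ Finset.range n, g i ≤ ∑' n, g n := hgs.sum_le_tsum _ fun i _ => hg i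
    have h4 := mul_le_mul_of_nonneg_left ih hr
    have h5 : r * ((f 0 + ∑' n, g n) / (1 - r)) + (f 0 + ∑' n, g n)
        = (f 0 + ∑' n, g n) / (1 - r) := by
      field_simp
      ring
    linarith

/-- Nonreal roots are conjugate with product 1/2. A real root x satisfies 2x² + 1 = |s||x| < 3|x|,
that is (2|x| − 1)(|x| − 1) < 0. -/
theorem norm_root_lt_one {s : ℝ} (hs : |s| < 3) {r : ℂ} (hr : r ^ 2 - s / 2 * r + 1 / 2 = 0) :
    ‖r‖ < 1 := by
  obtain ⟨x, y⟩ := r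
  have hre : x * x - y * y - s / 2 * x + 1 / 2 = 0 := by
    have := congrArg Complex.re hr
    simpa [pow_two] using this
  have him : 2 * x * y - s / 2 * y = 0 := by
    have := congrArg Complex.im hr
    simp [pow_two] at this
    linarith
  have hsq : x * x + y * y < 1 := by
    by_cases hy : y = 0
    · subst hy
      have h1 : |s| * |x| = 2 * (|x| * |x|) + 1 := by
        rw [← abs_mul, abs_mul_abs_self, abs_of_nonneg]
        · linarith
        · nlinarith [mul_self_nonneg x]
      have hx : 0 ≤ |x| := abs_nonneg x
      have h2 : |x| * |x| = x * x := abs_mul_abs_self x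
      have h3 : 0 < |x| := by
        refine lt_of_le_of_ne hx fun h0 => ?_
        rw [← h0] at h1
        norm_num at h1
      have h4 := mul_lt_mul_of_pos_right hs h3
      have h5 : |x| < 1 := by nlinarith
      nlinarith
    · have hx : x = s / 4 := by
        have : (x - s / 4) * y = 0 := by linarith
        have := (mul_eq_zero.1 this).resolve_right hy
        linarith
      subst hx
      nlinarith [mul_self_nonneg s]
  have : ‖(⟨x, y⟩ : ℂ)‖ ^ 2 < 1 := by
    rw [← Complex.normSq_eq_norm_sq, Complex.normSq_mk]
    exact hsq
  exact (sq_lt_one_iff₀ (norm_nonneg _)).1 this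

/-- Factor the characteristic polynomial: ξₙ₊₁ − r₁ξₙ is geometric of ratio r₂, so |ξₙ₊₁| ≤ |r₁||ξₙ|
plus a geometric term. Unlike the closed formula for ξₙ, this also covers a double root. -/
theorem summable_of_recurrence {s : ℝ} (hs : |s| < 3) {ξ : ℕ → ℝ}
    (h : ∀ n, ξ n + 2 * ξ (n + 2) = s * ξ (n + 1)) : Summable fun n => |ξ n| := by
  obtain ⟨d, hd⟩ := IsAlgClosed.exists_pow_nat_eq ((s / 2 : ℂ) ^ 2 - 2) two_pos
  set r₁ : ℂ := (s / 2 + d) / 2 with hr₁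
  set r₂ : ℂ := (s / 2 - d) / 2 with hr₂
  have h₁ : ‖r₁‖ < 1 := norm_root_lt_one hs (by rw [hr₁]; linear_combination hd / 4)
  have h₂ : ‖r₂‖ < 1 := norm_root_lt_one hs (by rw [hr₂]; linear_combination hd / 4)
  have hrec : ∀ n, (ξ (n + 2) : ℂ) - r₁ * ξ (n + 1) = r₂ * (ξ (n + 1) - r₁ * ξ n) := by
    intro n
    have hn : (ξ n : ℂ) + 2 * ξ (n + 2) = s * ξ (n + 1) := by exact_mod_cast h n
    rw [hr₁, hr₂]
    linear_combination hn / 2 - (ξ n : ℂ) * hd / 4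
  have hc : ∀ n, (ξ (n + 1) : ℂ) - r₁ * ξ n = r₂ ^ n * (ξ 1 - r₁ * ξ 0) := by
    intro n
    induction n with
    | zero => simp
    | succ n ih => rw [hrec, ih, pow_succ', mul_assoc]
  refine summable_of_le_mul_add (g := fun n => ‖r₂‖ ^ n * ‖(ξ 1 : ℂ) - r₁ * ξ 0‖) (r := ‖r₁‖)
    (fun n => abs_nonneg _) (fun n => by positivity)
    ((summable_geometric_of_lt_one (norm_nonneg _) h₂).mul_right _) (norm_nonneg _) h₁ fun n => ?_
  have e : (ξ (n + 1) : ℂ) = r₁ * ξ n + r₂ ^ n * (ξ 1 - r₁ * ξ 0) := by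
    rw [← hc]
    ring
  have h3 := norm_add_le (r₁ * (ξ n : ℂ)) (r₂ ^ n * (ξ 1 - r₁ * ξ 0))
  rw [← e, norm_mul, norm_mul, norm_pow, Complex.norm_real, Complex.norm_real] at h3
  exact h3

theorem hasSum_of_recurrence {s : ℝ} (hs : |s| < 3) {ξ : ℕ → ℝ}
    (h : ∀ n, ξ n + 2 * ξ (n + 2) = s * ξ (n + 1)) (h0 : ξ 0 = 1) (h1 : 3 * ξ 1 = s) :
    HasSum (fun n => ξ (n + 1)) ((2 * s - 3) / (3 * (3 - s))) := by
  have hsum : Summable ξ := (summable_of_recurrence hs h).of_abs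
  have hsum1 : Summable fun n => ξ (n + 1) := (summable_nat_add_iff 1).2 hsum
  have hsum2 : Summable fun n => ξ (n + 2) := (summable_nat_add_iff 2).2 hsum
  have e0 : ∑' n, ξ n = ξ 0 + ∑' n, ξ (n + 1) := hsum.tsum_eq_zero_add
  have e1 : ∑' n, ξ (n + 1) = ξ 1 + ∑' n, ξ (n + 2) := hsum1.tsum_eq_zero_add
  have e2 : ∑' n, ξ n + 2 * ∑' n, ξ (n + 2) = s * ∑' n, ξ (n + 1) := by
    rw [← tsum_mul_left, ← tsum_mul_left, ← hsum.tsum_add (hsum2.mul_left 2)]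
    exact tsum_congr h
  have hs3 : 3 - s ≠ 0 := by
    have := (abs_lt.1 hs).2
    linarith
  have : ∑' n, ξ (n + 1) = (2 * s - 3) / (3 * (3 - s)) := by
    rw [eq_div_iff (mul_ne_zero three_ne_zero hs3)]
    linear_combination -3 * e0 + 6 * e1 + 3 * e2 - 3 * h0 + 2 * h1
  rw [← this]
  exact hsum1.hasSum

/-! ### Spheres in `PGL₂(ℚ₂)` -/

/-- The function `size` on `PGL₂(ℚ₂)`. -/
def sizeP : PGL2 → ℝ :=
  Quotient.lift size (by
    intro g h hgh
    have hz : g⁻¹ * h ∈ Subgroup.center GL2 := QuotientGroup.leftRel_apply.1 hgh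
    have e : h = (g⁻¹ * h) * g := by
      rw [← Subgroup.mem_center_iff.1 hz g]
      group
    rw [e, size_center_mul _ hz])

/-- The double coset `K diag(1, 2ⁿ) K` in `PGL₂(ℚ₂)`. -/
def sphere (n : ℕ) : Set PGL2 := {x | sizeP x = 2 ^ n}

theorem mk_mem_sphere {n : ℕ} {g : GL2} : (g : PGL2) ∈ sphere n ↔ InCartan n g :=
  inCartan_iff.symm

theorem isOpen_sphere (n : ℕ) : IsOpen (sphere n) := by
  rw [← QuotientGroup.isOpenQuotientMap_mk.isQuotientMap.isOpen_preimage, isOpen_iff_mem_nhds]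
  intro g hg
  refine Filter.mem_of_superset ((isOpen_K2.preimage (continuous_const_mul g⁻¹)).mem_nhds
    (by simp : g⁻¹ * g ∈ (K2 : Set GL2))) fun h hh => ?_
  have h1 := (mk_mem_sphere.1 hg).mul_K2 (k := g⁻¹ * h) hh
  rw [mul_inv_cancel_left] at h1
  exact mk_mem_sphere.2 h1

theorem sphere_zero : sphere 0 = (PK2 : Set PGL2) := by
  ext x
  constructor
  · induction x using QuotientGroup.induction_on with
    | H g =>
      intro h
      obtain ⟨z, hz, k₁, h₁, k₂, h₂, rfl⟩ := mk_mem_sphere.1 h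
      refine ⟨k₁ * k₂, K2.mul_mem h₁ h₂, ?_⟩
      refine QuotientGroup.eq.2 ?_
      rw [dia_zero, mul_one, mul_assoc, ← Subgroup.mem_center_iff.1 hz, inv_mul_cancel_left]
      exact hz
  · rintro ⟨k, hk, rfl⟩
    exact mk_mem_sphere.2 ⟨1, one_mem _, k, hk, 1, one_mem _, by rw [dia_zero]; simp⟩

theorem iUnion_sphere : ⋃ n, sphere n = Set.univ := by
  refine Set.eq_univ_of_forall fun x => ?_
  induction x using QuotientGroup.induction_on with
  | H g =>
    obtain ⟨n, hn⟩ := exists_inCartan g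
    exact Set.mem_iUnion.2 ⟨n, mk_mem_sphere.2 hn⟩

theorem eq_of_mem_sphere {m n : ℕ} {x : PGL2} (hm : x ∈ sphere m) (hn : x ∈ sphere n) : m = n := by
  have h : (2 : ℝ) ^ m = 2 ^ n := by
    have h1 : sizeP x = 2 ^ m := hm
    have h2 : sizeP x = 2 ^ n := hn
    rw [← h1, h2]
  exact Nat.pow_right_injective (le_refl 2) (by exact_mod_cast h : 2 ^ m = 2 ^ n)

theorem pairwise_disjoint_sphere : Pairwise (Function.onFun Disjoint sphere) := by
  intro m n hmn
  exact Set.disjoint_left.2 fun x hm hn => hmn (eq_of_mem_sphere hm hn)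

/-- The transpose on `GL₂(ℚ₂)`. -/
def transposeGL2 (g : GL2) : GL2 :=
  Matrix.GeneralLinearGroup.mkOfDetNeZero (g : M2).transpose (by
    rw [Matrix.det_transpose]
    exact det_ne_zero_GL2 g)

theorem inCartan_transpose {n : ℕ} {g : GL2} : InCartan n (transposeGL2 g) ↔ InCartan n g := by
  rw [inCartan_iff, inCartan_iff]
  change maxNorm (g : M2).transpose ^ 2 / ‖(g : M2).transpose.det‖ = _ ↔ _
  rw [maxNorm_transpose, Matrix.det_transpose]
  rfl

-- Haar measure on the quotient is used through left translations, while the neighbour sums are over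
-- right ones; transposition preserves the radius and exchanges the two.
theorem inCartan_transpose_nbr_mul {n : ℕ} {g : GL2} (i : Fin 3) :
    InCartan n (transposeGL2 (nbr i) * g) ↔ InCartan n (transposeGL2 g * nbr i) := by
  rw [← inCartan_transpose]
  have : transposeGL2 (transposeGL2 (nbr i) * g) = transposeGL2 g * nbr i := by
    ext1
    change ((nbr i : M2).transpose * (g : M2)).transpose = (g : M2).transpose * (nbr i : M2)
    rw [Matrix.transpose_mul, Matrix.transpose_transpose]
  rw [this]

open Classical in
/-- The number of neighbours at distance `n` of a point at distance `m`. -/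
theorem sum_indicator_nbr (n : ℕ) {m : ℕ} {g : GL2} (hg : InCartan m g) :
    ∑ i, (if InCartan n (transposeGL2 (nbr i) * g) then (1 : ENNReal) else 0)
      = if m = 0 then 3 * (if n = 1 then 1 else 0)
        else (if n + 1 = m then 1 else 0) + 2 * (if n = m + 1 then 1 else 0) := by
  simp only [inCartan_transpose_nbr_mul]
  have hu : ∀ l h, InCartan l h → (if InCartan n h then (1 : ENNReal) else 0)
      = if n = l then 1 else 0 := by
    intro l h hl
    have : InCartan n h ↔ n = l := by
      rw [← mk_mem_sphere]
      constructor
      · intro h'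
        exact eq_of_mem_sphere h' (mk_mem_sphere.2 hl)
      · rintro rfl
        exact mk_mem_sphere.2 hl
    simp only [this]
  have hg' := inCartan_transpose.2 hg
  cases m with
  | zero =>
    rw [sum_nbr (u := fun h => if InCartan n h then (1 : ENNReal) else 0)
      (v := fun l => if n = l then 1 else 0) hu hg']
    simp
  | succ m =>
    rw [sum_mul_nbr (u := fun h => if InCartan n h then (1 : ENNReal) else 0)
      (v := fun l => if n = l then 1 else 0) hu hg']
    simp

theorem measure_sphere_zero {ρ : Measure PGL2} (hρ : ρ (PK2 : Set PGL2) = 1) : ρ (sphere 0) = 1 := by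
  rw [sphere_zero, hρ]

/-! ### Volumes of spheres and integration over them -/

section Sphere

variable {ρ : Measure PGL2} [ρ.IsHaarMeasure]

open Classical in
theorem three_mul_measure_sphere (n : ℕ) : 3 * ρ (sphere n) = ∫⁻ x,
    ∑ i, (sphere n).indicator 1 (((transposeGL2 (nbr i) : GL2) : PGL2) * x) ∂ρ := by
  have hm := (isOpen_sphere n).measurableSet
  rw [lintegral_finsetSum]
  · have : ∀ i : Fin 3, ∫⁻ x, (sphere n).indicator 1 (((transposeGL2 (nbr i) : GL2) : PGL2) * x) ∂ρ
        = ρ (sphere n) := fun i => by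
      rw [lintegral_mul_left_eq_self (μ := ρ) (fun x => (sphere n).indicator 1 x),
        lintegral_indicator_one hm]
    simp [this]
  · intro i _
    exact (measurable_one.indicator hm).comp (measurable_const_mul _)

/-- Left invariance makes 3ρ(Sₙ) the integral of the number of indices whose translate of x lands in
Sₙ. This number is nonzero only for x of radius n + 1, where it is 1, or of one smaller radius l,
where it is c. -/
theorem measure_sphere_recurrence {n l : ℕ} {c : ENNReal}
    (h : ∀ m, ∀ g : GL2, InCartan m g →
      (if m = 0 then 3 * (if n = 1 then 1 else 0)
        else (if n + 1 = m then 1 else 0) + 2 * (if n = m + 1 then 1 else 0) : ENNReal)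
        = (if m = n + 1 then 1 else 0) + c * (if m = l then 1 else 0)) :
    3 * ρ (sphere n) = ρ (sphere (n + 1)) + c * ρ (sphere l) := by
  classical
  have hm := fun n => (isOpen_sphere n).measurableSet
  rw [three_mul_measure_sphere, ← lintegral_indicator_one (hm (n + 1)),
    ← lintegral_indicator_one (hm l), ← lintegral_const_mul _ (measurable_one.indicator (hm l)),
    ← lintegral_add_left (measurable_one.indicator (hm (n + 1)))]
  refine lintegral_congr fun x => ?_
  induction x using QuotientGroup.induction_on with
  | H g =>
    obtain ⟨m, hg⟩ := exists_inCartan g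
    have hmem : ∀ j, (g : PGL2) ∈ sphere j ↔ m = j := fun j =>
      ⟨fun hj => eq_of_mem_sphere (mk_mem_sphere.2 hg) hj, fun hj => hj ▸ mk_mem_sphere.2 hg⟩
    have h1 := (sum_indicator_nbr n hg).trans (h m g hg)
    simp only [Set.indicator_apply, Pi.one_apply, hmem, ← QuotientGroup.mk_mul, mk_mem_sphere]
    exact h1

theorem measure_sphere_succ (hρ : ρ (PK2 : Set PGL2) = 1) (n : ℕ) :
    ρ (sphere (n + 1)) = 3 * 2 ^ n := by
  have h0 := measure_sphere_zero hρ
  have h1 : ρ (sphere 1) = 3 := by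
    have := measure_sphere_recurrence (ρ := ρ) (n := 0) (l := 0) (c := 0) (by
      intro m g hg
      rcases m with _ | _ | m <;> simp)
    rw [h0, zero_mul, add_zero, mul_one] at this
    exact this.symm
  -- The factor is c = 3 here, not 2, because all three neighbours of the base vertex are at
  -- distance 1.
  have h2 : ρ (sphere 2) = 6 := by
    have := measure_sphere_recurrence (ρ := ρ) (n := 1) (l := 0) (c := 3) (by
      intro m g hg
      rcases m with _ | _ | _ | m <;> simp)
    rw [h0, h1] at this
    have e : (3 : ENNReal) * 3 = 6 + 3 * 1 := by norm_num
    rw [e] at this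
    exact ((ENNReal.add_left_inj (by norm_num)).1 this).symm
  have key : ρ (sphere (n + 1)) = 3 * 2 ^ n ∧ ρ (sphere (n + 2)) = 3 * 2 ^ (n + 1) := by
    induction n with
    | zero => exact ⟨by rw [h1]; norm_num, by rw [h2]; norm_num⟩
    | succ n ih =>
      refine ⟨ih.2, ?_⟩
      have := measure_sphere_recurrence (ρ := ρ) (n := n + 2) (l := n + 1) (c := 2) (by
        intro m g hg
        rcases m with _ | m
        · simp
        · by_cases e1 : m = n
          · subst e1
            simp
          · by_cases e2 : m = n + 2
            · subst e2
              simp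
            · simp [e1, e2, Ne.symm e1, Ne.symm e2])
      rw [ih.1, ih.2] at this
      have e : (3 : ENNReal) * (3 * 2 ^ (n + 1)) = 3 * 2 ^ (n + 2) + 2 * (3 * 2 ^ n) := by
        ring
      rw [e] at this
      exact ((ENNReal.add_left_inj (by finiteness)).1 this).symm
  exact key.1

theorem integrable_of_const_on_spheres (hρ : ρ (PK2 : Set PGL2) = 1) {f : PGL2 → ℂ} {c : ℕ → ℂ}
    (hf : ∀ n, ∀ x ∈ sphere n, f x = c n) (hc : Summable fun n => 2 ^ n * ‖c (n + 1)‖) :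
    Integrable f ρ ∧ ∫ x, f x ∂ρ = c 0 + ∑' n, 3 * 2 ^ n * c (n + 1) := by
  have hm := fun n => (isOpen_sphere n).measurableSet
  have hfin : ∀ n, ρ (sphere n) ≠ ⊤ := by
    rintro (_ | n)
    · rw [measure_sphere_zero hρ]
      exact ENNReal.one_ne_top
    · rw [measure_sphere_succ hρ]
      finiteness
  have h0 : ρ.real (sphere 0) = 1 := by rw [measureReal_def, measure_sphere_zero hρ]; simp
  have h1 : ∀ n, ρ.real (sphere (n + 1)) = 3 * 2 ^ n := fun n => by
    rw [measureReal_def, measure_sphere_succ hρ]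
    simp
  have hon : ∀ n, IntegrableOn f (sphere n) ρ := fun n =>
    (integrableOn_congr_fun (hf n) (hm n)).2 (integrableOn_const (hfin n))
  have hnorm : ∀ n, ∫ x in sphere n, ‖f x‖ ∂ρ = ρ.real (sphere n) * ‖c n‖ := fun n => by
    rw [setIntegral_congr_fun (hm n) fun x hx => congrArg norm (hf n x hx), setIntegral_const,
      smul_eq_mul]
  have hint : ∀ n, ∫ x in sphere n, f x ∂ρ = ρ.real (sphere n) * c n := fun n => by
    rw [setIntegral_congr_fun (hm n) (hf n), setIntegral_const, Complex.real_smul]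
  have hsum : Summable fun n => ∫ x in sphere n, ‖f x‖ ∂ρ := by
    rw [← summable_nat_add_iff 1]
    simp only [hnorm, h1]
    simpa only [mul_assoc] using hc.mul_left 3
  have hI := integrableOn_iUnion_of_summable_integral_norm hon hsum
  rw [iUnion_sphere, integrableOn_univ] at hI
  refine ⟨hI, ?_⟩
  have hS := hasSum_integral_iUnion hm pairwise_disjoint_sphere hI.integrableOn
  rw [iUnion_sphere, setIntegral_univ] at hS
  rw [← hS.tsum_eq, hS.summable.tsum_eq_zero_add, hint, h0]
  simp only [hint, h1]
  push_cast
  rw [one_mul]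

end Sphere

/-! ### Parity in `ℤ₂` -/

theorem norm_lt_one_or_norm_add_one_lt_one {x : ℚ_[2]} (hx : ‖x‖ ≤ 1) : ‖x‖ < 1 ∨ ‖x + 1‖ < 1 := by
  let z : ℤ_[2] := ⟨x, hx⟩
  have h1 := toZMod_eq_zero_iff z
  have h2 := toZMod_eq_zero_iff (z + 1)
  have key : ∀ z : ZMod 2, z = 0 ∨ z + 1 = 0 := by decide
  rcases key (PadicInt.toZMod z) with h | h
  · exact Or.inl (h1.1 h)
  · rw [← map_one PadicInt.toZMod, ← map_add] at h
    have h3 := h2.1 h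
    rw [PadicInt.coe_add, PadicInt.coe_one] at h3
    exact Or.inr h3

theorem norm_le_one_of_norm_lt_one_add {x y : ℚ_[2]} (hy : ‖y‖ ≤ 1) (h : ‖x - y‖ < 1) :
    ‖x‖ ≤ 1 := by
  have := Padic.nonarchimedean (x - y) y
  rw [sub_add_cancel] at this
  exact this.trans (max_le h.le hy)

theorem norm_lt_one_congr {x y : ℚ_[2]} (h : ‖x - y‖ < 1) : ‖x‖ < 1 ↔ ‖y‖ < 1 := by
  constructor <;> intro h'
  · have := Padic.nonarchimedean (-(x - y)) x
    rw [norm_neg, neg_sub, sub_add_cancel] at this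
    exact this.trans_lt (max_lt h h')
  · have := Padic.nonarchimedean (x - y) y
    rw [sub_add_cancel] at this
    exact this.trans_lt (max_lt h h')

/-! ### The lattice `M₂(ℤ₂)` -/

theorem isClopen_integralM2 : IsClopen integralM2 := by
  have h : integralM2 = ⋂ i, ⋂ j, (fun β : M2 => β i j) ⁻¹' Metric.closedBall 0 1 := by
    ext β
    simp [integralM2]
  rw [h]
  exact isClopen_iInter_of_finite fun i => isClopen_iInter_of_finite fun j =>
    (IsUltrametricDist.isClopen_closedBall 0 one_ne_zero).preimage (by fun_prop)

theorem isCompact_norm_entry_le (r : ℝ) : IsCompact {β : M2 | ∀ i j, ‖β i j‖ ≤ r} := by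
  have h : {β : M2 | ∀ i j, ‖β i j‖ ≤ r} = Set.pi Set.univ fun _ : Fin 2 =>
      Set.pi Set.univ fun _ : Fin 2 => Metric.closedBall (0 : ℚ_[2]) r := by
    ext β
    refine ⟨fun hβ i _ j _ => mem_closedBall_zero_iff.2 (hβ i j), fun hβ i j => ?_⟩
    exact mem_closedBall_zero_iff.1 (hβ i (Set.mem_univ i) j (Set.mem_univ j))
  rw [h]
  exact isCompact_univ_pi fun _ => isCompact_univ_pi fun _ => isCompact_closedBall 0 r

theorem isCompact_integralM2 : IsCompact integralM2 := isCompact_norm_entry_le 1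

theorem add_mem_integralM2_iff {α β : M2} (hα : α ∈ integralM2) :
    β + α ∈ integralM2 ↔ β ∈ integralM2 := by
  have key : ∀ α ∈ integralM2, ∀ β ∈ integralM2, β + α ∈ integralM2 := fun α hα β hβ i j =>
    (Padic.nonarchimedean _ _).trans (max_le (hβ i j) (hα i j))
  refine ⟨fun h => ?_, key α hα β⟩
  have h1 : -α ∈ integralM2 := fun i j => by
    rw [Matrix.neg_apply, norm_neg]
    exact hα i j
  simpa using key _ h1 _ h

section Measure

variable {ν : Measure M2} [ν.IsAddHaarMeasure]

/-- By uniqueness of Haar measure the Jacobian can be read off from the volume of the preimage of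
the lattice alone. -/
theorem integral_comp_linearEquiv (hν : ν integralM2 = 1) (T : M2 ≃ₗ[ℚ_[2]] M2) {c : ℝ}
    (hc : ν.real (T ⁻¹' integralM2) = c) (f : M2 → ℂ) : ∫ β, f (T β) ∂ν = c * ∫ β, f β ∂ν := by
  let e : M2 ≃L[ℚ_[2]] M2 := T.toContinuousLinearEquiv
  have : (ν.map e).IsAddHaarMeasure := e.isAddHaarMeasure_map ν
  have h := Measure.isAddLeftInvariant_eq_smul (ν.map e) ν
  set d := Measure.addHaarScalarFactor (ν.map e) ν
  have hd : (d : ℝ) = c := by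
    have h2 : (ν.map e) integralM2 = d := by
      rw [h]
      simp [hν]
    rw [Measure.map_apply e.continuous.measurable isClopen_integralM2.isOpen.measurableSet] at h2
    rw [← hc, Measure.real]
    change _ = (ν (e ⁻¹' integralM2)).toReal
    rw [h2]
    rfl
  have h3 : ∫ β, f β ∂(ν.map e) = ∫ β, f (T β) ∂ν :=
    e.toHomeomorph.isClosedEmbedding.measurableEmbedding.integral_map f
  rw [← h3, h, integral_smul_nnreal_measure, ← hd]
  rfl

theorem integral_comp_linearEquiv_of_lattice (hν : ν integralM2 = 1) (T : M2 ≃ₗ[ℚ_[2]] M2)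
    (hT : ∀ β, T β ∈ integralM2 ↔ β ∈ integralM2) (f : M2 → ℂ) :
    ∫ β, f (T β) ∂ν = ∫ β, f β ∂ν := by
  have h : T ⁻¹' integralM2 = integralM2 := Set.ext hT
  rw [integral_comp_linearEquiv hν T (c := 1) (by rw [h, Measure.real, hν]; rfl)]
  simp

/-- Multiplication of one entry by a nonzero number. -/
def scaleEntry (i j : Fin 2) (x : ℚ_[2]ˣ) : M2 ≃ₗ[ℚ_[2]] M2 where
  toFun β := Matrix.of fun k l => if k = i ∧ l = j then x * β k l else β k l
  map_add' β γ := by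
    ext k l
    simp only [Matrix.of_apply, Matrix.add_apply]
    split_ifs <;> ring
  map_smul' c β := by
    ext k l
    simp only [Matrix.of_apply, Matrix.smul_apply, smul_eq_mul, RingHom.id_apply]
    split_ifs <;> ring
  invFun β := Matrix.of fun k l => if k = i ∧ l = j then (x⁻¹ : ℚ_[2]ˣ) * β k l else β k l
  left_inv β := by
    ext k l
    simp only [Matrix.of_apply]
    split_ifs <;> simp
  right_inv β := by
    ext k l
    simp only [Matrix.of_apply]
    split_ifs <;> simp

theorem measure_scaleEntry (hν : ν integralM2 = 1) (i j : Fin 2) :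
    ν.real (scaleEntry i j twoUnit ⁻¹' integralM2) = 2 := by
  let E : M2 := Matrix.single i j 2⁻¹
  -- Halving one integral entry gives either an integer or a half-integer: two cosets of the
  -- lattice.
  have h : scaleEntry i j twoUnit ⁻¹' integralM2 = integralM2 ∪ (fun β => β + E) ⁻¹' integralM2 := by
    ext β
    have h1 : scaleEntry i j twoUnit β ∈ integralM2 ↔
        ∀ k l, ‖(if k = i ∧ l = j then 2 * β k l else β k l : ℚ_[2])‖ ≤ 1 := Iff.rfl
    have h2 : β + E ∈ integralM2 ↔
        ∀ k l, ‖(β k l + if i = k ∧ j = l then 2⁻¹ else 0 : ℚ_[2])‖ ≤ 1 := Iff.rfl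
    rw [Set.mem_union, Set.mem_preimage, Set.mem_preimage, h1, h2]
    constructor
    · intro hβ
      have hij := hβ i j
      simp only [and_self, if_true] at hij
      rcases norm_lt_one_or_norm_add_one_lt_one hij with h | h
      · left
        intro k l
        by_cases hkl : k = i ∧ l = j
        · have := norm_half_le_one h
          rw [hkl.1, hkl.2]
          simpa using this
        · simpa [hkl] using hβ k l
      · right
        intro k l
        by_cases hkl : k = i ∧ l = j
        · have := norm_half_le_one h
          rw [hkl.1, hkl.2]
          rw [mul_add, mul_one, inv_mul_cancel_left₀ two_ne_zero] at this
          simpa using this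
        · have hkl' : ¬ (i = k ∧ j = l) := fun h => hkl ⟨h.1.symm, h.2.symm⟩
          simpa [hkl, hkl'] using hβ k l
    · intro hβ k l
      by_cases hkl : k = i ∧ l = j
      · rw [if_pos hkl]
        rcases hβ with h | h
        · rw [norm_mul, norm_two_padic]
          have : ‖β k l‖ ≤ 1 := h k l
          linarith
        · have h' := h k l
          rw [if_pos ⟨hkl.1.symm, hkl.2.symm⟩] at h'
          have e : 2 * β k l = 2 * (β k l + 2⁻¹) - 1 := by
            rw [mul_add, mul_inv_cancel₀ two_ne_zero]
            ring
          rw [e]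
          refine norm_le_one_of_norm_lt_one_add (y := -1) (by simp) ?_
          rw [sub_neg_eq_add, sub_add_cancel, norm_mul, norm_two_padic]
          linarith
      · rw [if_neg hkl]
        rcases hβ with h | h
        · exact h k l
        · have h' := h k l
          rw [if_neg fun h => hkl ⟨h.1.symm, h.2.symm⟩, add_zero] at h'
          exact h'
  have hdisj : Disjoint integralM2 ((fun β => β + E) ⁻¹' integralM2) := by
    refine Set.disjoint_left.2 fun β h1 h2 => ?_
    have h3 : E ∈ integralM2 := by
      rw [Set.mem_preimage, add_comm] at h2
      exact (add_mem_integralM2_iff h1).1 h2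
    have h4 := h3 i j
    simp only [E, Matrix.single_apply_same, norm_inv, norm_two_padic] at h4
    norm_num at h4
  rw [h, Measure.real, measure_union hdisj
    ((measurable_add_const E) isClopen_integralM2.isOpen.measurableSet), measure_preimage_add_right, hν]
  norm_num

theorem integral_scaleEntry_two (hν : ν integralM2 = 1) (i j : Fin 2) (f : M2 → ℂ) :
    ∫ β, f (scaleEntry i j twoUnit β) ∂ν = 2 * ∫ β, f β ∂ν := by
  rw [integral_comp_linearEquiv hν _ (measure_scaleEntry hν i j)]
  norm_num

theorem scaleEntry_mul (i j : Fin 2) (x y : ℚ_[2]ˣ) (β : M2) :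
    scaleEntry i j (x * y) β = scaleEntry i j x (scaleEntry i j y β) := by
  ext k l
  simp only [scaleEntry, LinearEquiv.coe_mk, LinearMap.coe_mk, AddHom.coe_mk, Matrix.of_apply]
  split_ifs
  · simp [mul_assoc]
  · rfl

theorem integral_scaleEntry_two_pow (hν : ν integralM2 = 1) (i j : Fin 2) (n : ℕ) (f : M2 → ℂ) :
    ∫ β, f (scaleEntry i j (twoUnit ^ n) β) ∂ν = 2 ^ n * ∫ β, f β ∂ν := by
  induction n generalizing f with
  | zero =>
    have : ∀ β, scaleEntry i j 1 β = β := fun β => by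
      ext k l
      simp [scaleEntry]
    simp only [this, pow_zero, one_mul]
  | succ n ih =>
    simp only [pow_succ, scaleEntry_mul]
    rw [integral_scaleEntry_two hν i j fun β => f (scaleEntry i j (twoUnit ^ n) β), ih]
    ring

/-! ### Integrals of functions that depend only on parities -/

/-- The matrices that are congruent to `ε` modulo `2`. -/
def residueClass (ε : M2) : Set M2 := {β | ∀ i j, ‖β i j - ε i j‖ < 1}

/-- The representatives of `M₂(ℤ₂)` modulo `2`. -/
def residueRep (p : Fin 2 × Fin 2 × Fin 2 × Fin 2) : M2 :=
  !![(p.1 : ℕ), (p.2.1 : ℕ); (p.2.2.1 : ℕ), (p.2.2.2 : ℕ)]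

theorem exists_unique_digit {x : ℚ_[2]} (hx : ‖x‖ ≤ 1) : ∃ e : Fin 2, ‖x - (e : ℕ)‖ < 1 ∧
    ∀ e' : Fin 2, ‖x - (e' : ℕ)‖ < 1 → e' = e := by
  have h01 : ∀ y : ℚ_[2], ‖y‖ < 1 → ¬ ‖y - 1‖ < 1 := fun y h1 h2 => by
    have := (norm_lt_one_congr (x := y) (y := 1) h2).1 h1
    simp at this
  have h10 : ‖x + 1‖ < 1 → ‖x - 1‖ < 1 := fun h => by
    refine (norm_lt_one_congr (x := x - 1) (y := x + 1) ?_).2 h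
    rw [show x - 1 - (x + 1) = -2 by ring, norm_neg, norm_two_padic]
    norm_num
  rcases norm_lt_one_or_norm_add_one_lt_one hx with h | h
  · refine ⟨0, by simpa using h, fun e' he' => ?_⟩
    fin_cases e'
    · rfl
    · exact absurd (by simpa using he') (h01 x h)
  · refine ⟨1, by simpa using h10 h, fun e' he' => ?_⟩
    fin_cases e'
    · exact absurd (h10 h) (h01 x (by simpa using he'))
    · rfl

theorem mem_residueClass_residueRep {p : Fin 2 × Fin 2 × Fin 2 × Fin 2} {β : M2} :
    β ∈ residueClass (residueRep p) ↔ ‖β 0 0 - (p.1 : ℕ)‖ < 1 ∧ ‖β 0 1 - (p.2.1 : ℕ)‖ < 1 ∧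
      ‖β 1 0 - (p.2.2.1 : ℕ)‖ < 1 ∧ ‖β 1 1 - (p.2.2.2 : ℕ)‖ < 1 := by
  simp only [residueClass, residueRep, Set.mem_ofPred_eq, Fin.forall_fin_two]
  simp [and_assoc]

theorem exists_unique_residueRep {β : M2} (hβ : β ∈ integralM2) :
    ∃ p, β ∈ residueClass (residueRep p) ∧ ∀ q, β ∈ residueClass (residueRep q) → q = p := by
  obtain ⟨e₁, h₁, u₁⟩ := exists_unique_digit (hβ 0 0)
  obtain ⟨e₂, h₂, u₂⟩ := exists_unique_digit (hβ 0 1)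
  obtain ⟨e₃, h₃, u₃⟩ := exists_unique_digit (hβ 1 0)
  obtain ⟨e₄, h₄, u₄⟩ := exists_unique_digit (hβ 1 1)
  refine ⟨(e₁, e₂, e₃, e₄), mem_residueClass_residueRep.2 ⟨h₁, h₂, h₃, h₄⟩, ?_⟩
  rintro ⟨q₁, q₂, q₃, q₄⟩ hq
  obtain ⟨k₁, k₂, k₃, k₄⟩ := mem_residueClass_residueRep.1 hq
  exact Prod.ext (u₁ _ k₁) (Prod.ext (u₂ _ k₂) (Prod.ext (u₃ _ k₃) (u₄ _ k₄)))

theorem residueRep_mem_integralM2 (p) : residueRep p ∈ integralM2 := by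
  obtain ⟨p₁, p₂, p₃, p₄⟩ := p
  intro i j
  fin_cases i <;> fin_cases j <;> exact PadicInt.norm_le_one ((_ : ℕ) : ℤ_[2])

theorem mem_integralM2_of_mem_residueClass {ε β : M2} (hε : ε ∈ integralM2)
    (hβ : β ∈ residueClass ε) : β ∈ integralM2 := fun i j =>
  norm_le_one_of_norm_lt_one_add (hε i j) (hβ i j)

theorem isClopen_residueClass (ε : M2) : IsClopen (residueClass ε) := by
  have h : residueClass ε = ⋂ i, ⋂ j, (fun β : M2 => β i j) ⁻¹' Metric.ball (ε i j) 1 := by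
    ext β
    simp [residueClass, dist_eq_norm]
  rw [h]
  exact isClopen_iInter_of_finite fun i => isClopen_iInter_of_finite fun j =>
    (IsUltrametricDist.isClopen_ball _ _).preimage (by fun_prop)

theorem measure_residueClass_eq (ε : M2) : ν (residueClass ε) = ν (residueClass 0) := by
  have h : residueClass ε = (fun β => β + -ε) ⁻¹' residueClass 0 := by
    ext β
    simp [residueClass, sub_eq_add_neg]
  rw [h, measure_preimage_add_right]

theorem eq_sum_indicator_residueClass {f : M2 → ℂ} (h0 : ∀ β ∉ integralM2, f β = 0)
    (h1 : ∀ ε ∈ integralM2, ∀ β ∈ residueClass ε, f β = f ε) (β : M2) :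
    f β = ∑ p, (residueClass (residueRep p)).indicator (fun _ => f (residueRep p)) β := by
  by_cases hβ : β ∈ integralM2
  · obtain ⟨p, hp, hu⟩ := exists_unique_residueRep hβ
    rw [Finset.sum_eq_single p]
    · rw [Set.indicator_of_mem hp, h1 _ (residueRep_mem_integralM2 p) _ hp]
    · exact fun q _ hq => Set.indicator_of_notMem (fun h => hq (hu q h)) _
    · exact fun h => absurd (Finset.mem_univ _) h
  · rw [h0 β hβ]
    refine (Finset.sum_eq_zero fun p _ => Set.indicator_of_notMem (fun h => hβ ?_) _).symm
    exact mem_integralM2_of_mem_residueClass (residueRep_mem_integralM2 p) h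

theorem integral_eq_measure_mul_sum {f : M2 → ℂ} (h0 : ∀ β ∉ integralM2, f β = 0)
    (h1 : ∀ ε ∈ integralM2, ∀ β ∈ residueClass ε, f β = f ε) :
    ∫ β, f β ∂ν = ν.real (residueClass 0) * ∑ p, f (residueRep p) := by
  have hfin : ∀ p, ν (residueClass (residueRep p)) < ⊤ := fun p =>
    (measure_mono fun _ h =>
      mem_integralM2_of_mem_residueClass (residueRep_mem_integralM2 p) h).trans_lt
      isCompact_integralM2.measure_lt_top
  rw [integral_congr_ae (Filter.Eventually.of_forall (eq_sum_indicator_residueClass h0 h1)),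
    integral_finsetSum]
  · rw [Finset.mul_sum]
    refine Finset.sum_congr rfl fun p _ => ?_
    rw [integral_indicator (isClopen_residueClass _).isOpen.measurableSet, setIntegral_const,
      Measure.real, measure_residueClass_eq]
    rfl
  · exact fun p _ => (integrable_indicator_iff (isClopen_residueClass _).isOpen.measurableSet).2
      (integrableOn_const (hfin p).ne)

/-- Sixteen translates of this class partition the lattice of volume 1. -/
theorem measure_residueClass_zero (hν : ν integralM2 = 1) : ν.real (residueClass 0) = 1 / 16 := by
  have h := integral_eq_measure_mul_sum (ν := ν) (f := integralM2.indicator fun _ => 1)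
    (fun β hβ => Set.indicator_of_notMem hβ _) (fun ε hε β hβ => by
      rw [Set.indicator_of_mem hε,
        Set.indicator_of_mem (mem_integralM2_of_mem_residueClass hε hβ)])
  rw [integral_indicator isClopen_integralM2.isOpen.measurableSet, setIntegral_const, Measure.real, hν,
    Finset.sum_congr rfl fun p _ => Set.indicator_of_mem (residueRep_mem_integralM2 p) _] at h
  simp only [Finset.sum_const, Finset.card_univ, Fintype.card_prod, Fintype.card_fin] at h
  have h2 : (1 : ℝ) = ν.real (residueClass 0) * 16 := by
    apply Complex.ofReal_injective
    push_cast
    simpa using h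
  linarith

theorem integral_eq_sum_residueRep (hν : ν integralM2 = 1) {f : M2 → ℂ}
    (h0 : ∀ β ∉ integralM2, f β = 0) (h1 : ∀ ε ∈ integralM2, ∀ β ∈ residueClass ε, f β = f ε) :
    ∫ β, f β ∂ν = 1 / 16 * ∑ p, f (residueRep p) := by
  rw [integral_eq_measure_mul_sum h0 h1, measure_residueClass_zero hν]
  norm_num

/-! ### The self-dual measure -/

theorem tracePairing_eq (α β : M2) :
    tracePairing α β = α 0 0 * β 1 1 - α 0 1 * β 1 0 - α 1 0 * β 0 1 + α 1 1 * β 0 0 := by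
  rw [tracePairing, Matrix.trace_fin_two, Matrix.adjugate_fin_two, Matrix.mul_apply,
    Matrix.mul_apply, Fin.sum_univ_two, Fin.sum_univ_two]
  simp
  ring

theorem tracePairing_add (α β γ : M2) :
    tracePairing α (β + γ) = tracePairing α β + tracePairing α γ := by
  simp only [tracePairing_eq, Matrix.add_apply]
  ring

theorem norm_tracePairing_le_one {α β : M2} (hα : α ∈ integralM2) (hβ : β ∈ integralM2) :
    ‖tracePairing α β‖ ≤ 1 := by
  let x : ∀ _ _, ℤ_[2] := fun i j => ⟨α i j, hα i j⟩
  let y : ∀ _ _, ℤ_[2] := fun i j => ⟨β i j, hβ i j⟩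
  have h : tracePairing α β =
      ((x 0 0 * y 1 1 - x 0 1 * y 1 0 - x 1 0 * y 0 1 + x 1 1 * y 0 0 : ℤ_[2]) : ℚ_[2]) := by
    rw [tracePairing_eq]
    push_cast
    rfl
  rw [h]
  exact PadicInt.norm_le_one _

theorem exists_tracePairing_eq (α : M2) (i j : Fin 2) {y : ℚ_[2]} (hy : ‖y‖ ≤ 1) :
    ∃ β ∈ integralM2, tracePairing α β = α i j * y := by
  refine ⟨(Matrix.single j i y).adjugate, ?_, ?_⟩
  · intro k l
    rw [Matrix.adjugate_fin_two]
    fin_cases i <;> fin_cases j <;> fin_cases k <;> fin_cases l <;> simp [hy]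
  · rw [tracePairing_eq, Matrix.adjugate_fin_two]
    fin_cases i <;> fin_cases j <;> simp

/-- For α outside the lattice some integral β₀ has ψ(⟨α,β₀⟩) ≠ 1, and translating by β₀ multiplies
the integral by this number, so it vanishes. -/
theorem fourierM2_indicator {ψ : AddChar ℚ_[2] Circle} (hψ : IsUnramifiedChar ψ) (α : M2) :
    fourierM2 ψ ν (integralM2.indicator fun _ => 1) α =
      integralM2.indicator (fun _ => (ν.real integralM2 : ℂ)) α := by
  have hψ1 : ∀ x : ℚ_[2], ‖x‖ ≤ 1 → ψ x = 1 := fun x hx => by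
    simpa using (hψ.2 x).2 hx 1 (by simp)
  by_cases hα : α ∈ integralM2
  · rw [Set.indicator_of_mem hα, fourierM2]
    have : ∀ β, integralM2.indicator (fun _ => (1 : ℂ)) β * (ψ (tracePairing α β) : ℂ) =
        integralM2.indicator (fun _ => (1 : ℂ)) β := fun β => by
      by_cases hβ : β ∈ integralM2
      · rw [hψ1 _ (norm_tracePairing_le_one hα hβ)]
        simp
      · simp [Set.indicator_of_notMem hβ]
    simp only [this]
    rw [integral_indicator isClopen_integralM2.isOpen.measurableSet, setIntegral_const]
    simp
  · rw [Set.indicator_of_notMem hα]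
    have : ∃ i j, ¬ ‖α i j‖ ≤ 1 := by
      by_contra! h
      exact hα h
    obtain ⟨i, j, hij⟩ := this
    have := mt (hψ.2 (α i j)).1 hij
    push Not at this
    obtain ⟨y, hy, hne⟩ := this
    obtain ⟨β₀, hβ₀, e⟩ := exists_tracePairing_eq α i j hy
    set f : M2 → ℂ := fun β =>
      integralM2.indicator (fun _ => (1 : ℂ)) β * (ψ (tracePairing α β) : ℂ) with hf
    have h1 : ∀ β, f (β + β₀) = (ψ (α i j * y) : ℂ) * f β := fun β => by
      have h2 : integralM2.indicator (fun _ => (1 : ℂ)) (β + β₀) =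
          integralM2.indicator (fun _ => (1 : ℂ)) β := by
        classical
        simp only [Set.indicator_apply, add_mem_integralM2_iff hβ₀]
      simp only [hf, h2, tracePairing_add, e, AddChar.map_add_eq_mul, Circle.coe_mul]
      ring
    have h2 := integral_add_right_eq_self (μ := ν) f β₀
    simp only [h1] at h2
    rw [integral_const_mul] at h2
    change ∫ β, f β ∂ν = 0
    by_contra h3
    exact hne (Circle.coe_injective (by simpa using mul_right_cancel₀ h3 (h2.trans (one_mul _).symm)))

theorem isSchwartzBruhat_indicator : IsSchwartzBruhat (integralM2.indicator fun _ => (1 : ℂ)) := by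
  constructor
  · refine (IsLocallyConstant.iff_eventually_eq _).2 fun x => ?_
    by_cases hx : x ∈ integralM2
    · filter_upwards [isClopen_integralM2.isOpen.mem_nhds hx] with y hy
      rw [Set.indicator_of_mem hx, Set.indicator_of_mem hy]
    · filter_upwards [isClopen_integralM2.compl.isOpen.mem_nhds hx] with y hy
      rw [Set.indicator_of_notMem hx, Set.indicator_of_notMem hy]
  · exact HasCompactSupport.of_support_subset_isCompact isCompact_integralM2 Set.support_indicator_subset

/-- Applying the Fourier transform twice to the indicator and evaluating at 0 gives the square of
the volume, which must be 1. -/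
theorem measure_integralM2 {ψ : AddChar ℚ_[2] Circle} (hψ : IsUnramifiedChar ψ)
    (hνψ : IsSelfDual ψ ν) : ν integralM2 = 1 := by
  have h := hνψ _ isSchwartzBruhat_indicator 0
  have h0 : (0 : M2) ∈ integralM2 := fun i j => by simp
  rw [neg_zero, Set.indicator_of_mem h0, show fourierM2 ψ ν (integralM2.indicator fun _ => 1) = _ from
    funext fun α => fourierM2_indicator hψ α] at h
  have hz : ∀ β, tracePairing 0 β = 0 := fun β => by simp [tracePairing]
  simp only [fourierM2, hz, AddChar.map_zero_eq_one, Circle.coe_one, mul_one] at h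
  rw [integral_indicator isClopen_integralM2.isOpen.measurableSet, setIntegral_const] at h
  have h2 : ν.real integralM2 * ν.real integralM2 = 1 := by
    apply Complex.ofReal_injective
    push_cast
    simpa using h
  have h3 : ν.real integralM2 = 1 := by
    have : 0 ≤ ν.real integralM2 := measureReal_nonneg
    nlinarith
  rw [Measure.real] at h3
  rw [← ENNReal.ofReal_toReal isCompact_integralM2.measure_lt_top.ne, h3, ENNReal.ofReal_one]

end Measure

/-! ### Formulas for `φ` -/

/-- The sum `(-1)^{b+c} + (-1)^{a+c} + (-1)^{a+b}`. -/
def signSum (a b c : ℚ_[2]) : ℂ := sgn2 (b + c) + sgn2 (a + c) + sgn2 (a + b)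

open Classical in
theorem sum_chi (β : M2) : ∑ i : Fin 3, chi i β =
    if β.trace = 0 ∧ ‖β 0 0‖ ≤ 1 ∧ ‖β 0 1 / 2‖ ≤ 1 ∧ ‖β 1 0 / 2‖ ≤ 1 then
      signSum (β 0 0) (β 0 1 / 2) (β 1 0 / 2) else 0 := by
  simp only [chi, Fin.sum_univ_three, signSum]
  split_ifs <;> simp

-- The factor 4 in φ'' turns the trace-zero part of β into the coordinates a = 2(β₀₀ − β₁₁), b =
-- 2β₀₁, c = 2β₁₀.
open Classical in
theorem phi_eq (β : M2) : phi β = phi' (β.trace / 2) * (2 ^ (-3 : ℤ) * (kappa0 : ℂ) *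
    if ‖2 * (β 0 0 - β 1 1)‖ ≤ 1 ∧ ‖2 * β 0 1‖ ≤ 1 ∧ ‖2 * β 1 0‖ ≤ 1 then
      signSum (2 * (β 0 0 - β 1 1)) (2 * β 0 1) (2 * β 1 0) else 0) := by
  have h : ((4 : ℚ_[2]) • (β - Matrix.scalar (Fin 2) (β.trace / 2))).trace = 0 := by
    simp only [Matrix.trace_fin_two, Matrix.smul_apply, Matrix.sub_apply, Matrix.scalar_apply,
      Matrix.diagonal_apply_eq, smul_eq_mul]
    ring
  have h0 : ((4 : ℚ_[2]) • (β - Matrix.scalar (Fin 2) (β.trace / 2))) 0 0 =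
      2 * (β 0 0 - β 1 1) := by
    simp only [Matrix.trace_fin_two, Matrix.smul_apply, Matrix.sub_apply, Matrix.scalar_apply,
      Matrix.diagonal_apply_eq, smul_eq_mul]
    ring
  have h1 : ((4 : ℚ_[2]) • (β - Matrix.scalar (Fin 2) (β.trace / 2))) 0 1 / 2 = 2 * β 0 1 := by
    simp
    ring
  have h2 : ((4 : ℚ_[2]) • (β - Matrix.scalar (Fin 2) (β.trace / 2))) 1 0 / 2 = 2 * β 1 0 := by
    simp
    ring
  simp only [phi, phi'', sum_chi, h, h0, h1, h2, true_and]

theorem sgn2_congr {x y : ℚ_[2]} (h : ‖x‖ < 1 ↔ ‖y‖ < 1) : sgn2 x = sgn2 y := by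
  simp only [sgn2, h]

theorem eventually_norm_le_one_iff {f : M2 → ℚ_[2]} (hf : Continuous f) (x : M2) :
    ∀ᶠ y in nhds x, (‖f y‖ ≤ 1 ↔ ‖f x‖ ≤ 1) := by
  have h : IsClopen {y | ‖f y‖ ≤ 1} := by
    have := (IsUltrametricDist.isClopen_closedBall (0 : ℚ_[2]) one_ne_zero).preimage hf
    simpa [Set.preimage] using this
  by_cases hx : ‖f x‖ ≤ 1
  · filter_upwards [h.isOpen.mem_nhds hx] with y hy
    exact iff_of_true hy hx
  · filter_upwards [h.compl.isOpen.mem_nhds hx] with y hy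
    exact iff_of_false hy hx

theorem eventually_norm_lt_one_iff {f : M2 → ℚ_[2]} (hf : Continuous f) (x : M2) :
    ∀ᶠ y in nhds x, (‖f y‖ < 1 ↔ ‖f x‖ < 1) := by
  have h : IsClopen {y | ‖f y‖ < 1} := by
    have := (IsUltrametricDist.isClopen_ball (0 : ℚ_[2]) 1).preimage hf
    simpa [Set.preimage] using this
  by_cases hx : ‖f x‖ < 1
  · filter_upwards [h.isOpen.mem_nhds hx] with y hy
    exact iff_of_true hy hx
  · filter_upwards [h.compl.isOpen.mem_nhds hx] with y hy
    exact iff_of_false hy hx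

theorem norm_eq_one_iff (x : ℚ_[2]) : ‖x‖ = 1 ↔ ‖x‖ ≤ 1 ∧ ¬ ‖x‖ < 1 := by
  rw [not_lt]
  exact le_antisymm_iff

theorem isLocallyConstant_phi : IsLocallyConstant phi := by
  refine (IsLocallyConstant.iff_eventually_eq _).2 fun x => ?_
  filter_upwards [eventually_norm_le_one_iff (f := fun β => β.trace / 2) (by fun_prop) x,
    eventually_norm_lt_one_iff (f := fun β => β.trace / 2) (by fun_prop) x,
    eventually_norm_le_one_iff (f := fun β => 2 * (β 0 0 - β 1 1)) (by fun_prop) x,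
    eventually_norm_le_one_iff (f := fun β => 2 * β 0 1) (by fun_prop) x,
    eventually_norm_le_one_iff (f := fun β => 2 * β 1 0) (by fun_prop) x,
    eventually_norm_lt_one_iff (f := fun β => 2 * β 0 1 + 2 * β 1 0) (by fun_prop) x,
    eventually_norm_lt_one_iff (f := fun β => 2 * (β 0 0 - β 1 1) + 2 * β 1 0) (by fun_prop) x,
    eventually_norm_lt_one_iff (f := fun β => 2 * (β 0 0 - β 1 1) + 2 * β 0 1) (by fun_prop) x]
    with y h1 h2 h3 h4 h5 h6 h7 h8
  have hs : signSum (2 * (y 0 0 - y 1 1)) (2 * y 0 1) (2 * y 1 0) =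
      signSum (2 * (x 0 0 - x 1 1)) (2 * x 0 1) (2 * x 1 0) := by
    unfold signSum
    rw [sgn2_congr h6, sgn2_congr h7, sgn2_congr h8]
  have hm : phi' (y.trace / 2) = phi' (x.trace / 2) := by
    simp only [phi', norm_eq_one_iff, h1, h2]
  rw [phi_eq, phi_eq, hs, hm]
  simp only [h3, h4, h5]

theorem isSchwartzBruhat_phi : IsSchwartzBruhat phi := by
  refine ⟨isLocallyConstant_phi,
    HasCompactSupport.of_support_subset_isCompact (isCompact_norm_entry_le 4) ?_⟩
  intro β hβ
  rw [Function.mem_support, phi_eq] at hβ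
  have hm : ‖β.trace / 2‖ = 1 := by
    by_contra h
    exact hβ (by rw [phi', if_neg h, zero_mul])
  have hc : ‖2 * (β 0 0 - β 1 1)‖ ≤ 1 ∧ ‖2 * β 0 1‖ ≤ 1 ∧ ‖2 * β 1 0‖ ≤ 1 := by
    by_contra h
    exact hβ (by rw [if_neg h, mul_zero, mul_zero])
  obtain ⟨ha, hb, hc⟩ := hc
  rw [Matrix.trace_fin_two] at hm
  simp only [norm_mul, norm_div, norm_two_padic] at hm ha hb hc
  have key : ∀ x y : ℚ_[2], ‖x‖ ≤ 2 → ‖y‖ ≤ 2 → ‖(x + y) / 2‖ ≤ 4 := fun x y hx hy => by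
    have := (Padic.nonarchimedean x y).trans (max_le hx hy)
    rw [norm_div, norm_two_padic, div_inv_eq_mul]
    linarith
  rw [div_inv_eq_mul] at hm
  have h1 : ‖β 0 0 + β 1 1‖ ≤ 2 := by linarith
  have h2 : ‖β 0 0 - β 1 1‖ ≤ 2 := by linarith
  have h3 : ‖β 1 1 - β 0 0‖ ≤ 2 := by rwa [norm_sub_rev]
  have e1 : β 0 0 = ((β 0 0 + β 1 1) + (β 0 0 - β 1 1)) / 2 := by ring
  have e2 : β 1 1 = ((β 0 0 + β 1 1) + (β 1 1 - β 0 0)) / 2 := by ring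
  intro i j
  fin_cases i <;> fin_cases j
  · change ‖β 0 0‖ ≤ 4
    rw [e1]
    exact key _ _ h1 h2
  · change ‖β 0 1‖ ≤ 4
    linarith
  · change ‖β 1 0‖ ≤ 4
    linarith
  · change ‖β 1 1‖ ≤ 4
    rw [e2]
    exact key _ _ h1 h3

/-! ### Invariance of `φ` under conjugation by `GL₂(ℤ₂)` -/

/-- The sign `(-1)^z`. -/
def signZMod (z : ZMod 2) : ℤ := if z = 0 then 1 else -1

/-- The function on `M₂(𝔽₂)` that corresponds to `χ₁ + χ₂ + χ₃`. -/
def signMatrix (p q r s : ZMod 2) : ℤ :=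
  signZMod (q + r) + signZMod (p - s + r) + signZMod (p - s + q)

theorem sgn2_coe (z : ℤ_[2]) : sgn2 (z : ℚ_[2]) = (signZMod (PadicInt.toZMod z) : ℂ) := by
  simp only [sgn2, signZMod, toZMod_eq_zero_iff]
  split_ifs <;> simp

/-- The matrix `2y - tr(y)`. -/
def traceZeroPart (y : Matrix (Fin 2) (Fin 2) ℤ_[2]) : M2 :=
  (2 : ℚ_[2]) • (algebraMap ℤ_[2] ℚ_[2]).mapMatrix y - Matrix.scalar (Fin 2) ((y.trace : ℤ_[2]) : ℚ_[2])

theorem traceZeroPart_apply (y : Matrix (Fin 2) (Fin 2) ℤ_[2]) (i j : Fin 2) :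
    traceZeroPart y i j = 2 * (y i j : ℚ_[2]) -
      if i = j then (y 0 0 : ℚ_[2]) + (y 1 1 : ℚ_[2]) else 0 := by
  have h : (((y 0 0 + y 1 1 : ℤ_[2])) : ℚ_[2]) = (y 0 0 : ℚ_[2]) + (y 1 1 : ℚ_[2]) :=
    PadicInt.coe_add _ _
  rw [traceZeroPart, Matrix.sub_apply, Matrix.scalar_apply, Matrix.diagonal_apply,
    Matrix.trace_fin_two, h]
  rfl

theorem sum_chi_traceZeroPart (y : Matrix (Fin 2) (Fin 2) ℤ_[2]) :
    ∑ i : Fin 3, chi i (traceZeroPart y) =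
      (signMatrix (PadicInt.toZMod (y 0 0)) (PadicInt.toZMod (y 0 1)) (PadicInt.toZMod (y 1 0))
        (PadicInt.toZMod (y 1 1)) : ℂ) := by
  have h0 : (traceZeroPart y).trace = 0 := by
    rw [Matrix.trace_fin_two, traceZeroPart_apply, traceZeroPart_apply, if_pos rfl, if_pos rfl]
    ring
  have h1 : traceZeroPart y 0 0 = ((y 0 0 - y 1 1 : ℤ_[2]) : ℚ_[2]) := by
    rw [traceZeroPart_apply, if_pos rfl, PadicInt.coe_sub]
    ring
  have h2 : traceZeroPart y 0 1 / 2 = ((y 0 1 : ℤ_[2]) : ℚ_[2]) := by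
    rw [traceZeroPart_apply, if_neg (by decide)]
    ring
  have h3 : traceZeroPart y 1 0 / 2 = ((y 1 0 : ℤ_[2]) : ℚ_[2]) := by
    rw [traceZeroPart_apply, if_neg (by decide)]
    ring
  rw [sum_chi, h0, h1, h2, h3, if_pos ⟨rfl, PadicInt.norm_le_one _, PadicInt.norm_le_one _,
    PadicInt.norm_le_one _⟩, signSum]
  simp only [← PadicInt.coe_add, sgn2_coe, map_add, map_sub, signMatrix, Int.cast_add]

theorem exists_traceZeroPart {β : M2} (h : ∑ i : Fin 3, chi i β ≠ 0) :
    ∃ y, β = traceZeroPart y := by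
  rw [sum_chi] at h
  have h' : β.trace = 0 ∧ ‖β 0 0‖ ≤ 1 ∧ ‖β 0 1 / 2‖ ≤ 1 ∧ ‖β 1 0 / 2‖ ≤ 1 := by
    by_contra h'
    exact h (if_neg h')
  obtain ⟨ht, ha, hb, hc⟩ := h'
  rw [Matrix.trace_fin_two] at ht
  refine ⟨!![⟨_, ha⟩, ⟨_, hb⟩; ⟨_, hc⟩, 0], ?_⟩
  ext i j
  rw [traceZeroPart_apply]
  fin_cases i <;> fin_cases j
  · change β 0 0 = 2 * β 0 0 - (β 0 0 + 0)
    ring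
  · change β 0 1 = 2 * (β 0 1 / 2) - 0
    ring
  · change β 1 0 = 2 * (β 1 0 / 2) - 0
    ring
  · change β 1 1 = 2 * 0 - (β 0 0 + 0)
    linear_combination ht

/-- The three signs are y ↦ (−1)^{tr(Ay)} with A running over the elements of order 2 of GL₂(𝔽₂).
They form a conjugacy class, so conjugation only permutes the signs. -/
theorem signMatrix_conj : ∀ p q r s a b c d : ZMod 2, p * s - q * r = 1 →
    signMatrix ((p * a + q * c) * s - (p * b + q * d) * r)
      (-(p * a + q * c) * q + (p * b + q * d) * p)
      ((r * a + s * c) * s - (r * b + s * d) * r)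
      (-(r * a + s * c) * q + (r * b + s * d) * p) = signMatrix a b c d := by
  decide

theorem sum_chi_conj_traceZeroPart {k : GL2} (hk : k ∈ K2) (y : Matrix (Fin 2) (Fin 2) ℤ_[2]) :
    ∑ i : Fin 3, chi i (conjM2 k (traceZeroPart y)) = ∑ i : Fin 3, chi i (traceZeroPart y) := by
  obtain ⟨u, rfl⟩ := hk
  set w : Matrix (Fin 2) (Fin 2) ℤ_[2] := ((u⁻¹ : GL (Fin 2) ℤ_[2]) : Matrix (Fin 2) (Fin 2) ℤ_[2]) with hw
  have huw : (u : Matrix (Fin 2) (Fin 2) ℤ_[2]) * w = 1 := Units.mul_inv u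
  have hwu : w * (u : Matrix (Fin 2) (Fin 2) ℤ_[2]) = 1 := Units.inv_mul u
  have h1 : conjM2 (Matrix.GeneralLinearGroup.map (n := Fin 2) (algebraMap ℤ_[2] ℚ_[2]) u)
      (traceZeroPart y) = traceZeroPart ((u : Matrix (Fin 2) (Fin 2) ℤ_[2]) * y * w) := by
    change (algebraMap ℤ_[2] ℚ_[2]).mapMatrix (u : Matrix (Fin 2) (Fin 2) ℤ_[2]) *
      traceZeroPart y * (algebraMap ℤ_[2] ℚ_[2]).mapMatrix w = _
    have ht : ((u : Matrix (Fin 2) (Fin 2) ℤ_[2]) * y * w).trace = y.trace := by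
      rw [Matrix.trace_mul_cycle, hwu, one_mul]
    rw [traceZeroPart, traceZeroPart, ht, mul_sub, sub_mul, Matrix.mul_smul, Matrix.smul_mul,
      ← map_mul, ← map_mul, ← (Matrix.scalar_commute (n := Fin 2) _ (fun r => Commute.all _ r) _).eq,
      mul_assoc (Matrix.scalar (Fin 2) _), ← map_mul, huw, map_one, mul_one]
  rw [h1, sum_chi_traceZeroPart, sum_chi_traceZeroPart]
  let P := (PadicInt.toZMod (p := 2)).mapMatrix (u : Matrix (Fin 2) (Fin 2) ℤ_[2])
  let A := (PadicInt.toZMod (p := 2)).mapMatrix y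
  let W := (PadicInt.toZMod (p := 2)).mapMatrix w
  have hPW : P * W = 1 := by
    simp only [P, W]
    rw [← map_mul, huw, map_one]
  have hdet : P.det = 1 := by
    have key : ∀ a b : ZMod 2, a * b = 1 → a = 1 := by decide
    exact key _ W.det (by rw [← Matrix.det_mul, hPW, Matrix.det_one])
  have hW : W = P.adjugate := by
    calc W = P.adjugate * P * W := by rw [Matrix.adjugate_mul, hdet, one_smul, one_mul]
      _ = P.adjugate := by rw [mul_assoc, hPW, mul_one]
  have e : ∀ i j, PadicInt.toZMod (((u : Matrix (Fin 2) (Fin 2) ℤ_[2]) * y * w) i j) =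
      (P * A * P.adjugate) i j := fun i j => by
    rw [← hW]
    simp only [P, A, W]
    rw [← map_mul, ← map_mul]
    rfl
  have h2 := signMatrix_conj (P 0 0) (P 0 1) (P 1 0) (P 1 1) (A 0 0) (A 0 1) (A 1 0) (A 1 1)
    (by rw [← Matrix.det_fin_two, hdet])
  rw [e, e, e, e]
  simp only [Matrix.adjugate_fin_two, Matrix.mul_apply, Fin.sum_univ_two]
  refine congrArg _ (Eq.trans ?_ h2)
  simp only [Matrix.of_apply, Matrix.cons_val', Matrix.cons_val_zero, Matrix.cons_val_one,
    Matrix.cons_val_fin_one]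
  congr 1 <;> ring

theorem sum_chi_conj {k : GL2} (hk : k ∈ K2) (β : M2) :
    ∑ i : Fin 3, chi i (conjM2 k β) = ∑ i : Fin 3, chi i β := by
  by_cases h : ∑ i : Fin 3, chi i β = 0
  · by_cases h' : ∑ i : Fin 3, chi i (conjM2 k β) = 0
    · rw [h, h']
    · obtain ⟨y, hy⟩ := exists_traceZeroPart h'
      have e : β = conjM2 k⁻¹ (traceZeroPart y) := by
        rw [← hy]
        change β = (conjM2 k⁻¹ * conjM2 k) β
        rw [← map_mul, inv_mul_cancel, map_one]
        rfl
      rw [hy, e, sum_chi_conj_traceZeroPart (K2.inv_mem hk)]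
  · obtain ⟨y, rfl⟩ := exists_traceZeroPart h
    exact sum_chi_conj_traceZeroPart hk y

theorem phi_conj {k : GL2} (hk : k ∈ K2) (β : M2) : phi (conjM2 k β) = phi β := by
  have h1 : (conjM2 k β).trace = β.trace := by
    change ((k : M2) * β * ((k⁻¹ : GL2) : M2)).trace = _
    rw [Matrix.trace_mul_cycle, Units.inv_mul, one_mul]
  have h2 : (4 : ℚ_[2]) • (conjM2 k β - Matrix.scalar (Fin 2) (β.trace / 2)) =
      conjM2 k ((4 : ℚ_[2]) • (β - Matrix.scalar (Fin 2) (β.trace / 2))) := by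
    change _ = (k : M2) * _ * ((k⁻¹ : GL2) : M2)
    rw [Matrix.mul_smul, Matrix.smul_mul, mul_sub, sub_mul,
      ← (Matrix.scalar_commute (n := Fin 2) _ (fun r => Commute.all _ r) (k : M2)).eq,
      mul_assoc _ (k : M2), Units.mul_inv, mul_one]
    rfl
  simp only [phi, phi'', h1, h2, sum_chi_conj hk]

/-! ### The matrix coefficient of `φ` -/

theorem innerM2_mul_of_mem_K2 (ν : Measure M2) {k : GL2} (hk : k ∈ K2) (x : PGL2) :
    innerM2 ν (AdFun (x * (k : PGL2)) phi) phi = innerM2 ν (AdFun x phi) phi := by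
  have h : AdFun (x * (k : PGL2)) phi = AdFun x phi := by
    funext β
    simp only [AdFun, mul_inv_rev, map_mul]
    exact phi_conj (K2.inv_mem hk) _
  rw [h]

section Measure

variable {ν : Measure M2} [ν.IsAddHaarMeasure]

/-- Conjugation as a linear equivalence. -/
def conjEquiv (g : GL2) : M2 ≃ₗ[ℚ_[2]] M2 where
  toFun := conjM2 g
  map_add' β γ := by
    change (g : M2) * (β + γ) * ((g⁻¹ : GL2) : M2) = _
    rw [mul_add, add_mul]
    rfl
  map_smul' c β := by
    change (g : M2) * (c • β) * ((g⁻¹ : GL2) : M2) = _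
    rw [Matrix.mul_smul, Matrix.smul_mul]
    rfl
  invFun := conjM2 g⁻¹
  left_inv β := by
    change (conjM2 g⁻¹ * conjM2 g) β = β
    rw [← map_mul, inv_mul_cancel, map_one]
    rfl
  right_inv β := by
    change (conjM2 g * conjM2 g⁻¹) β = β
    rw [← map_mul, mul_inv_cancel, map_one]
    rfl

theorem mem_integralM2_iff {β : M2} : β ∈ integralM2 ↔ maxNorm β ≤ 1 :=
  (maxNorm_le_iff zero_le_one).symm

theorem innerM2_K2_mul (hν : ν integralM2 = 1) {k : GL2} (hk : k ∈ K2) (x : PGL2) :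
    innerM2 ν (AdFun ((k : PGL2) * x) phi) phi = innerM2 ν (AdFun x phi) phi := by
  have hk' := K2.inv_mem hk
  have h := integral_comp_linearEquiv_of_lattice hν (conjEquiv k⁻¹) (fun β => by
    change ((k⁻¹ : GL2) : M2) * β * ((k⁻¹⁻¹ : GL2) : M2) ∈ _ ↔ _
    rw [mem_integralM2_iff, mem_integralM2_iff, maxNorm_mul_of_mem_K2' (K2.inv_mem hk'),
      maxNorm_mul_of_mem_K2 hk']) fun β => AdFun x phi β * star (phi β)
  refine Eq.trans (integral_congr_ae (Filter.Eventually.of_forall fun β => ?_)) h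
  change phi _ * _ = phi _ * star (phi (conjM2 k⁻¹ β))
  rw [phi_conj hk']
  simp only [mul_inv_rev, map_mul]
  rfl

theorem innerM2_eq_of_mem_sphere (hν : ν integralM2 = 1) {n : ℕ} {x : PGL2} (hx : x ∈ sphere n) :
    innerM2 ν (AdFun x phi) phi = innerM2 ν (AdFun (dia n : PGL2) phi) phi := by
  induction x using QuotientGroup.induction_on with
  | H g =>
    obtain ⟨z, hz, k₁, h₁, k₂, h₂, rfl⟩ := mk_mem_sphere.1 hx
    have hz1 : (z : PGL2) = 1 := (QuotientGroup.eq_one_iff z).2 hz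
    rw [QuotientGroup.mk_mul, QuotientGroup.mk_mul, QuotientGroup.mk_mul, hz1, one_mul,
      innerM2_mul_of_mem_K2 ν h₂, innerM2_K2_mul hν h₁]

theorem conjM2_dia_inv (n : ℕ) (β : M2) : conjM2 (dia n)⁻¹ β 0 0 = β 0 0 ∧
    conjM2 (dia n)⁻¹ β 0 1 = 2 ^ n * β 0 1 ∧ 2 ^ n * conjM2 (dia n)⁻¹ β 1 0 = β 1 0 ∧
    conjM2 (dia n)⁻¹ β 1 1 = β 1 1 := by
  set X := conjM2 (dia n)⁻¹ β with hX
  have h : (dia n : M2) * X = β * (dia n : M2) := by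
    change (dia n : M2) * (((dia n)⁻¹ : GL2) * β * (((dia n)⁻¹⁻¹ : GL2) : M2)) = _
    rw [inv_inv, ← mul_assoc, ← mul_assoc, Units.mul_inv, one_mul]
  rw [dia_val] at h
  have h2 : (2 : ℚ_[2]) ^ n ≠ 0 := pow_ne_zero _ two_ne_zero
  have e : ∀ i j, _ = _ := fun i j => congrFun (congrFun h i) j
  have h00 := e 0 0
  have h01 := e 0 1
  have h10 := e 1 0
  have h11 := e 1 1
  simp [Matrix.mul_apply, Fin.sum_univ_two] at h00 h01 h10 h11
  refine ⟨h00, by rw [h01, mul_comm], h10, ?_⟩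
  rw [mul_comm] at h11
  exact mul_right_cancel₀ h2 h11

/-- The shear `(m, t) ↦ (m + t, t)` of the diagonal entries. -/
def shearDiag : M2 ≃ₗ[ℚ_[2]] M2 where
  toFun β := !![β 0 0 + β 1 1, β 0 1; β 1 0, β 1 1]
  map_add' β γ := by
    ext i j
    fin_cases i <;> fin_cases j <;> simp
    ring
  map_smul' c β := by
    ext i j
    fin_cases i <;> fin_cases j <;> simp
    ring
  invFun β := !![β 0 0 - β 1 1, β 0 1; β 1 0, β 1 1]
  left_inv β := by
    ext i j
    fin_cases i <;> fin_cases j <;> simp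
  right_inv β := by
    ext i j
    fin_cases i <;> fin_cases j <;> simp

/-- The reflection `(u, t) ↦ (u, u - t)` of the diagonal entries. -/
def reflectDiag : M2 ≃ₗ[ℚ_[2]] M2 where
  toFun β := !![β 0 0, β 0 1; β 1 0, β 0 0 - β 1 1]
  map_add' β γ := by
    ext i j
    fin_cases i <;> fin_cases j <;> simp
    ring
  map_smul' c β := by
    ext i j
    fin_cases i <;> fin_cases j <;> simp
    ring
  invFun β := !![β 0 0, β 0 1; β 1 0, β 0 0 - β 1 1]
  left_inv β := by
    ext i j
    fin_cases i <;> fin_cases j <;> simp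
  right_inv β := by
    ext i j
    fin_cases i <;> fin_cases j <;> simp

theorem norm_sub_le_one {x y : ℚ_[2]} (hx : ‖x‖ ≤ 1) (hy : ‖y‖ ≤ 1) : ‖x - y‖ ≤ 1 := by
  rw [sub_eq_add_neg]
  exact (Padic.nonarchimedean _ _).trans (max_le hx (by rwa [norm_neg]))

theorem mem_integralM2_iff_entries {β : M2} : β ∈ integralM2 ↔
    ‖β 0 0‖ ≤ 1 ∧ ‖β 0 1‖ ≤ 1 ∧ ‖β 1 0‖ ≤ 1 ∧ ‖β 1 1‖ ≤ 1 := by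
  simp only [integralM2, Set.mem_ofPred_eq, Fin.forall_fin_two]
  tauto

theorem shearDiag_mem_integralM2_iff (β : M2) : shearDiag β ∈ integralM2 ↔ β ∈ integralM2 := by
  rw [mem_integralM2_iff_entries, mem_integralM2_iff_entries]
  change ‖β 0 0 + β 1 1‖ ≤ 1 ∧ ‖β 0 1‖ ≤ 1 ∧ ‖β 1 0‖ ≤ 1 ∧ ‖β 1 1‖ ≤ 1 ↔ _
  refine ⟨fun ⟨h1, h2, h3, h4⟩ => ⟨?_, h2, h3, h4⟩, fun ⟨h1, h2, h3, h4⟩ => ⟨?_, h2, h3, h4⟩⟩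
  · simpa using norm_sub_le_one h1 h4
  · exact (Padic.nonarchimedean _ _).trans (max_le h1 h4)

theorem reflectDiag_mem_integralM2_iff (β : M2) : reflectDiag β ∈ integralM2 ↔ β ∈ integralM2 := by
  rw [mem_integralM2_iff_entries, mem_integralM2_iff_entries]
  change ‖β 0 0‖ ≤ 1 ∧ ‖β 0 1‖ ≤ 1 ∧ ‖β 1 0‖ ≤ 1 ∧ ‖β 0 0 - β 1 1‖ ≤ 1 ↔ _
  refine ⟨fun ⟨h1, h2, h3, h4⟩ => ⟨h1, h2, h3, ?_⟩, fun ⟨h1, h2, h3, h4⟩ => ⟨h1, h2, h3, ?_⟩⟩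
  · simpa using norm_sub_le_one h1 h4
  · exact norm_sub_le_one h1 h4

open Classical in
/-- The integrand of `⟨Ad(diag(1, 2ⁿ)) φ, φ⟩` up to a constant, in suitable coordinates. -/
def coeffFun (n : ℕ) (δ : M2) : ℂ := phi' (δ 0 0) *
  if ‖δ 1 1‖ ≤ 1 ∧ ‖δ 0 1‖ ≤ 1 ∧ ‖δ 1 0‖ ≤ 1 then
    signSum (δ 1 1) (2 ^ n * δ 0 1) (δ 1 0) * signSum (δ 1 1) (δ 0 1) (2 ^ n * δ 1 0) else 0

theorem star_sgn2 (x : ℚ_[2]) : star (sgn2 x) = sgn2 x := by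
  unfold sgn2
  split_ifs <;> simp

theorem star_signSum (a b c : ℚ_[2]) : star (signSum a b c) = signSum a b c := by
  simp only [signSum, star_add, star_sgn2]

theorem norm_two_pow_mul_le (n : ℕ) (x : ℚ_[2]) : ‖2 ^ n * x‖ ≤ ‖x‖ := by
  rw [norm_mul]
  exact mul_le_of_le_one_left (norm_nonneg _) (norm_two_pow_le_one n)

/-- The substitution uses half the trace m and half the diagonal difference t as coordinates, the
diagonal being (m + t, m − t), and multiplies the lower left entry by 2ⁿ to clear the denominator of
the conjugation. The scalings on the right make the support of φ'' integral. -/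
theorem phi_mul_star_phi (n : ℕ) (δ : M2) :
    phi (conjM2 (dia n)⁻¹ (reflectDiag (scaleEntry 1 1 twoUnit (shearDiag
      (scaleEntry 1 0 (twoUnit ^ n) δ))))) * star (phi (reflectDiag (scaleEntry 1 1 twoUnit
        (shearDiag (scaleEntry 1 0 (twoUnit ^ n) δ))))) =
      (2 ^ (-3 : ℤ) * (kappa0 : ℂ)) ^ 2 * coeffFun n (scaleEntry 1 1 twoUnit (scaleEntry 1 1 twoUnit
        (scaleEntry 0 1 twoUnit (scaleEntry 1 0 twoUnit δ)))) := by
  classical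
  set B := reflectDiag (scaleEntry 1 1 twoUnit (shearDiag (scaleEntry 1 0 (twoUnit ^ n) δ)))
  set E := scaleEntry 1 1 twoUnit (scaleEntry 1 1 twoUnit
    (scaleEntry 0 1 twoUnit (scaleEntry 1 0 twoUnit δ)))
  have b00 : B 0 0 = δ 0 0 + δ 1 1 := by
    simp [B, reflectDiag, scaleEntry, shearDiag]
  have b01 : B 0 1 = δ 0 1 := by
    simp [B, reflectDiag, scaleEntry, shearDiag]
  have b10 : B 1 0 = 2 ^ n * δ 1 0 := by
    simp [B, reflectDiag, scaleEntry, shearDiag, twoUnit]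
  have b11 : B 1 1 = δ 0 0 - δ 1 1 := by
    simp [B, reflectDiag, scaleEntry, shearDiag, twoUnit]
    ring
  have e00 : E 0 0 = δ 0 0 := by
    simp [E, scaleEntry]
  have e01 : E 0 1 = 2 * δ 0 1 := by
    simp [E, scaleEntry, twoUnit]
  have e10 : E 1 0 = 2 * δ 1 0 := by
    simp [E, scaleEntry, twoUnit]
  have e11 : E 1 1 = 4 * δ 1 1 := by
    simp [E, scaleEntry, twoUnit]
    ring
  obtain ⟨c00, c01, c10, c11⟩ := conjM2_dia_inv n B
  set C := conjM2 (dia n)⁻¹ B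
  rw [b00] at c00
  rw [b01] at c01
  rw [b10] at c10
  rw [b11] at c11
  replace c10 := mul_left_cancel₀ (pow_ne_zero _ two_ne_zero) c10
  rw [phi_eq, phi_eq, coeffFun, Matrix.trace_fin_two, Matrix.trace_fin_two, b00, b01, b10, b11, c00,
    c01, c10, c11, e00, e01, e10, e11]
  have hm : (δ 0 0 + δ 1 1 + (δ 0 0 - δ 1 1)) / 2 = δ 0 0 := by ring
  have ha : 2 * (δ 0 0 + δ 1 1 - (δ 0 0 - δ 1 1)) = 4 * δ 1 1 := by ring
  have hb : 2 * (2 ^ n * δ 0 1) = 2 ^ n * (2 * δ 0 1) := by ring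
  have hc : 2 * (2 ^ n * δ 1 0) = 2 ^ n * (2 * δ 1 0) := by ring
  rw [hm, ha, hb, hc]
  have hκ : star (2 ^ (-3 : ℤ) * (kappa0 : ℂ)) = 2 ^ (-3 : ℤ) * (kappa0 : ℂ) := by
    simp
  have hφ : star (phi' (δ 0 0)) = phi' (δ 0 0) := by
    unfold phi'
    split_ifs <;> simp
  have hφ2 : phi' (δ 0 0) * phi' (δ 0 0) = phi' (δ 0 0) := by
    unfold phi'
    split_ifs <;> simp
  rw [star_mul', star_mul', hκ, hφ]
  -- The two supports ask for integrality of (2ⁿb, c) and of (b, 2ⁿc); together they give b and c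
  -- integral.
  by_cases h : ‖4 * δ 1 1‖ ≤ 1 ∧ ‖2 * δ 0 1‖ ≤ 1 ∧ ‖2 * δ 1 0‖ ≤ 1
  · obtain ⟨h1, h2, h3⟩ := h
    rw [if_pos ⟨h1, (norm_two_pow_mul_le n _).trans h2, h3⟩,
      if_pos ⟨h1, h2, (norm_two_pow_mul_le n _).trans h3⟩, if_pos ⟨h1, h2, h3⟩, star_signSum]
    linear_combination (2 ^ (-3 : ℤ) * (kappa0 : ℂ)) ^ 2 *
      signSum (4 * δ 1 1) (2 ^ n * (2 * δ 0 1)) (2 * δ 1 0) *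
      signSum (4 * δ 1 1) (2 * δ 0 1) (2 ^ n * (2 * δ 1 0)) * hφ2
  · rw [if_neg h, mul_zero, mul_zero]
    by_cases h' : ‖4 * δ 1 1‖ ≤ 1 ∧ ‖2 * δ 0 1‖ ≤ 1 ∧ ‖2 ^ n * (2 * δ 1 0)‖ ≤ 1
    · rw [if_neg fun h'' => h ⟨h''.1, h'.2.1, h''.2.2⟩, mul_zero, mul_zero, zero_mul]
    · rw [if_neg h', star_zero, mul_zero, mul_zero, mul_zero]

/-- The substitution on the left has Jacobian 2·2ⁿ and the four doublings on the right have 2⁴,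
whence the factor 8·2⁻ⁿ. -/
theorem innerM2_dia (hν : ν integralM2 = 1) (n : ℕ) :
    innerM2 ν (AdFun (dia n : PGL2) phi) phi =
      8 * (2 ^ n)⁻¹ * (2 ^ (-3 : ℤ) * (kappa0 : ℂ)) ^ 2 * ∫ δ, coeffFun n δ ∂ν := by
  set H : M2 → ℂ := fun β => phi (conjM2 (dia n)⁻¹ β) * star (phi β) with hH
  have h1 : innerM2 ν (AdFun (dia n : PGL2) phi) phi = ∫ β, H β ∂ν := rfl
  have h2 : ∫ δ, H (reflectDiag (scaleEntry 1 1 twoUnit (shearDiag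
      (scaleEntry 1 0 (twoUnit ^ n) δ)))) ∂ν = 2 ^ n * (2 * ∫ β, H β ∂ν) := by
    rw [integral_scaleEntry_two_pow hν 1 0 n
        fun δ => H (reflectDiag (scaleEntry 1 1 twoUnit (shearDiag δ))),
      integral_comp_linearEquiv_of_lattice hν shearDiag shearDiag_mem_integralM2_iff
        fun δ => H (reflectDiag (scaleEntry 1 1 twoUnit δ)),
      integral_scaleEntry_two hν 1 1 fun δ => H (reflectDiag δ),
      integral_comp_linearEquiv_of_lattice hν reflectDiag reflectDiag_mem_integralM2_iff]
  have h3 : ∫ δ, coeffFun n (scaleEntry 1 1 twoUnit (scaleEntry 1 1 twoUnit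
      (scaleEntry 0 1 twoUnit (scaleEntry 1 0 twoUnit δ)))) ∂ν = 16 * ∫ δ, coeffFun n δ ∂ν := by
    rw [integral_scaleEntry_two hν 1 0 fun δ => coeffFun n (scaleEntry 1 1 twoUnit
        (scaleEntry 1 1 twoUnit (scaleEntry 0 1 twoUnit δ))),
      integral_scaleEntry_two hν 0 1 fun δ => coeffFun n (scaleEntry 1 1 twoUnit
        (scaleEntry 1 1 twoUnit δ)),
      integral_scaleEntry_two hν 1 1 fun δ => coeffFun n (scaleEntry 1 1 twoUnit δ),
      integral_scaleEntry_two hν 1 1]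
    ring
  simp only [hH, phi_mul_star_phi] at h2
  rw [integral_const_mul, h3] at h2
  change _ = 2 ^ n * (2 * ∫ β, H β ∂ν) at h2
  have hn : ((2 : ℂ) ^ n)⁻¹ * 2 ^ n = 1 := inv_mul_cancel₀ (pow_ne_zero _ two_ne_zero)
  rw [h1]
  generalize ((2 : ℂ) ^ n)⁻¹ = u at *
  generalize (2 : ℂ) ^ n = v at *
  linear_combination (-(u / 2)) * h2 - (∫ β, H β ∂ν) * hn

theorem signSum_congr {a b c a' b' c' : ℚ_[2]} (ha : ‖a - a'‖ < 1) (hb : ‖b - b'‖ < 1)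
    (hc : ‖c - c'‖ < 1) : signSum a b c = signSum a' b' c' := by
  have key : ∀ {x y x' y' : ℚ_[2]}, ‖x - x'‖ < 1 → ‖y - y'‖ < 1 →
      sgn2 (x + y) = sgn2 (x' + y') := fun {x y x' y'} h h' => by
    refine sgn2_congr (norm_lt_one_congr ?_)
    rw [add_sub_add_comm]
    exact (Padic.nonarchimedean _ _).trans_lt (max_lt h h')
  rw [signSum, signSum, key hb hc, key ha hc, key ha hb]

theorem integral_coeffFun (hν : ν integralM2 = 1) (n : ℕ) :
    ∫ δ, coeffFun n δ ∂ν = 1 / 16 * ∑ p, coeffFun n (residueRep p) := by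
  refine integral_eq_sum_residueRep hν (fun β hβ => ?_) fun ε hε β hβ => ?_
  · unfold coeffFun
    rw [mem_integralM2_iff_entries] at hβ
    by_cases h : ‖β 1 1‖ ≤ 1 ∧ ‖β 0 1‖ ≤ 1 ∧ ‖β 1 0‖ ≤ 1
    · rw [phi', if_neg, zero_mul]
      exact fun h0 => hβ ⟨h0.le, h.2.1, h.2.2, h.1⟩
    · rw [if_neg h, mul_zero]
  · have hβ' := mem_integralM2_of_mem_residueClass hε hβ
    have hpow : ∀ i j, ‖2 ^ n * β i j - 2 ^ n * ε i j‖ < 1 := fun i j => by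
      rw [← mul_sub]
      exact (norm_two_pow_mul_le n _).trans_lt (hβ i j)
    have hm : phi' (β 0 0) = phi' (ε 0 0) := by
      simp only [phi', norm_eq_one_iff, hβ' 0 0, hε 0 0, norm_lt_one_congr (hβ 0 0)]
    unfold coeffFun
    rw [hm, if_pos ⟨hβ' 1 1, hβ' 0 1, hβ' 1 0⟩, if_pos ⟨hε 1 1, hε 0 1, hε 1 0⟩,
      signSum_congr (hβ 1 1) (hpow 0 1) (hβ 1 0), signSum_congr (hβ 1 1) (hβ 0 1) (hpow 1 0)]

/-! ### Character sums modulo 2 -/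

theorem sgn2_zero : sgn2 0 = 1 := by simp [sgn2]

theorem sgn2_one : sgn2 1 = -1 := by simp [sgn2]

theorem sgn2_two : sgn2 2 = 1 := by
  rw [sgn2, norm_two_padic]
  norm_num

/-- The residue of m must be odd. Over the eight triples (a,b,c), the square of a sum of three
distinct characters sums to 3·8. -/
theorem sum_coeffFun_zero : ∑ p, coeffFun 0 (residueRep p) = 24 := by
  have h2 : (1 : ℚ_[2]) + 1 = 2 := one_add_one_eq_two
  simp [Fintype.sum_prod_type, Fin.sum_univ_two, coeffFun, residueRep, signSum, phi', h2, sgn2_zero,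
    sgn2_one, sgn2_two]
  norm_num

/-- With 2ⁿ⁺¹b and 2ⁿ⁺¹c even, the two factors are sums over the characters c, a+c, a and b, a, a+b;
only a is common, which leaves 8. -/
theorem sum_coeffFun_succ (n : ℕ) : ∑ p, coeffFun (n + 1) (residueRep p) = 8 := by
  have hp : ‖(2 : ℚ_[2]) ^ (n + 1)‖ < 1 := by
    rw [norm_pow, norm_two_padic]
    exact pow_lt_one₀ (by norm_num) (by norm_num) (Nat.succ_ne_zero n)
  have hb : ∀ a c : ℚ_[2], signSum a (2 ^ (n + 1)) c = signSum a 0 c := fun a c =>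
    signSum_congr (by simp) (by simpa using hp) (by simp)
  have hc : ∀ a b : ℚ_[2], signSum a b (2 ^ (n + 1)) = signSum a b 0 := fun a b =>
    signSum_congr (by simp) (by simp) (by simpa using hp)
  have h2 : (1 : ℚ_[2]) + 1 = 2 := one_add_one_eq_two
  simp [Fintype.sum_prod_type, Fin.sum_univ_two, coeffFun, residueRep, phi', hb, hc]
  simp [signSum, h2, sgn2_zero, sgn2_one, sgn2_two]
  norm_num

theorem innerM2_dia_zero (hν : ν integralM2 = 1) :
    innerM2 ν (AdFun (dia 0 : PGL2) phi) phi = ((2 ^ (-4 : ℤ) * kappa0 ^ 2 * 3 : ℝ) : ℂ) := by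
  rw [innerM2_dia hν, integral_coeffFun hν, sum_coeffFun_zero]
  push_cast
  ring

theorem innerM2_dia_succ (hν : ν integralM2 = 1) (n : ℕ) :
    innerM2 ν (AdFun (dia (n + 1) : PGL2) phi) phi =
      ((2 ^ (-4 : ℤ) * kappa0 ^ 2 * (2 ^ (n + 1))⁻¹ : ℝ) : ℂ) := by
  rw [innerM2_dia hν, integral_coeffFun hν, sum_coeffFun_succ]
  push_cast
  ring

end Measure

/-- At 1/2 the Euler factor is 2/(3 − s) with s = √2 λ(2), and ζ₂(2) = 4/3. -/
theorem eulerFactorTwo_div_zetaLocal {lam : ℕ → ℝ} (h : |√2 * lam 2| < 3) :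
    eulerFactorTwo lam (1 / 2) / zetaLocal 2 2 = 3 / (2 * (3 - √2 * lam 2)) := by
  have h1 : (2 : ℝ) ^ (-(1 / 2) : ℝ) = √2 / 2 := by
    rw [Real.rpow_neg zero_le_two, ← Real.sqrt_eq_rpow, inv_eq_iff_eq_inv, inv_div,
      Real.div_sqrt]
  have h2 : (2 : ℝ) ^ (-(2 * (1 / 2)) : ℝ) = 1 / 2 := by
    norm_num [Real.rpow_neg]
  have h3 : zetaLocal 2 2 = 4 / 3 := by
    norm_num [zetaLocal, Real.rpow_neg]
  have h4 : 3 - √2 * lam 2 ≠ 0 := by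
    have := (abs_lt.1 h).2
    linarith
  have h5 : 1 - lam 2 * (√2 / 2) + 1 / 2 = (3 - √2 * lam 2) / 2 := by ring
  rw [eulerFactorTwo, h1, h2, h3, h5]
  field_simp
  norm_num

end

/-! ### Assembling the integral -/

theorem mainTheorem7
    -- the quaternion algebra, a maximal order in it, and the embedding in `M₂(ℚ₂)`
    (a b : ℚ) (hB : IsRamifiedAtInftyAnd23 a b)
    (R : Subring ℍ[ℚ, a, b]) (hR : Maximal IsOrder R)
    (ι : ℍ[ℚ, a, b] →ₐ[ℚ] M2) (hι : ∀ x ∈ R, ι x ∈ integralM2)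
    -- the Haar measure on `GL₂(ℚ₂)`, a fundamental domain for `Γ`, the eigenfunctions
    (μ : Measure GL2) (hμ : μ.IsHaarMeasure) (hμK : μ (K2 : Set GL2) = 2)
    (D : Set GL2) (hD : IsFundamentalDomain (Gam R ι) D μ)
    (Ψ : Fin 2 → FunY R ι) (lam : Fin 2 → ℕ → ℝ) (hΨ : IsHeckeBasis μ D Ψ lam)
    -- the self-dual measure on `M₂(ℚ₂)`
    (ψ : AddChar ℚ_[2] Circle) (hψ : IsUnramifiedChar ψ)
    (ν : Measure M2) (hν : ν.IsAddHaarMeasure) (hνψ : IsSelfDual ψ ν)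
    -- the Haar measure on `PGL₂(ℚ₂)`
    (ρ : Measure PGL2) (hρ : ρ.IsHaarMeasure) (hρK : ρ (PK2 : Set PGL2) = 1)
    (k : Fin 2) :
    IsSchwartzBruhat phi ∧
    Integrable (fun g : PGL2 => innerM2 ν (AdFun g phi) phi * (Xi μ D (Ψ k) g : ℂ)) ρ ∧
    ∫ g : PGL2, innerM2 ν (AdFun g phi) phi * (Xi μ D (Ψ k) g : ℂ) ∂ρ =
      ((2 ^ (-4 : ℤ) * kappa0 ^ 2 *
        (2 + eulerFactorTwo (lam k) (1 / 2) / zetaLocal 2 2) : ℝ) : ℂ) := by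
  refine ⟨isSchwartzBruhat_phi, ?_⟩
  have hνL := measure_integralM2 hψ hνψ
  have hμ' : μ (K2 : Set GL2) ≠ ⊤ := by rw [hμK]; exact ENNReal.ofNat_ne_top
  have hs := abs_eigenvalue_lt_three hB hR.prop hμ' hD hΨ k
  set s := √2 * lam k 2 with hs_def
  set ξ : ℕ → ℝ := fun n => matCoeff μ D (Ψ k) (dia n) with hξ
  have hrec : ∀ n, ξ n + 2 * ξ (n + 2) = s * ξ (n + 1) :=
    matCoeff_dia_add_two hR.prop hΨ hμ' hD k
  have h0 : ξ 0 = 1 := matCoeff_dia_zero hΨ k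
  have hsum := hasSum_of_recurrence hs hrec h0 (matCoeff_dia_one hR.prop hΨ hμ' hD k)
  have habs := (summable_nat_add_iff 1).2 (summable_of_recurrence hs hrec)
  set C : ℝ := 2 ^ (-4 : ℤ) * kappa0 ^ 2 with hC
  set c : ℕ → ℂ := fun n => innerM2 ν (AdFun (dia n : PGL2) phi) phi * (ξ n : ℂ) with hc
  have hc0 : c 0 = ((C * 3 : ℝ) : ℂ) := by
    simp only [hc, h0, innerM2_dia_zero hνL, Complex.ofReal_one, mul_one]
    rfl
  have hc1 : ∀ n, c (n + 1) = ((C * (2 ^ (n + 1))⁻¹ * ξ (n + 1) : ℝ) : ℂ) := fun n => by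
    simp only [hc, innerM2_dia_succ hνL]
    rw [← Complex.ofReal_mul]
  have hp : ∀ n : ℕ, (2 : ℝ) ^ n * (2 ^ (n + 1))⁻¹ = 1 / 2 := fun n => by
    rw [pow_succ, mul_inv, mul_inv_cancel_left₀ (pow_ne_zero n two_ne_zero), one_div]
  have key := integrable_of_const_on_spheres hρK (c := c)
    (f := fun g : PGL2 => innerM2 ν (AdFun g phi) phi * (Xi μ D (Ψ k) g : ℂ)) ?_ ?_
  · refine ⟨key.1, key.2.trans ?_⟩
    -- The growth 3·2ⁿ of the sphere of radius n + 1 cancels the decay 2⁻ⁿ⁻¹ of the coefficient of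
    -- φ, leaving the factor 3/2.
    have ht : ∀ n : ℕ, 3 * 2 ^ n * c (n + 1) = ((C * (3 / 2) * ξ (n + 1) : ℝ) : ℂ) := fun n => by
      have e : 3 * 2 ^ n * (C * (2 ^ (n + 1))⁻¹ * ξ (n + 1)) = C * (3 / 2) * ξ (n + 1) := by
        linear_combination 3 * C * ξ (n + 1) * hp n
      rw [hc1, ← e]
      push_cast
      ring
    simp only [ht]
    rw [← Complex.ofReal_tsum, (hsum.mul_left (C * (3 / 2))).tsum_eq, hc0,
      eulerFactorTwo_div_zetaLocal hs, ← Complex.ofReal_add, ← hs_def]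
    congr 1
    have h4 : 3 - s ≠ 0 := by
      have := (abs_lt.1 hs).2
      linarith
    field_simp
    ring
  · intro n x hx
    have h1 := innerM2_eq_of_mem_sphere hνL hx
    have h2 : Xi μ D (Ψ k) x = ξ n := by
      induction x using QuotientGroup.induction_on with
      | H g => exact matCoeff_eq_of_inCartan hμ' hD (Ψ k) (mk_mem_sphere.1 hx)
    simp only [h1, h2, hc]
  -- By the same cancellation, absolute convergence reduces to that of Σ|ξₙ|.
  · refine (habs.mul_left (|C| / 2)).congr fun n => ?_
    rw [hc1, Complex.norm_real, Real.norm_eq_abs, abs_mul (C * _), abs_mul C,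
      abs_of_pos (by positivity : (0 : ℝ) < (2 ^ (n + 1))⁻¹)]
    linear_combination (-(|C| * |ξ (n + 1)|)) * hp n
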